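/- Let $k$ be an algebraically closed field of characteristic zero, $C$ an integral smooth quasi-projective curve over $k$ with function field $K$, and $\mathcal A$ a hereditary $\mathcal O_C$-order. That is, $\mathcal A$ is a coherent torsion-free sheaf of $\mathcal O_C$-algebras whose generic stalk $D=\mathcal A\otimes_{\mathcal O_C} K$ is a central simple $K$-algebra, and every stalk $\mathcal A_p$ is a hereditary ring. An overorder of $\mathcal A$ is an $\mathcal O_C$-order $\mathcal B$ with $\mathcal A\subseteq\mathcal B\subseteq D$; it is maximal if it has no proper overorder. The ramification locus $\Delta$ is the complement of the largest open subset of $C$ on which $\mathcal A$ is Azumaya. Then $\Delta$ is finite, and for every $p\in\Delta$ there are an integer $r_p$, positive integers $n_1,\dots,n_{r_p}$ with sum $n$, and an isomorphism of $\mathcal O_{C,p}$-algebras $\varphi_p$ from $\mathcal A_p$ onto the algebra of those $n\times n$ block matrices over $\mathcal O_{C,p}$, with blocks of size $n_i\times n_j$, whose blocks strictly below the diagonal have all entries in the maximal ideal. Fix any such data for each $p\in\Delta$ and let $L_p^{(j)}=e_j\mathcal A_p$ and ${}'L_p^{(j)}=\mathcal A_pe_j$ for $1\le j\le r_p$, where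 $e_j\in\mathcal A_p$ corresponds under $\varphi_p$ to the diagonal matrix unit $E_{\alpha,\alpha}$ with $\alpha=n_1+\dots+n_j$. An overorder $\mathcal B$ is called purely of type $j$ at $p$ as a right (left) module if $\mathcal B_p$ is isomorphic to a direct sum of finitely many, and at least one, copies of $L_p^{(j)}$ as a right $\mathcal A_p$-module (of ${}'L_p^{(j)}$ as a left $\mathcal A_p$-module). Then $r_p>1$ for all $p\in\Delta$, and: (i) $\mathcal A$ has precisely $\prod_{p\in\Delta} r_p$ maximal overorders. (ii) Every maximal overorder $\mathcal B$ of $\mathcal A$ is locally projective as a left and as a right $\mathcal A$-module: $C$ is covered by affine open subsets $U$ such that $\mathcal B(U)$ is a finitely generated projective left (right) $\mathcal A(U)$-module. (iii) For every maximal overorder $\mathcal B$ and every $p\in\Delta$ there is exactly one $j$ such that $\mathcal B$ is purely of type $j$ at $p$ as a right module, and exactly one $j$ such that it is so as a left module. If two maximal overorders have the same type as right modules at every $p\in\Delta$, then they are equal. -/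

import Mathlib

universe u v

open AlgebraicGeometry CategoryTheory MulOpposite

noncomputable section

namespace HereditaryOrder

section Rings

/-- A ring is hereditary if all its left ideals and all its right ideals are projective. -/
def IsHereditaryRing (S : Type v) [Ring S] : Prop :=
  (∀ I : Submodule S S, Module.Projective S I) ∧
    ∀ I : Submodule Sᵐᵒᵖ S, Module.Projective Sᵐᵒᵖ I

variable {S T : Type v} [Ring S] [Ring T]

/-- `T` as a left `S`-module along a ring homomorphism `S → T`. -/
abbrev leftModule (φ : S →+* T) : Module S T := Module.compHom T φ

/-- `T` as a right `S`-module along a ring homomorphism `S → T`. -/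
abbrev rightModule (φ : S →+* T) : Module Sᵐᵒᵖ T := Module.compHom T (RingHom.op φ)

/-- `T` is a finitely generated projective left `S`-module. -/
def IsLeftFGProjective (φ : S →+* T) : Prop :=
  letI := leftModule φ
  Module.Finite S T ∧ Module.Projective S T

/-- `T` is a finitely generated projective right `S`-module. -/
def IsRightFGProjective (φ : S →+* T) : Prop :=
  letI := rightModule φ
  Module.Finite Sᵐᵒᵖ T ∧ Module.Projective Sᵐᵒᵖ T

/-- The right `S`-module `T` is isomorphic to `L ^ k` for some `k > 0`, where `L` is a right
ideal of `S`. -/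
def IsRightPower (φ : S →+* T) (L : Submodule Sᵐᵒᵖ S) : Prop :=
  letI := rightModule φ
  ∃ k : ℕ, 0 < k ∧ Nonempty (T ≃ₗ[Sᵐᵒᵖ] (Fin k → L))

/-- The left `S`-module `T` is isomorphic to `L ^ k` for some `k > 0`, where `L` is a left
ideal of `S`. -/
def IsLeftPower (φ : S →+* T) (L : Submodule S S) : Prop :=
  letI := leftModule φ
  ∃ k : ℕ, 0 < k ∧ Nonempty (T ≃ₗ[S] (Fin k → L))

end Rings

section Standard

variable (R : Type u) [CommRing R] [IsLocalRing R] {r : ℕ} (n : Fin r → ℕ)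

/-- The standard block order in `Mat_n(R)`, with `n = n₁ + ⋯ + n_r`: block matrices whose blocks
strictly below the diagonal have entries in the maximal ideal. Row `(i, s)` is the `s`-th row of
the `i`-th block. -/
def blockOrder : Subalgebra R (Matrix (Σ i, Fin (n i)) (Σ i, Fin (n i)) R) where
  carrier := {M | ∀ a b, b.1 < a.1 → M a b ∈ IsLocalRing.maximalIdeal R}
  mul_mem' {M N} hM hN a b hab := by
    rw [Matrix.mul_apply]
    refine Ideal.sum_mem _ fun c _ => ?_
    rcases lt_or_ge c.1 a.1 with h | h
    · exact Ideal.mul_mem_right _ _ (hM a c h)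
    · exact Ideal.mul_mem_left _ _ (hN c b (hab.trans_le h))
  add_mem' {M N} hM hN a b hab := Ideal.add_mem _ (hM a b hab) (hN a b hab)
  algebraMap_mem' x a b hab := by
    have : a ≠ b := fun h => by simp [h] at hab
    simp [Matrix.algebraMap_matrix_apply, this]

variable {n}

/-- The elementary matrix `E_{α,α}`, where `α = n₁ + ⋯ + n_j` is the last index of the `j`-th
block. -/
def blockIdempotent (hn : ∀ i, 0 < n i) (j : Fin r) : blockOrder R n :=
  ⟨Matrix.single ⟨j, n j - 1, Nat.sub_lt (hn j) one_pos⟩ ⟨j, n j - 1, Nat.sub_lt (hn j) one_pos⟩ 1,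
    fun a b hab => by
      rw [Matrix.single_apply, if_neg]
      · exact Ideal.zero_mem _
      · rintro ⟨rfl, rfl⟩
        exact lt_irrefl _ hab⟩

end Standard

section Sheaves

variable (X : Scheme.{u}) [IsIntegral X] (D : Type v) [Ring D] [Algebra X.functionField D]

/-- An algebra over the function field is an algebra over the sections on any nonempty open. -/
instance (priority := 50) sectionsAlgebra (U : X.Opens) [Nonempty U] : Algebra Γ(X, U) D :=
  Algebra.compHom D (algebraMap Γ(X, U) X.functionField)

/-- An algebra over the function field is an algebra over every local ring. -/
instance (priority := 50) stalkAlgebra (p : X) : Algebra (X.presheaf.stalk p) D :=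
  Algebra.compHom D (algebraMap (X.presheaf.stalk p) X.functionField)

/-- An `𝒪_X`-order in the `K(X)`-algebra `D`: a coherent sheaf of `𝒪_X`-subalgebras of the
constant sheaf `D` whose generic stalk is `D`. (A torsion-free coherent sheaf of algebras is a
subsheaf of the constant sheaf given by its generic stalk.) As `X` is irreducible, sections of
the constant sheaf over a nonempty open set are just elements of `D`. -/
@[ext]
structure OrderIn where
  /-- The sections over a nonempty open set. -/
  sections : ∀ (U : X.Opens) [Nonempty U], Subalgebra Γ(X, U) D
  /-- Restriction. -/
  restrict : ∀ (U V : X.Opens) [Nonempty U] [Nonempty V], U ≤ V →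
    ∀ x ∈ sections V, x ∈ sections U
  /-- Being a section is a local condition. -/
  local_mem : ∀ (V : X.Opens) [Nonempty V] (x : D),
    (∀ p ∈ V, ∃ (U : X.Opens) (_ : Nonempty U), p ∈ U ∧ U ≤ V ∧ x ∈ sections U) →
      x ∈ sections V
  /-- Quasi-coherence: sections over `D(f) ⊆ U` are the localization at `f` of those over `U`. -/
  quasiCoherent : ∀ (U : X.Opens) [Nonempty U], IsAffineOpen U →
    ∀ (f : Γ(X, U)) [Nonempty (X.basicOpen f)], ∀ x ∈ sections (X.basicOpen f),
      ∃ m : ℕ, f ^ m • x ∈ sections U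
  /-- Finite type. -/
  finite : ∀ (U : X.Opens) [Nonempty U], IsAffineOpen U → (sections U).toSubmodule.FG
  /-- The generic stalk is `D`. -/
  generic : ∀ x : D, ∃ (U : X.Opens) (_ : Nonempty U), x ∈ sections U

variable {X D}

namespace OrderIn

/-- Inclusion of subsheaves of `D`. -/
instance : PartialOrder (OrderIn X D) where
  le A B := ∀ (U : X.Opens) [Nonempty U], A.sections U ≤ B.sections U
  le_refl _ _ _ := le_rfl
  le_trans _ _ _ h h' U _ := (h U).trans (h' U)
  le_antisymm A B h h' := by
    ext U hU x
    exact ⟨fun hx => h U hx, fun hx => h' U hx⟩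

/-- The stalk at `p`, i.e. the union of the sections over the open neighbourhoods of `p`. -/
def stalk (A : OrderIn X D) (p : X) : Subalgebra (X.presheaf.stalk p) D where
  carrier := {x | ∃ (U : X.Opens) (_ : Nonempty U), p ∈ U ∧ x ∈ A.sections U}
  mul_mem' := by
    rintro x y ⟨U, hU, hpU, hx⟩ ⟨V, hV, hpV, hy⟩
    have : Nonempty (U ⊓ V : X.Opens) := ⟨⟨p, hpU, hpV⟩⟩
    exact ⟨U ⊓ V, this, ⟨hpU, hpV⟩,
      mul_mem (A.restrict _ U inf_le_left _ hx) (A.restrict _ V inf_le_right _ hy)⟩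
  add_mem' := by
    rintro x y ⟨U, hU, hpU, hx⟩ ⟨V, hV, hpV, hy⟩
    have : Nonempty (U ⊓ V : X.Opens) := ⟨⟨p, hpU, hpV⟩⟩
    exact ⟨U ⊓ V, this, ⟨hpU, hpV⟩,
      add_mem (A.restrict _ U inf_le_left _ hx) (A.restrict _ V inf_le_right _ hy)⟩
  algebraMap_mem' := by
    intro s
    obtain ⟨U, hpU, t, rfl⟩ := X.presheaf.exists_germ_eq s
    have : Nonempty U := ⟨⟨p, hpU⟩⟩
    refine ⟨U, this, hpU, ?_⟩
    have h : algebraMap (X.presheaf.stalk p) D (X.presheaf.germ U p hpU t) =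
        algebraMap Γ(X, U) D t := by
      change algebraMap X.functionField D (algebraMap (X.presheaf.stalk p) X.functionField _) =
        algebraMap X.functionField D (algebraMap Γ(X, U) X.functionField t)
      rw [Scheme.algebraMap_germ_eq_germToFunctionField]
      rfl
    rw [h]
    exact (A.sections U).algebraMap_mem t

theorem stalk_mono {A B : OrderIn X D} (h : A ≤ B) (p : X) : A.stalk p ≤ B.stalk p := by
  rintro x ⟨U, hU, hp, hx⟩
  exact ⟨U, hU, hp, h U hx⟩

/-- The order is hereditary: all its stalks are hereditary rings. -/
def IsHereditary (A : OrderIn X D) : Prop := ∀ p : X, IsHereditaryRing (A.stalk p)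

/-- The ramification locus: the complement of the largest open subset on which the order is
Azumaya. -/
def ramificationLocus (A : OrderIn X D) : Set X :=
  {p | ¬ ∃ U : X.Opens, p ∈ U ∧ ∀ q ∈ U, IsAzumaya (X.presheaf.stalk q) (A.stalk q)}

/-- The maximal overorders of `A`: orders in `D` that contain `A` and have no proper overorder. -/
def maximalOverorders (A : OrderIn X D) : Set (OrderIn X D) :=
  {B | A ≤ B ∧ ∀ B' : OrderIn X D, B ≤ B' → B' = B}

/-- The inclusion of sections over `U`. -/
def sectionsHom {A B : OrderIn X D} (h : A ≤ B) (U : X.Opens) [Nonempty U] :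
    A.sections U →+* B.sections U :=
  (Subalgebra.inclusion (h U) : A.sections U →ₐ[Γ(X, U)] B.sections U)

/-- The inclusion of stalks at `p`. -/
def stalkHom {A B : OrderIn X D} (h : A ≤ B) (p : X) : A.stalk p →+* B.stalk p :=
  (Subalgebra.inclusion (stalk_mono h p) : A.stalk p →ₐ[X.presheaf.stalk p] B.stalk p)

/-- The overorder `B` is a locally projective left `A`-module: `X` is covered by affine opens `U`
such that `B(U)` is a finitely generated projective left `A(U)`-module. -/
def IsLeftLocallyProjective {A B : OrderIn X D} (h : A ≤ B) : Prop :=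
  ∀ p : X, ∃ (U : X.Opens) (_ : Nonempty U), p ∈ U ∧ IsAffineOpen U ∧
    IsLeftFGProjective (sectionsHom h U)

/-- The overorder `B` is a locally projective right `A`-module. -/
def IsRightLocallyProjective {A B : OrderIn X D} (h : A ≤ B) : Prop :=
  ∀ p : X, ∃ (U : X.Opens) (_ : Nonempty U), p ∈ U ∧ IsAffineOpen U ∧
    IsRightFGProjective (sectionsHom h U)

/-- Ramification data `(n₁, …, n_r)` of `A` at `p`, together with an isomorphism of
`𝒪_{X,p}`-algebras from the stalk to the standard block order. -/
structure RamificationData (A : OrderIn X D) (p : X) where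
  /-- The number of blocks; this is the ramification index if it is at least two. -/
  r : ℕ
  /-- The sizes of the blocks. -/
  n : Fin r → ℕ
  n_pos : ∀ i, 0 < n i
  /-- The isomorphism. -/
  equiv : A.stalk p ≃ₐ[X.presheaf.stalk p] blockOrder (X.presheaf.stalk p) n

namespace RamificationData

variable {A : OrderIn X D} {p : X} (d : A.RamificationData p)

/-- The idempotent of the stalk that corresponds to `E_{α,α}`, with `α` the last index of the
`j`-th block. -/
def idempotent (j : Fin d.r) : A.stalk p :=
  d.equiv.symm (blockIdempotent (X.presheaf.stalk p) d.n_pos j)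

/-- The indecomposable projective right module `E_{α,α} A_p` (a row). -/
def row (j : Fin d.r) : Submodule (A.stalk p)ᵐᵒᵖ (A.stalk p) :=
  Submodule.span _ {d.idempotent j}

/-- The indecomposable projective left module `A_p E_{α,α}` (a column). -/
def column (j : Fin d.r) : Submodule (A.stalk p) (A.stalk p) :=
  Submodule.span _ {d.idempotent j}

/-- The overorder `B`, as a right `A`-module, is purely of type `j` at `p`. -/
def IsPurelyOfType {B : OrderIn X D} (h : A ≤ B) (j : Fin d.r) : Prop :=
  IsRightPower (stalkHom h p) (d.row j)

/-- The overorder `B`, as a left `A`-module, is purely of type `j` at `p`. -/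
def IsLeftPurelyOfType {B : OrderIn X D} (h : A ≤ B) (j : Fin d.r) : Prop :=
  IsLeftPower (stalkHom h p) (d.column j)

end RamificationData

end OrderIn

end Sheaves

end HereditaryOrder

end

/-!
By Tsen's theorem the generic algebra is a matrix algebra over `K`. The stalk of the order at a
closed point `p` is then an order in `End V` over a discrete valuation ring. When it is hereditary,
the lattices in `V` that it stabilizes are, up to scaling, a periodic chain of some length `r p`,
and in a basis adapted to the chain it is the block order. It is the intersection of the orders
`End L`, for `L` in the chain, and every order above it is contained in one of them. So there are
`r p` maximal ones, and the type of `End L`, on either side, is the position of `L` in the chain.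

The order is Azumaya, hence maximal, at all but finitely many points, and an order is the
intersection of its stalks, which can be prescribed freely at finitely many closed points. So the
maximal overorders correspond to a choice of one of the `r p` local ones at each ramified `p`.
Projectivity over the stalks is a dual basis, which spreads out to a neighbourhood.
-/

noncomputable section

namespace HereditaryOrder

section Tsen

open Polynomial

section CommonZeros

variable {k σ : Type*} [Field k]

theorem height_vanishingIdeal_singleton_eq (x y : σ → k) :
    (MvPolynomial.vanishingIdeal k {x}).height = (MvPolynomial.vanishingIdeal k {y}).height := by
  let translate (z : σ → k) : MvPolynomial σ k →ₐ[k] MvPolynomial σ k :=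
    MvPolynomial.aeval fun i => MvPolynomial.X i + MvPolynomial.C (z i)
  let e : MvPolynomial σ k ≃ₐ[k] MvPolynomial σ k :=
    AlgEquiv.ofAlgHom (translate (x - y)) (translate (y - x))
      (by ext1; simp [translate]; ring) (by ext1; simp [translate]; ring)
  have h : (MvPolynomial.aeval y).comp (translate (x - y)) = MvPolynomial.aeval (R := k) x := by
    ext; simp [translate]
  rw [← RingEquiv.height_comap e.toRingEquiv (MvPolynomial.vanishingIdeal k {y})]
  congr 1
  ext p
  simp only [Ideal.mem_comap, MvPolynomial.mem_vanishingIdeal_singleton_iff]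
  rw [← h]
  rfl

variable [IsAlgClosed k] [Fintype σ]

theorem card_le_height_vanishingIdeal_singleton (x : σ → k) :
    (Fintype.card σ : ℕ∞) ≤ (MvPolynomial.vanishingIdeal k {x}).height := by
  have hdim : ringKrullDim (MvPolynomial σ k) ≤ (MvPolynomial.vanishingIdeal k {x}).height := by
    rw [ringKrullDim_le_iff_isMaximal_height_le]
    intro m hm
    obtain ⟨y, rfl⟩ := MvPolynomial.eq_vanishingIdeal_singleton_of_isMaximal k hm
    rw [height_vanishingIdeal_singleton_eq x y]
  have h := (ringKrullDim_add_natCard_le_ringKrullDim_mvPolynomial (R := k) σ).trans hdim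
  rw [ringKrullDim_eq_zero_of_field, zero_add, Nat.card_eq_fintype_card] at h
  exact_mod_cast h

theorem exists_ne_zero_forall_aeval_eq_zero {τ : Type*} [Fintype τ]
    (hcard : Fintype.card τ < Fintype.card σ) (f : τ → MvPolynomial σ k)
    (hf : ∀ j, MvPolynomial.aeval (0 : σ → k) (f j) = 0) :
    ∃ x : σ → k, x ≠ 0 ∧ ∀ j, MvPolynomial.aeval x (f j) = 0 := by
  classical
  by_contra! hne
  let I := Ideal.span ((Finset.univ.image f : Finset _) : Set (MvPolynomial σ k))
  have hzero : MvPolynomial.zeroLocus k I = {0} := by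
    rw [MvPolynomial.zeroLocus_span]
    ext x
    simp only [Finset.coe_image, Finset.coe_univ, Set.image_univ, Set.forall_mem_range,
      Set.mem_ofPred_eq, Set.mem_singleton_iff]
    refine ⟨fun hx => ?_, ?_⟩
    · by_contra h0
      obtain ⟨j, hj⟩ := hne x h0
      exact hj (hx j)
    · rintro rfl
      exact hf
  have hmin : MvPolynomial.vanishingIdeal k {(0 : σ → k)} ∈ I.minimalPrimes := by
    rw [← Ideal.radical_minimalPrimes, ← MvPolynomial.vanishingIdeal_zeroLocus_eq_radical (K := k),
      hzero, Ideal.minimalPrimes_eq_subsingleton_self]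
    rfl
  have hle : Fintype.card σ ≤ (Finset.univ.image f).card := by
    exact_mod_cast (card_le_height_vanishingIdeal_singleton (0 : σ → k)).trans
      (Ideal.height_le_card_of_mem_minimalPrimes_span_finset hmin)
  exact (hle.trans Finset.card_image_le).not_gt hcard

end CommonZeros

section MatrixPencils

variable {ι n : Type*} [Fintype ι] [Fintype n] [DecidableEq n]

theorem natDegree_det_le {R : Type*} [CommRing R] (M : Matrix n n R[X]) (c : ℕ)
    (hM : ∀ a b, (M a b).natDegree ≤ c) : M.det.natDegree ≤ Fintype.card n * c := by
  rw [Matrix.det_apply]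
  refine natDegree_sum_le_of_forall_le _ _ fun s _ => ?_
  refine (natDegree_smul_le _ _).trans ((natDegree_prod_le _ _).trans ?_)
  exact (Finset.sum_le_card_nsmul _ _ c fun i _ => hM _ _).trans (by simp)

theorem natDegree_det_sum_smul_le {R : Type*} [CommRing R] {G : ι → Matrix n n R[X]}
    {z : ι → R[X]} {c m : ℕ} (hG : ∀ i a b, (G i a b).natDegree ≤ c)
    (hz : ∀ i, (z i).natDegree ≤ m) :
    (∑ i, z i • G i).det.natDegree ≤ Fintype.card n * (m + c) := by
  refine natDegree_det_le _ _ fun a b => ?_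
  simp only [Matrix.sum_apply, Matrix.smul_apply, smul_eq_mul]
  exact natDegree_sum_le_of_forall_le _ _ fun i _ =>
    natDegree_mul_le.trans (add_le_add (hz i) (hG i a b))

/- Vanishing of the determinant at the points of `T` amounts to `#T` equations, without constant
term, in the coefficients of the `z i`. -/
theorem exists_natDegree_lt_forall_eval_det_eq_zero {k : Type*} [Field k] [IsAlgClosed k]
    [Nonempty n] (G : ι → Matrix n n k[X]) {m : ℕ} (T : Finset k)
    (hT : T.card < Fintype.card ι * m) :
    ∃ z : ι → k[X], z ≠ 0 ∧ (∀ i, (z i).natDegree < m) ∧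
      ∀ t ∈ T, (∑ i, z i • G i).det.eval t = 0 := by
  classical
  let z (w : ι × Fin m → k) (i : ι) : k[X] := ofFn m fun l => w (i, l)
  let f (t : T) : MvPolynomial (ι × Fin m) k :=
    (∑ i, (∑ l : Fin m, MvPolynomial.X (i, l) * MvPolynomial.C ((t : k) ^ (l : ℕ))) •
      (G i).map fun q => MvPolynomial.C (q.eval (t : k))).det
  have hf (w) (t : T) : MvPolynomial.aeval w (f t) = (∑ i, z w i • G i).det.eval (t : k) := by
    rw [← coe_evalRingHom, RingHom.map_det, AlgHom.map_det]
    congr 1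
    ext a b
    simp [z, Matrix.sum_apply, eval_finsetSum, ofFn_eq_sum_monomial]
  have hz0 : z 0 = 0 := funext fun _ => ofFn_zero m
  obtain ⟨w, hw0, hw⟩ := exists_ne_zero_forall_aeval_eq_zero (by simpa using hT) f
    (fun t => by rw [hf, hz0]; simp [Matrix.det_zero])
  have hm : 1 ≤ m := by
    by_contra! h
    simp [Nat.lt_one_iff.1 h] at hT
  refine ⟨z w, fun h => hw0 ?_, fun i => ofFn_natDegree_lt hm _, fun t ht => hf w ⟨t, ht⟩ ▸ hw _⟩
  ext ⟨i, l⟩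
  exact congrFun (injective_ofFn m ((congrFun h i).trans (ofFn_zero m).symm)) l

end MatrixPencils

section Norms

theorem exists_basis_norm_eq_det (R F D : Type*) [CommRing R] [IsDomain R] [Field F] [Algebra R F]
    [IsFractionRing R F] [Ring D] [Algebra F D] [FiniteDimensional F D] :
    ∃ (d : ℕ) (b : Module.Basis (Fin d) F D) (G : Fin d → Matrix (Fin d) (Fin d) R),
      ∀ z : Fin d → R, Algebra.norm F (∑ i, algebraMap R F (z i) • b i) =
        algebraMap R F (∑ i, z i • G i).det := by
  let b := Module.finBasis F D
  obtain ⟨g, hg⟩ := IsLocalization.exist_integer_multiples_of_finite (nonZeroDivisors R)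
    (fun q : Fin _ × Fin _ × Fin _ => Algebra.leftMulMatrix b (b q.1) q.2.1 q.2.2)
  choose G hG using hg
  have hg0 : algebraMap R F g ≠ 0 := by simp
  refine ⟨_, b.unitsSMul fun _ => Units.mk0 _ hg0, fun i => Matrix.of fun a a' => G (i, a, a'),
    fun z => ?_⟩
  rw [Algebra.norm_eq_matrix_det b, RingHom.map_det]
  congr 1
  ext a a'
  simp only [Module.Basis.unitsSMul_apply, Units.smul_mk0, map_sum, map_smul, Matrix.sum_apply,
    Matrix.smul_apply, RingHom.mapMatrix_apply, Matrix.map_apply, Matrix.of_apply, smul_eq_mul,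
    map_mul, hG]
  exact Finset.sum_congr rfl fun i _ => by rw [Algebra.smul_def]

theorem exists_norm_eq_pow_of_not_commute (F : Type*) {D : Type*} [Field F] [DivisionRing D]
    [Algebra F D] [FiniteDimensional F D] {u v : D} (huv : ¬ Commute u v) (y : D) :
    ∃ (c : F) (e : ℕ), 2 ≤ e ∧ Algebra.norm F y = c ^ e := by
  let L := Algebra.adjoin F {y}
  have hL := Algebra.isMulCommutative_adjoin F (s := {y}) (by simp)
  let _ : CommRing L := { (inferInstance : Ring L) with mul_comm := hL.is_comm.comm }
  let _ : Field L :=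
    (isField_of_isIntegral_of_isField' (R := F) (S := L) (Field.toIsField F)).toField
  have : IsScalarTower F L D := inferInstance
  have : FiniteDimensional L D := Module.Finite.of_restrictScalars_finite F L D
  let y' : L := ⟨y, Algebra.self_mem_adjoin_singleton F y⟩
  refine ⟨Algebra.norm F y', Module.finrank L D, ?_, ?_⟩
  · by_contra! hlt
    have hone : Module.finrank L D = 1 := by
      have : 0 < Module.finrank L D := Module.finrank_pos
      omega
    have hmem (x : D) : x ∈ L := by
      obtain ⟨c, rfl⟩ := (finrank_eq_one_iff_of_nonzero' (1 : D) one_ne_zero).1 hone x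
      change (c : D) * 1 ∈ L
      rw [mul_one]
      exact c.2
    exact huv (congrArg Subtype.val (mul_comm (⟨u, hmem u⟩ : L) ⟨v, hmem v⟩))
  · have h := LinearMap.det_restrictScalars (R := F) (S := L) (A := D) (f := y' • LinearMap.id)
    rw [LinearMap.det_smul, LinearMap.det_id, mul_one, map_pow] at h
    rw [← h, Algebra.norm_apply]
    rfl

theorem exists_eq_pow_of_norm_eq_algebraMap {R F D : Type*} [CommRing R]
    [IsIntegrallyClosed R] [Field F] [Algebra R F] [IsFractionRing R F] [DivisionRing D]
    [Algebra F D] [FiniteDimensional F D] {u v : D} (huv : ¬ Commute u v) {y : D} {P : R}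
    (hP : Algebra.norm F y = algebraMap R F P) : ∃ (q : R) (e : ℕ), 2 ≤ e ∧ P = q ^ e := by
  obtain ⟨c, e, he, hc⟩ := exists_norm_eq_pow_of_not_commute F huv y
  rw [hP] at hc
  obtain ⟨q, rfl⟩ : ∃ q, algebraMap R F q = c :=
    IsIntegrallyClosed.exists_algebraMap_eq_of_isIntegral_pow (n := e) (by omega)
      (hc ▸ isIntegral_algebraMap)
  exact ⟨q, e, he, IsFractionRing.injective R F (by rw [hc, map_pow])⟩

end Norms

theorem mul_card_le_natDegree_pow {k : Type*} [CommRing k] [IsDomain k] {q : k[X]} {e : ℕ}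
    (hq : q ^ e ≠ 0) {T : Finset k} (hT : ∀ t ∈ T, (q ^ e).eval t = 0) :
    e * T.card ≤ (q ^ e).natDegree := by
  rcases eq_or_ne e 0 with rfl | he
  · simp
  rw [natDegree_pow]
  refine Nat.mul_le_mul_left _ (card_le_degree_of_subset_roots fun t ht => ?_)
  rw [mem_roots ((pow_ne_zero_iff he).1 hq), IsRoot.def]
  have := hT t ht
  rwa [eval_pow, pow_eq_zero_iff he] at this

/-- Tsen's theorem. In a noncommutative `D` the norm is a proper power of a rational function, so
a norm form of degree `d` would have, relative to its degree, twice as many zeros as it can. -/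
theorem commute_of_finiteDimensional_ratFunc (k F : Type*) [Field k] [IsAlgClosed k] [Field F]
    [Algebra k[X] F] [IsFractionRing k[X] F] {D : Type*} [DivisionRing D] [Algebra F D]
    [FiniteDimensional F D] (u v : D) : Commute u v := by
  by_contra huv
  obtain ⟨d, b, G, hG⟩ := exists_basis_norm_eq_det k[X] F D
  have : NeZero d := ⟨(Fin.pos_iff_nonempty.2 b.index_nonempty).ne'⟩
  obtain ⟨c, hc⟩ : ∃ c, ∀ i a a', (G i a a').natDegree ≤ c :=
    ⟨Finset.univ.sup fun q : Fin d × Fin d × Fin d => (G q.1 q.2.1 q.2.2).natDegree,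
      fun i a a' => Finset.le_sup (f := fun q : Fin d × Fin d × Fin d =>
        (G q.1 q.2.1 q.2.2).natDegree) (Finset.mem_univ (i, a, a'))⟩
  obtain ⟨T, hTcard⟩ := Infinite.exists_subset_card_eq k (d * (c + 1))
  obtain ⟨z, hz0, hzdeg, hzT⟩ := exists_natDegree_lt_forall_eval_det_eq_zero G (m := c + 2) T (by
    rw [hTcard, Fintype.card_fin]
    exact Nat.mul_lt_mul_of_pos_left (by omega) (NeZero.pos d))
  have hdet : (∑ i, z i • G i).det ≠ 0 := by
    have hy : ∑ i, algebraMap k[X] F (z i) • b i ≠ 0 := fun h => hz0 <| funext fun i => by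
      simpa using Fintype.linearIndependent_iff.1 b.linearIndependent _ h i
    intro h
    have := (IsUnit.mk0 _ hy).map (Algebra.norm F)
    rw [hG, h, map_zero] at this
    exact not_isUnit_zero this
  obtain ⟨q, e, he, hq⟩ := exists_eq_pow_of_norm_eq_algebraMap huv (hG z)
  have hlower := mul_card_le_natDegree_pow (hq ▸ hdet) (hq ▸ hzT)
  have hupper := natDegree_det_sum_smul_le (m := c + 1) hc fun i => Nat.lt_succ_iff.1 (hzdeg i)
  rw [hq, Fintype.card_fin] at hupper
  rw [hTcard] at hlower
  nlinarith [NeZero.pos d, Nat.mul_le_mul_right (d * (c + 1)) he]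

theorem exists_algEquiv_matrix_of_commute {K : Type*} {E : Type v} [Field K] [Ring E] [Algebra K E]
    [FiniteDimensional K E] [Algebra.IsCentral K E] [IsSimpleRing E]
    (hcomm : ∀ (D : Type v) [DivisionRing D] [Algebra K D] [FiniteDimensional K D] (u v : D),
      Commute u v) : ∃ N : ℕ, N ≠ 0 ∧ Nonempty (E ≃ₐ[K] Matrix (Fin N) (Fin N) K) := by
  have : IsArtinianRing E := IsArtinianRing.of_finite K E
  obtain ⟨n, hn, D, _, _, _, ⟨e⟩⟩ := IsSimpleRing.exists_algEquiv_matrix_divisionRing_finite K E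
  have hcen : Algebra.IsCentral K (Matrix (Fin n) (Fin n) D) :=
    Algebra.IsCentral.of_algEquiv K _ _ e
  have hsurj : Function.Surjective (algebraMap K D) := by
    intro x
    have hx : Matrix.scalar (Fin n) x ∈ Subalgebra.center K (Matrix (Fin n) (Fin n) D) := by
      rw [Subalgebra.mem_center_iff]
      intro M
      ext a b
      simp [Matrix.diagonal_mul, Matrix.mul_diagonal, (hcomm D x _).eq]
    obtain ⟨c, hc⟩ := hcen.out hx
    refine ⟨c, ?_⟩
    simpa [Matrix.algebraMap_matrix_apply] using congrFun₂ hc (0 : Fin n) 0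
  exact ⟨n, hn.ne, ⟨e.trans (AlgEquiv.mapMatrix
    (AlgEquiv.ofBijective (Algebra.ofId K D) ⟨(algebraMap K D).injective, hsurj⟩)).symm⟩⟩

theorem exists_algEquiv_matrix_of_finiteDimensional_ratFunc (k F : Type*) [Field k] [IsAlgClosed k]
    [Field F] [Algebra k[X] F] [IsFractionRing k[X] F] {K : Type*} {E : Type v} [Field K]
    [Algebra F K] [FiniteDimensional F K] [Ring E] [Algebra K E] [FiniteDimensional K E]
    [Algebra.IsCentral K E] [IsSimpleRing E] :
    ∃ N : ℕ, N ≠ 0 ∧ Nonempty (E ≃ₐ[K] Matrix (Fin N) (Fin N) K) := by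
  refine exists_algEquiv_matrix_of_commute fun D _ _ _ u v => ?_
  let _ : Algebra F D := Algebra.compHom D (algebraMap F K)
  have : IsScalarTower F K D := IsScalarTower.of_algebraMap_eq fun _ => rfl
  have : FiniteDimensional F D := Module.Finite.trans K D
  exact commute_of_finiteDimensional_ratFunc k F u v

end Tsen

section Curves

open Polynomial

theorem isLocalHom_of_comap_maximalIdeal {A S : Type*} [CommRing A] [CommRing S] [IsLocalRing S]
    [Algebra A S] (P : Ideal A) [P.IsPrime]
    (hP : (IsLocalRing.maximalIdeal S).comap (algebraMap A S) = P)
    (φ : Localization.AtPrime P →+* S)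
    (hφ : ∀ a, φ (algebraMap A (Localization.AtPrime P) a) = algebraMap A S a) : IsLocalHom φ := by
  refine ⟨fun a ha => ?_⟩
  obtain ⟨x, s, rfl⟩ := IsLocalization.exists_mk'_eq P.primeCompl a
  rw [IsLocalization.AtPrime.isUnit_mk'_iff]
  intro hx
  have hs : IsUnit (algebraMap A S s) := by
    by_contra h
    exact s.2 (hP.le ((IsLocalRing.mem_maximalIdeal _).2 h))
  refine (IsLocalRing.mem_maximalIdeal _).1 (hP.ge hx) ?_
  rw [← hφ, ← IsLocalization.mk'_spec (Localization.AtPrime P) x s, map_mul, hφ]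
  exact ha.mul hs

theorem isDiscreteValuationRing_of_formallyUnramified (A : Type*) {S : Type*} [CommRing A]
    [IsPrincipalIdealRing A] [CommRing S] [IsDomain S] [IsLocalRing S]
    [IsNoetherianRing S] [Algebra A S] [Algebra.FormallyUnramified A S]
    [Algebra.EssFiniteType A S] (hS : ¬ IsField S) : IsDiscreteValuationRing S := by
  let P := (IsLocalRing.maximalIdeal S).comap (algebraMap A S)
  let AP := Localization.AtPrime P
  have hunit (y : P.primeCompl) : IsUnit (algebraMap A S y) := by
    by_contra h
    exact y.2 ((IsLocalRing.mem_maximalIdeal _).2 h)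
  let φ : AP →+* S := IsLocalization.lift hunit
  let _ : Algebra AP S := φ.toAlgebra
  have hφ (a : A) : φ (algebraMap A AP a) = algebraMap A S a := IsLocalization.lift_eq hunit a
  have : IsScalarTower A AP S := IsScalarTower.of_algebraMap_eq fun a => (hφ a).symm
  have : IsLocalHom (algebraMap AP S) := isLocalHom_of_comap_maximalIdeal P rfl φ hφ
  have : Algebra.FormallyUnramified AP S := .of_restrictScalars A _ _
  have : Algebra.EssFiniteType AP S := .of_comp A _ _
  have hmax := Algebra.FormallyUnramified.map_maximalIdeal (R := AP) (S := S)
  rw [← Localization.AtPrime.map_eq_maximalIdeal, Ideal.map_map,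
    ← IsScalarTower.algebraMap_eq] at hmax
  obtain ⟨⟨t, ht⟩⟩ := IsPrincipalIdealRing.principal P
  have hprincipal : IsLocalRing.maximalIdeal S = S ∙ algebraMap A S t := by
    rw [← hmax, ht, Ideal.submodule_span_eq, Ideal.map_span, Set.image_singleton]
  exact ((IsDiscreteValuationRing.TFAE S hS).out 0 4 rfl rfl).2 ⟨_, hprincipal⟩

theorem finiteDimensional_fractionRing_of_formallyUnramified {A K : Type*} [CommRing A]
    [IsDomain A] [Field K] [Algebra A K] [Algebra.FormallyUnramified A K]
    [Algebra.EssFiniteType A K] (hinj : Function.Injective (algebraMap A K)) :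
    ∃ _ : Algebra (FractionRing A) K, FiniteDimensional (FractionRing A) K := by
  have : FaithfulSMul A K := (faithfulSMul_iff_algebraMap_injective A K).2 hinj
  let _ := FractionRing.liftAlgebra A K
  have : Algebra.FormallyUnramified (FractionRing A) K := .of_restrictScalars A _ _
  have : Algebra.EssFiniteType (FractionRing A) K := .of_comp A _ _
  exact ⟨inferInstance, Algebra.FormallyUnramified.finite_of_free _ _⟩

theorem formallyUnramified_and_essFiniteType_of_isLocalization {A B S : Type*} [CommRing A]
    [CommRing B] [CommRing S] [Algebra A B] [Algebra B S] [Algebra A S] [IsScalarTower A B S]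
    [Algebra.FormallyUnramified A B] [Algebra.FiniteType A B] (M : Submonoid B)
    [IsLocalization M S] : Algebra.FormallyUnramified A S ∧ Algebra.EssFiniteType A S := by
  have : Algebra.FormallyUnramified B S := .of_isLocalization M
  have : Algebra.EssFiniteType B S := .of_isLocalization _ M
  exact ⟨.comp _ B _, .comp _ B _⟩

theorem exists_etale_polynomial {k : Type u} [Field k] {C : Scheme.{u}}
    (f : C ⟶ Spec (CommRingCat.of k)) [SmoothOfRelativeDimension 1 f] (x : C) :
    ∃ (V : C.Opens) (_ : IsAffineOpen V) (_ : x ∈ V) (φ : k[X] →+* Γ(C, V)), φ.Etale := by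
  obtain ⟨U, hU, V, hV, hx, e, hf⟩ :=
    SmoothOfRelativeDimension.exists_isStandardSmoothOfRelativeDimension (n := 1) (f := f) x
  obtain ⟨g, -, hg⟩ := hf.exists_etale_mvPolynomial
  have hUtop : U = ⊤ := by
    have : Subsingleton (PrimeSpectrum k) := inferInstance
    refine eq_top_iff.2 fun y _ => ?_
    rw [this.elim (α := PrimeSpectrum k) y (f x)]
    exact e hx
  subst hUtop
  let e₁ : k ≃+* Γ(Spec (CommRingCat.of k), ⊤) :=
    (Scheme.ΓSpecIso (CommRingCat.of k)).symm.commRingCatIsoToRingEquiv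
  let e₂ : k[X] ≃+* MvPolynomial (Fin 1) Γ(Spec (CommRingCat.of k), ⊤) :=
    (Polynomial.mapEquiv e₁).trans (MvPolynomial.uniqueAlgEquiv _ (Fin 1)).symm.toRingEquiv
  exact ⟨V, hV, hx, g.comp e₂.toRingHom, RingHom.Etale.stableUnderComposition _ _
    (RingHom.Etale.of_bijective e₂.bijective) hg⟩

section IntegralScheme

variable {X : Scheme.{u}} [IsIntegral X]

theorem genericPoint_mem (U : X.Opens) [h : Nonempty U] : genericPoint X ∈ U :=
  ((genericPoint_spec X).mem_open_set_iff U.isOpen).mpr (by simpa using h)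

theorem primeIdealOf_ne_bot {U : X.Opens} (hU : IsAffineOpen U) {p : X} (hpU : p ∈ U)
    (hp : p ≠ genericPoint X) : (hU.primeIdealOf ⟨p, hpU⟩).asIdeal ≠ ⊥ := by
  intro h
  have : Nonempty U := ⟨⟨p, hpU⟩⟩
  have hgeneric := hU.fromSpec_primeIdealOf ⟨genericPoint X, genericPoint_mem U⟩
  rw [hU.primeIdealOf_genericPoint, genericPoint_eq_bot_of_affine,
    ← show hU.primeIdealOf ⟨p, hpU⟩ = ⊥ from PrimeSpectrum.ext h,
    hU.fromSpec_primeIdealOf] at hgeneric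
  exact hp hgeneric

end IntegralScheme

/-- A Dedekind scheme: an integral Noetherian scheme that is regular of dimension at most one,
i.e. the local rings at the points other than the generic point are discrete valuation rings. -/
class IsDedekindScheme (X : Scheme.{u}) [IsIntegral X] : Prop extends IsNoetherian X where
  isDiscreteValuationRing_stalk :
    ∀ p : X, p ≠ genericPoint X → IsDiscreteValuationRing (X.presheaf.stalk p)

namespace IsDedekindScheme

variable {X : Scheme.{u}} [IsIntegral X] [IsDedekindScheme X]

theorem eq_of_specializes {p q : X} (hp : p ≠ genericPoint X) (h : p ⤳ q) : p = q := by
  have hq : q ≠ genericPoint X := by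
    rintro rfl
    exact hp (h.antisymm (genericPoint_specializes p)).eq
  have := isDiscreteValuationRing_stalk q hq
  have hrange := Scheme.range_fromSpecStalk (X := X) (x := q)
  obtain ⟨y, rfl⟩ : p ∈ Set.range (X.fromSpecStalk q) := hrange ▸ h
  obtain ⟨z, hz⟩ : genericPoint X ∈ Set.range (X.fromSpecStalk q) :=
    hrange ▸ genericPoint_specializes q
  by_cases hy : PrimeSpectrum.asIdeal y = ⊥
  · have hyz : y ⤳ z := (PrimeSpectrum.le_iff_specializes y z).1
      (show PrimeSpectrum.asIdeal y ≤ PrimeSpectrum.asIdeal z from hy ▸ bot_le)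
    have hspec := hyz.map (X.fromSpecStalk q).continuous
    rw [hz] at hspec
    exact absurd (hspec.antisymm (genericPoint_specializes _)).eq hp
  · have hclosed : y = IsLocalRing.closedPoint (X.presheaf.stalk q) :=
      PrimeSpectrum.ext (IsLocalRing.eq_maximalIdeal (PrimeSpectrum.isPrime y |>.isMaximal hy))
    rw [hclosed, Scheme.fromSpecStalk_closedPoint]

theorem isClosed_singleton {p : X} (hp : p ≠ genericPoint X) : IsClosed ({p} : Set X) := by
  rw [← closure_eq_iff_isClosed]
  ext q
  rw [← specializes_iff_mem_closure, Set.mem_singleton_iff]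
  exact ⟨fun h => (eq_of_specializes hp h).symm, fun h => h ▸ specializes_rfl⟩

theorem finite_compl (U : X.Opens) [Nonempty U] : ((U : Set X)ᶜ).Finite := by
  obtain ⟨S, hS, hclosed, hirr, hU⟩ :=
    TopologicalSpace.NoetherianSpace.exists_finite_set_isClosed_irreducible
      (isClosed_compl_iff.2 U.isOpen)
  rw [hU]
  refine hS.sUnion fun Z hZ => ?_
  obtain ⟨x, hx⟩ := QuasiSober.sober (hirr Z hZ) (hclosed Z hZ)
  have hxU : x ∈ (U : Set X)ᶜ := hU ▸ ⟨Z, hZ, hx.mem⟩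
  have hxgen : x ≠ genericPoint X := by
    rintro rfl
    exact hxU (genericPoint_mem U)
  rw [← hx.def, (isClosed_singleton hxgen).closure_eq]
  exact Set.finite_singleton x

theorem isOpen_compl_of_finite {Z : Set X} (hZ : Z.Finite) (hgen : genericPoint X ∉ Z) :
    IsOpen Zᶜ := by
  rw [isOpen_compl_iff, ← Set.biUnion_of_singleton Z]
  exact hZ.isClosed_biUnion fun p hp => isClosed_singleton fun h => hgen (h ▸ hp)

instance isIntegrallyClosed_stalk (p : X) : IsIntegrallyClosed (X.presheaf.stalk p) := by
  rcases eq_or_ne p (genericPoint X) with rfl | hp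
  · exact inferInstanceAs (IsIntegrallyClosed X.functionField)
  · have := isDiscreteValuationRing_stalk p hp
    infer_instance

end IsDedekindScheme

section SmoothCurve

variable {k : Type u} [Field k] {C : Scheme.{u}} [IsIntegral C]

theorem isDedekindScheme_of_smooth (f : C ⟶ Spec (CommRingCat.of k))
    [SmoothOfRelativeDimension 1 f] [QuasiCompact f] : IsDedekindScheme C := by
  have := SmoothOfRelativeDimension.smooth 1 f
  have : IsLocallyNoetherian C := LocallyOfFiniteType.isLocallyNoetherian f
  have : CompactSpace C := QuasiCompact.compactSpace_of_compactSpace f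
  refine { (show IsNoetherian C from {}) with isDiscreteValuationRing_stalk := fun p hp => ?_ }
  obtain ⟨V, hV, hx, φ, hφ⟩ := exists_etale_polynomial f p
  let _ : Algebra k[X] Γ(C, V) := φ.toAlgebra
  have : Algebra.Etale k[X] Γ(C, V) := hφ
  let _ : Algebra Γ(C, V) (C.presheaf.stalk p) := C.presheaf.algebra_section_stalk ⟨p, hx⟩
  let q := (hV.primeIdealOf ⟨p, hx⟩).asIdeal
  have : IsLocalization.AtPrime (C.presheaf.stalk p) q := hV.isLocalization_stalk ⟨p, hx⟩
  let _ : Algebra k[X] (C.presheaf.stalk p) :=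
    ((algebraMap Γ(C, V) (C.presheaf.stalk p)).comp φ).toAlgebra
  have : IsScalarTower k[X] Γ(C, V) (C.presheaf.stalk p) := IsScalarTower.of_algebraMap_eq' rfl
  have ⟨_, _⟩ := formallyUnramified_and_essFiniteType_of_isLocalization (A := k[X])
    (S := C.presheaf.stalk p) q.primeCompl
  have : Nonempty V := ⟨⟨_, hx⟩⟩
  exact isDiscreteValuationRing_of_formallyUnramified k[X]
    (IsLocalization.AtPrime.not_isField Γ(C, V) (primeIdealOf_ne_bot hV hx hp) _)

theorem exists_finiteDimensional_functionField (f : C ⟶ Spec (CommRingCat.of k))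
    [SmoothOfRelativeDimension 1 f] :
    ∃ _ : Algebra (FractionRing k[X]) C.functionField,
      FiniteDimensional (FractionRing k[X]) C.functionField := by
  obtain ⟨V, hV, hx, φ, hφ⟩ := exists_etale_polynomial f (genericPoint C)
  have : Nonempty V := ⟨⟨_, hx⟩⟩
  let _ : Algebra k[X] Γ(C, V) := φ.toAlgebra
  have : Algebra.Etale k[X] Γ(C, V) := hφ
  have : IsFractionRing Γ(C, V) C.functionField :=
    functionField_isFractionRing_of_isAffineOpen C V hV
  let _ : Algebra k[X] C.functionField := ((algebraMap Γ(C, V) C.functionField).comp φ).toAlgebra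
  have : IsScalarTower k[X] Γ(C, V) C.functionField := IsScalarTower.of_algebraMap_eq' rfl
  have ⟨_, _⟩ := formallyUnramified_and_essFiniteType_of_isLocalization (A := k[X])
    (S := C.functionField) (nonZeroDivisors Γ(C, V))
  have : Module.IsTorsionFree k[X] Γ(C, V) := inferInstance
  exact finiteDimensional_fractionRing_of_formallyUnramified
    ((IsFractionRing.injective Γ(C, V) C.functionField).comp
      (FaithfulSMul.algebraMap_injective k[X] Γ(C, V)))

theorem exists_algEquiv_matrix_functionField [IsAlgClosed k] (f : C ⟶ Spec (CommRingCat.of k))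
    [SmoothOfRelativeDimension 1 f] (D : Type v) [Ring D]
    [Algebra C.functionField D] [FiniteDimensional C.functionField D]
    [Algebra.IsCentral C.functionField D] [IsSimpleRing D] :
    ∃ N : ℕ, N ≠ 0 ∧ Nonempty (D ≃ₐ[C.functionField] Matrix (Fin N) (Fin N) C.functionField) := by
  obtain ⟨_, _⟩ := exists_finiteDimensional_functionField f
  exact exists_algEquiv_matrix_of_finiteDimensional_ratFunc k (FractionRing k[X])

end SmoothCurve

end Curves

section AdaptedBasis

theorem exists_adapted_linearIndepOn {k W : Type*} [Field k] [AddCommGroup W] [Module k W]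
    [FiniteDimensional k W] {𝓕 : Set (Submodule k W)} (h𝓕 : IsChain (· ≤ ·) 𝓕)
    (G : Submodule k W) :
    ∃ s : Set W, LinearIndepOn k id s ∧ Submodule.span k s = G ∧
      ∀ F ∈ 𝓕, F ≤ G → Submodule.span k (s ∩ F) = F := by
  induction hG : Module.finrank k G using Nat.strong_induction_on generalizing G with
  | _ n ih =>
  -- it suffices to extend a basis adapted to the members of the chain that are smaller than `G`
  obtain ⟨s, hs, hsG, hsF⟩ : ∃ s : Set W, LinearIndepOn k id s ∧ s ⊆ G ∧
      ∀ F ∈ 𝓕, F < G → Submodule.span k (s ∩ F) = F := by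
    by_cases hex : ∃ F ∈ 𝓕, F < G
    · obtain ⟨H, ⟨hH, hHG⟩, hmax⟩ := WellFounded.has_min
        (wellFounded_gt (α := Submodule k W)) {F | F ∈ 𝓕 ∧ F < G} hex
      obtain ⟨s, hs, hsH, hsF⟩ := ih _ (hG ▸ Submodule.finrank_lt_finrank_of_lt hHG) H rfl
      refine ⟨s, hs, fun x hx => hHG.le (hsH ▸ Submodule.subset_span hx), fun F hF hFG => ?_⟩
      refine hsF F hF ((h𝓕.total hF hH).elim id fun hHF => ?_)
      exact (hHF.eq_or_lt.resolve_right (hmax F ⟨hF, hFG⟩)).ge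
    · exact ⟨∅, linearIndepOn_empty k id, Set.empty_subset _,
        fun F hF hFG => absurd ⟨F, hF, hFG⟩ hex⟩
  obtain ⟨t, htG, hst, hGt, ht⟩ := exists_linearIndepOn_id_extension hs hsG
  have htspan : Submodule.span k t = G := le_antisymm (Submodule.span_le.2 htG) hGt
  refine ⟨t, ht, htspan, fun F hF hFG => ?_⟩
  rcases hFG.eq_or_lt with rfl | hFG
  · rw [Set.inter_eq_left.2 htG, htspan]
  · refine le_antisymm (Submodule.span_le.2 Set.inter_subset_right) ?_
    exact (hsF F hF hFG).ge.trans (Submodule.span_mono (Set.inter_subset_inter_left _ hst))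

open TensorProduct IsLocalRing

variable {R M : Type*} [CommRing R] [IsLocalRing R] [AddCommGroup M] [Module R M]

theorem one_tmul_mem_span_image_iff {F : Submodule R M}
    (hF : maximalIdeal R • (⊤ : Submodule R M) ≤ F) (m : M) :
    1 ⊗ₜ m ∈ Submodule.span (ResidueField R) (TensorProduct.mk R (ResidueField R) M 1 '' F) ↔
      m ∈ F := by
  refine ⟨fun hm => ?_, fun hm => Submodule.subset_span ⟨m, hm, rfl⟩⟩
  rw [← Submodule.restrictScalars_mem R, Submodule.restrictScalars_span R (ResidueField R)
    residue_surjective, ← Submodule.map_span, Submodule.span_eq] at hm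
  obtain ⟨f, hf, hfm⟩ := hm
  have hker : LinearMap.ker (TensorProduct.mk R (ResidueField R) M 1) = maximalIdeal R • ⊤ :=
    LinearMap.ker_tensorProductMk M
  refine (F.sub_mem_iff_left hf).1 (hF (hker ▸ LinearMap.mem_ker.2 ?_))
  rw [map_sub, hfm, TensorProduct.mk_apply, sub_self]

theorem baseChange_repr_one_tmul_eq_zero_iff {ι : Type*} (b : Module.Basis ι R M) (m : M) (i : ι) :
    (b.baseChange (ResidueField R)).repr (1 ⊗ₜ m) i = 0 ↔ b.repr m i ∈ maximalIdeal R := by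
  rw [Module.Basis.baseChange_repr_tmul, Algebra.smul_def, mul_one]
  exact residue_eq_zero_iff _

variable [Module.Finite R M] [Module.Free R M]

theorem exists_basis_one_tmul_eq {s : Set (ResidueField R ⊗[R] M)}
    (hs : LinearIndepOn (ResidueField R) id s) (hspan : Submodule.span (ResidueField R) s = ⊤) :
    ∃ b : Module.Basis s R M, ∀ i, 1 ⊗ₜ b i = (i : ResidueField R ⊗[R] M) := by
  have := Module.finitePresentation_of_projective R M
  choose v hv using TensorProduct.mk_surjective R M (ResidueField R) residue_surjective
  have hv' : TensorProduct.mk R (ResidueField R) M 1 ∘ (fun i : s => v i) = Subtype.val :=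
    funext fun i => hv i
  obtain ⟨b, hb⟩ := Module.exists_basis_of_basis_baseChange (R := R) (fun i : s => v i)
    (by rw [hv']; exact hs) (by rw [hv', Subtype.range_coe, hspan])
    (Module.Flat.rTensor_preserves_injective_linearMap _ Subtype.val_injective)
  exact ⟨b, fun i => by rw [hb]; exact hv i⟩

theorem exists_adapted_basis {𝓕 : Set (Submodule R M)} (h𝓕 : IsChain (· ≤ ·) 𝓕)
    (hmax : ∀ F ∈ 𝓕, maximalIdeal R • ⊤ ≤ F) :
    ∃ (n : ℕ) (b : Module.Basis (Fin n) R M), ∀ F ∈ 𝓕, ∀ m : M,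
      m ∈ F ↔ ∀ i, b i ∉ F → b.repr m i ∈ maximalIdeal R := by
  let bar (F : Submodule R M) : Submodule (ResidueField R) (ResidueField R ⊗[R] M) :=
    Submodule.span _ (TensorProduct.mk R (ResidueField R) M 1 '' F)
  obtain ⟨s, hs, hspan, hsF⟩ := exists_adapted_linearIndepOn (𝓕 := bar '' 𝓕)
    (IsChain.image_of_map_rel _ _ bar (fun _ _ h => Submodule.span_mono (Set.image_mono h)) h𝓕) ⊤
  obtain ⟨b, hb⟩ := exists_basis_one_tmul_eq hs hspan
  suffices hbF : ∀ F ∈ 𝓕, ∀ m : M, m ∈ F ↔ ∀ i, b i ∉ F → b.repr m i ∈ maximalIdeal R by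
    have : Finite s := hs.finite
    exact ⟨_, b.reindex (Finite.equivFin s), fun F hF m => (hbF F hF m).trans
      ((Finite.equivFin s).forall_congr fun i => by
        rw [b.reindex_apply, b.repr_reindex_apply, Equiv.symm_apply_apply])⟩
  refine fun F hF m => ⟨fun hm i hi => ?_, fun hm => ?_⟩
  · rw [← baseChange_repr_one_tmul_eq_zero_iff]
    have hspan_le : Submodule.span _ (s ∩ bar F) ≤
        LinearMap.ker ((b.baseChange (ResidueField R)).coord i) := by
      refine Submodule.span_le.2 fun w ⟨hws, hwF⟩ => ?_
      have hne : (⟨w, hws⟩ : s) ≠ i := by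
        rintro rfl
        exact hi ((one_tmul_mem_span_image_iff (hmax F hF) _).1 (by rwa [hb]))
      rw [SetLike.mem_coe, LinearMap.mem_ker, show w = _ from (hb ⟨w, hws⟩).symm,
        ← Module.Basis.baseChange_apply, Module.Basis.coord_apply, Module.Basis.repr_self,
        Finsupp.single_eq_of_ne hne.symm]
    exact hspan_le ((hsF _ ⟨F, hF, rfl⟩ le_top).ge
      ((one_tmul_mem_span_image_iff (hmax F hF) m).2 hm))
  · rw [← b.linearCombination_repr m]
    refine Submodule.sum_mem _ fun i _ => ?_
    by_cases hi : b i ∈ F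
    · exact F.smul_mem _ hi
    · exact hmax F hF (Submodule.smul_mem_smul (hm i hi) trivial)

end AdaptedBasis

section LocalOrder

variable {R E : Type*} [CommRing R] [Ring E] [Algebra R E]

/-- `A` is an `R`-order in `E`: a subalgebra that is finitely generated as an `R`-module and spans
`E` over the fraction field of `R`. The second condition is stated without the fraction field: every
element of `E` has a nonzero multiple in `A`. -/
def IsLocalOrder (A : Subalgebra R E) : Prop :=
  (Subalgebra.toSubmodule A).FG ∧ ∀ x : E, ∃ r : R, r ≠ 0 ∧ r • x ∈ A

theorem IsLocalOrder.finite {A : Subalgebra R E} (hA : IsLocalOrder A) : Module.Finite R A :=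
  Module.Finite.iff_fg.2 hA.1

variable [IsDomain R]

theorem exists_smul_mem_of_fg {M : Type*} [AddCommGroup M] [Module R M]
    {Q : Submodule R M} (hQ : ∀ x : M, ∃ r : R, r ≠ 0 ∧ r • x ∈ Q) {P : Submodule R M} (hP : P.FG) :
    ∃ r : R, r ≠ 0 ∧ ∀ x ∈ P, r • x ∈ Q := by
  induction P, hP using Submodule.fg_induction with
  | singleton x =>
    obtain ⟨r, hr, hrx⟩ := hQ x
    refine ⟨r, hr, fun y hy => ?_⟩
    obtain ⟨c, rfl⟩ := Submodule.mem_span_singleton.1 hy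
    rw [smul_comm]
    exact Q.smul_mem c hrx
  | sup P P' _ _ ihP ihP' =>
    obtain ⟨r, hr, hrP⟩ := ihP
    obtain ⟨s, hs, hsP⟩ := ihP'
    refine ⟨r * s, mul_ne_zero hr hs, fun x hx => ?_⟩
    obtain ⟨p, hp, q, hq, rfl⟩ := Submodule.mem_sup.1 hx
    rw [smul_add]
    refine add_mem ?_ ?_
    · rw [mul_comm, mul_smul]
      exact Q.smul_mem s (hrP p hp)
    · rw [mul_smul]
      exact Q.smul_mem r (hsP q hq)

theorem IsLocalOrder.map_eq_smul {X Y : Type*} [AddCommGroup X] [Module E X] [Module R X]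
    [IsScalarTower R E X] [AddCommGroup Y] [Module E Y] [Module R Y] [IsScalarTower R E Y]
    [Module.IsTorsionFree R Y] {A : Subalgebra R E} (hA : IsLocalOrder A) {N : Submodule A X}
    (s : N →ₗ[A] Y) {z : E} {x x' : N} (h : (x' : X) = z • (x : X)) : s x' = z • s x := by
  obtain ⟨r, hr, hrz⟩ := hA.2 z
  have hx' : (⟨r • z, hrz⟩ : A) • x = algebraMap R A r • x' := by
    ext
    change (r • z) • (x : X) = algebraMap R E r • (x' : X)
    rw [h, algebraMap_smul, smul_assoc]
  have hs := congrArg s hx'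
  rw [map_smul, map_smul] at hs
  refine (smul_right_injective Y hr ?_).symm
  change r • (z • s x) = r • s x'
  rw [← smul_assoc, ← algebraMap_smul E r (s x')]
  exact hs

end LocalOrder

section Lattices

variable {R K V : Type*} [CommRing R] [IsDomain R] [Field K] [Algebra R K] [IsFractionRing R K]
  [AddCommGroup V] [Module K V] [Module R V] [IsScalarTower R K V] [FiniteDimensional K V]
  {A : Subalgebra R (Module.End K V)}

theorem projective_lattice (hA : IsLocalOrder A)
    (hproj : ∀ I : Submodule A A, Module.Projective A I)
    (L : Submodule A V) [Module.Finite R L] : Module.Projective A L := by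
  rcases subsingleton_or_nontrivial V with _ | _
  · exact Module.Projective.of_free
  obtain ⟨v, hv⟩ := exists_ne (0 : V)
  obtain ⟨φ, hφ⟩ := Module.Projective.exists_dual_eq_one K hv
  -- `w ↦ φ(·) w` embeds `V` into `End V`, and a multiple of it embeds `L` as a left ideal of `A`
  let rankOne : V →ₗ[R] Module.End K V :=
    { toFun w := φ.smulRight w
      map_add' w w' := by ext; simp
      map_smul' c w := by ext w'; exact smul_comm (φ w') c w }
  obtain ⟨r, hr, hrA⟩ := exists_smul_mem_of_fg (Q := Subalgebra.toSubmodule A) hA.2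
    (Submodule.FG.map rankOne
      (Module.Finite.iff_fg (N := L.restrictScalars R).1 ‹Module.Finite R L›))
  let j : L →ₗ[A] A :=
    { toFun l := ⟨r • rankOne l, hrA _ ⟨l, l.2, rfl⟩⟩
      map_add' l l' := Subtype.ext (by simp)
      map_smul' a l := by
        ext w
        change r • (φ w • (a : Module.End K V) l) = (a : Module.End K V) (r • φ w • (l : V))
        rw [LinearMap.map_smul_of_tower, map_smul] }
  have hj : Function.Injective j := by
    intro l l' h
    have hv : r • (φ v • (l : V)) = r • (φ v • (l' : V)) :=
      LinearMap.congr_fun (congrArg Subtype.val h) v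
    rw [hφ, one_smul, one_smul] at hv
    have : Module.IsTorsionFree R V := Module.IsTorsionFree.trans_faithfulSMul R K V
    exact Subtype.ext (smul_right_injective V hr hv)
  have := hproj (LinearMap.range j)
  exact Module.Projective.of_equiv (LinearEquiv.ofInjective j hj).symm

theorem lattice_hom_eq_smul (hA : IsLocalOrder A) {N : Submodule A V} (s : N →ₗ[A] V) :
    ∃ c : K, ∀ x : N, s x = c • (x : V) := by
  by_cases h : ∃ x : N, x ≠ 0
  · obtain ⟨x, hx⟩ := h
    have : Module.IsTorsionFree R V := Module.IsTorsionFree.trans_faithfulSMul R K V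
    obtain ⟨φ, hφ⟩ := Module.Projective.exists_dual_eq_one K (x := (x : V)) (by simpa using hx)
    refine ⟨φ (s x), fun x' => ?_⟩
    rw [hA.map_eq_smul s (z := φ.smulRight (x' : V)) (x := x) (x' := x') (by simp [hφ])]
    simp
  · push Not at h
    exact ⟨0, fun x => by simp [h x]⟩

/- As `L ⊔ M` is projective, `L × M → L ⊔ M` has a section, and its components are homotheties. -/
theorem exists_smul_sup_mem (hA : IsLocalOrder A)
    (hproj : ∀ I : Submodule A A, Module.Projective A I)
    (L M : Submodule A V) [Module.Finite R L] [Module.Finite R M] :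
    ∃ c : K, ∀ x ∈ L ⊔ M, c • x ∈ L ∧ (1 - c) • x ∈ M := by
  have : Module.Finite R (L ⊔ M : Submodule A V) := by
    have hfg := (Module.Finite.iff_fg (N := L.restrictScalars R).1 ‹Module.Finite R L›).sup
      (Module.Finite.iff_fg (N := M.restrictScalars R).1 ‹Module.Finite R M›)
    rw [← Submodule.restrictScalars_sup] at hfg
    exact Module.Finite.iff_fg.2 hfg
  have := projective_lattice hA hproj (L ⊔ M)
  let f : L × M →ₗ[A] (L ⊔ M : Submodule A V) :=
    (Submodule.inclusion le_sup_left).coprod (Submodule.inclusion le_sup_right)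
  have hf : Function.Surjective f := by
    rintro ⟨x, hx⟩
    obtain ⟨l, hl, m, hm, rfl⟩ := Submodule.mem_sup.1 hx
    exact ⟨(⟨l, hl⟩, ⟨m, hm⟩), rfl⟩
  obtain ⟨s, hs⟩ := Module.projective_lifting_property f LinearMap.id hf
  obtain ⟨c, hc⟩ := lattice_hom_eq_smul hA (L.subtype ∘ₗ LinearMap.fst A L M ∘ₗ s)
  refine ⟨c, fun x hx => ?_⟩
  have hsum : ((s ⟨x, hx⟩).1 : V) + (s ⟨x, hx⟩).2 = x :=
    congrArg Subtype.val (LinearMap.congr_fun hs ⟨x, hx⟩)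
  have hcx : ((s ⟨x, hx⟩).1 : V) = c • x := hc ⟨x, hx⟩
  rw [sub_smul, one_smul, ← hcx, sub_eq_of_eq_add' hsum.symm]
  exact ⟨(s ⟨x, hx⟩).1.2, (s ⟨x, hx⟩).2.2⟩

theorem exists_algebraMap_mul_eq_one_or {R K : Type*} [CommRing R] [IsDomain R] [ValuationRing R]
    [Field K] [Algebra R K] [IsFractionRing R K] (c : K) :
    ∃ y : R, algebraMap R K y * c = 1 ∨ algebraMap R K y * (1 - c) = 1 := by
  rcases ValuationRing.isInteger_or_isInteger R c with ⟨y, rfl⟩ | ⟨y, hy⟩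
  · rcases IsLocalRing.isUnit_or_isUnit_one_sub_self y with hu | hu
    · obtain ⟨z, hz⟩ := hu.exists_left_inv
      exact ⟨z, Or.inl (by rw [← map_mul, hz, map_one])⟩
    · obtain ⟨z, hz⟩ := hu.exists_left_inv
      exact ⟨z, Or.inr (by rw [← map_one (algebraMap R K), ← map_sub, ← map_mul, hz])⟩
  · rcases eq_or_ne c 0 with rfl | hc
    · exact ⟨1, Or.inr (by simp)⟩
    · exact ⟨y, Or.inl (by rw [hy, inv_mul_cancel₀ hc])⟩

theorem lattice_total [ValuationRing R] (hA : IsLocalOrder A)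
    (hproj : ∀ I : Submodule A A, Module.Projective A I)
    (L M : Submodule A V) [Module.Finite R L] [Module.Finite R M] : L ≤ M ∨ M ≤ L := by
  obtain ⟨c, hc⟩ := exists_smul_sup_mem hA hproj L M
  have mem_of_smul_mem {N : Submodule A V} {y : R} {c : K} (hy : algebraMap R K y * c = 1) {x : V}
      (hx : c • x ∈ N) : x ∈ N := by
    have hyx := N.smul_of_tower_mem y hx
    rwa [← algebraMap_smul K, smul_smul, hy, one_smul] at hyx
  obtain ⟨y, hy | hy⟩ := exists_algebraMap_mul_eq_one_or (R := R) c
  · exact Or.inr (le_sup_right.trans fun x hx => mem_of_smul_mem hy (hc x hx).1)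
  · exact Or.inl (le_sup_left.trans fun x hx => mem_of_smul_mem hy (hc x hx).2)

/- The lattice `P v` is projective, so `P ≃ P v ⊕ {p ∈ P | p v = 0}`, and `x` preserves `P v`. -/
theorem mul_mem_of_forall_lattice (hA : IsLocalOrder A)
    (hproj : ∀ I : Submodule A A, Module.Projective A I) {x : Module.End K V}
    (hx : ∀ L : Submodule A V, Module.Finite R L → ∀ l ∈ L, x l ∈ L)
    (P : Submodule A (Module.End K V)) [Module.Finite R P] (v : V)
    (hker : ∀ q ∈ P, q v = 0 → x * q ∈ P) : ∀ p ∈ P, x * p ∈ P := by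
  intro p hp
  let ev : Module.End K V →ₗ[A] V :=
    (LinearMap.toSpanSingleton (Module.End K V) V v).restrictScalars A
  have hL : Module.Finite R (P.map ev) :=
    Module.Finite.of_surjective ((ev.submoduleMap P).restrictScalars R)
      (LinearMap.submoduleMap_surjective ev P)
  have := projective_lattice hA hproj (P.map ev)
  obtain ⟨t, ht⟩ := Module.projective_lifting_property (ev.submoduleMap P) LinearMap.id
    (LinearMap.submoduleMap_surjective ev P)
  let l : P.map ev := ⟨p v, p, hp, rfl⟩
  let xl : P.map ev := ⟨x (p v), hx _ hL _ l.2⟩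
  have : Module.IsTorsionFree R (Module.End K V) :=
    Module.IsTorsionFree.trans_faithfulSMul R K (Module.End K V)
  have hxl : ((t xl : P) : Module.End K V) = x * (t l : P) :=
    hA.map_eq_smul (P.subtype ∘ₗ t) (z := x) (x := l) (x' := xl) rfl
  have htl : ((t l : P) : Module.End K V) v = p v :=
    congrArg Subtype.val (LinearMap.congr_fun ht l)
  have hmem := hker (p - (t l : P)) (P.sub_mem hp (t l).2) (by
    rw [LinearMap.sub_apply, htl, sub_self])
  rw [mul_sub, ← hxl] at hmem
  exact (P.sub_mem_iff_left (t xl).2).1 hmem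

theorem mem_of_forall_lattice [IsNoetherianRing R] (hA : IsLocalOrder A)
    (hproj : ∀ I : Submodule A A, Module.Projective A I) {x : Module.End K V}
    (hx : ∀ L : Submodule A V, Module.Finite R L → ∀ l ∈ L, x l ∈ L) : x ∈ A := by
  classical
  let b := Module.finBasis K V
  have mul_mem (s : Finset (Fin (Module.finrank K V))) (P : Submodule A (Module.End K V))
      (hP : Module.Finite R P) (hs : ∀ p ∈ P, ∀ i ∉ s, p (b i) = 0) : ∀ p ∈ P, x * p ∈ P := by
    induction s using Finset.induction_on generalizing P with
    | empty =>
      intro p hp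
      have hp0 : p = 0 := b.ext fun i => hs p hp i (Finset.notMem_empty i)
      rw [hp0, mul_zero]
      exact P.zero_mem
    | insert i s _ ih =>
      refine mul_mem_of_forall_lattice hA hproj hx P (b i) fun q hq hqi => ?_
      let P' : Submodule A (Module.End K V) :=
        P ⊓ LinearMap.ker ((LinearMap.toSpanSingleton (Module.End K V) V (b i)).restrictScalars A)
      have : _root_.IsNoetherian R P := isNoetherian_of_isNoetherianRing_of_finite R P
      have hP' : Module.Finite R P' :=
        Module.Finite.of_injective ((Submodule.inclusion (inf_le_left : P' ≤ P)).restrictScalars R)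
          (Submodule.inclusion_injective (inf_le_left : P' ≤ P))
      refine (ih P' hP' (fun p hp j hj => ?_) q ⟨hq, hqi⟩).1
      by_cases hji : j = i
      · exact hji ▸ hp.2
      · exact hs p hp.1 j (by simp [hji, hj])
  have := hA.finite
  have hfin : Module.Finite R (Submodule.span A {(1 : Module.End K V)}) := Module.Finite.trans A _
  obtain ⟨a, ha⟩ := Submodule.mem_span_singleton.1
    (mul_mem Finset.univ _ hfin (by simp) 1 (Submodule.mem_span_singleton_self 1))
  have hax : (a : Module.End K V) = x := by simpa [Subalgebra.smul_def] using ha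
  exact hax ▸ a.2

end Lattices

section Blocks

/- The rank of `a` is the number of elements that precede it. -/
theorem exists_rank {ι : Type*} [Finite ι] (r : ι → ι → Prop) (hirr : ∀ a, ¬ r a a)
    (htrans : ∀ a b c, r a b → r b c → r a c) (hweak : ∀ a b c, r a c → r a b ∨ r b c) :
    ∃ h : ι → ℕ, ∀ a b, h a < h b ↔ r a b := by
  classical
  have := Fintype.ofFinite ι
  refine ⟨fun a => (Finset.univ.filter fun c => r c a).card, fun a b => ⟨?_, fun hab => ?_⟩⟩
  · contrapose!
    refine fun hab => Finset.card_le_card fun c hc => ?_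
    simp only [Finset.mem_filter, Finset.mem_univ, true_and] at hc ⊢
    exact (hweak c a b hc).resolve_right hab
  · refine Finset.card_lt_card (Finset.ssubset_iff.2 ⟨a, by simpa using hirr a, fun c hc => ?_⟩)
    simp only [Finset.mem_insert, Finset.mem_filter, Finset.mem_univ, true_and] at hc ⊢
    rcases hc with rfl | hc
    · exact hab
    · exact htrans _ _ _ hc hab

theorem exists_block_equiv {ι α : Type*} [Finite ι] [LinearOrder α] (h : ι → α) :
    ∃ (r : ℕ) (n : Fin r → ℕ) (_ : ∀ i, 0 < n i) (e : ι ≃ Σ i, Fin (n i)),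
      ∀ a b, (e a).1 < (e b).1 ↔ h a < h b := by
  classical
  have := Fintype.ofFinite ι
  let I := Finset.univ.image h
  let o : Fin I.card ≃o I := I.orderIsoOfFin rfl
  let f (a : ι) : Fin I.card := o.symm ⟨h a, Finset.mem_image_of_mem _ (Finset.mem_univ a)⟩
  refine ⟨I.card, fun i => Fintype.card {a // f a = i}, fun i => ?_,
    (Equiv.sigmaFiberEquiv f).symm.trans (Equiv.sigmaCongrRight fun i => Fintype.equivFin _),
    fun a b => ?_⟩
  · obtain ⟨a, -, ha⟩ := Finset.mem_image.1 (o i).2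
    refine Fintype.card_pos_iff.2 ⟨a, ?_⟩
    simp only [f]
    rw [OrderIso.symm_apply_eq]
    exact Subtype.ext ha
  · change f a < f b ↔ _
    simp [f]

end Blocks

section BlockMatrices

variable (R : Type*) [CommRing R] [IsLocalRing R] (K : Type*) [Field K] [Algebra R K]
  {r : ℕ} (n : Fin r → ℕ)

/-- The block order as an order in the matrix algebra over the fraction field. -/
def fracBlockOrder : Subalgebra R (Matrix (Σ i, Fin (n i)) (Σ i, Fin (n i)) K) :=
  (blockOrder R n).map (Algebra.ofId R K).mapMatrix

variable {n}

theorem mem_fracBlockOrder (M : Matrix (Σ i, Fin (n i)) (Σ i, Fin (n i)) K) :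
    M ∈ fracBlockOrder R K n ↔ ∀ a b, ∃ y : R, algebraMap R K y = M a b ∧
      (b.1 < a.1 → y ∈ IsLocalRing.maximalIdeal R) := by
  constructor
  · rintro ⟨N, hN, rfl⟩ a b
    exact ⟨N a b, rfl, hN a b⟩
  · intro h
    choose y hy hym using h
    exact ⟨Matrix.of y, fun a b => hym a b, Matrix.ext hy⟩

/-- The canonical isomorphism from the block order onto its image over the fraction field. -/
def fracBlockOrderEquiv [FaithfulSMul R K] : blockOrder R n ≃ₐ[R] fracBlockOrder R K n :=
  (blockOrder R n).equivMapOfInjective _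
    (Matrix.map_injective (FaithfulSMul.algebraMap_injective R K))

end BlockMatrices

section Structure

open IsLocalRing Pointwise

variable {R K V ι : Type*} [CommRing R] [IsLocalRing R] [Field K] [Algebra R K]
  [AddCommGroup V] [Module K V] [Module R V]

/-- The submodule `L` is compatible with the basis `β`: it is the sum of the lines `R β i` for
`β i ∈ L` and the lines `𝔪 β i` for `β i ∉ L`. -/
def IsAdapted (β : Module.Basis ι K V) (L : Submodule R V) : Prop :=
  ∀ v, v ∈ L ↔ ∀ i, ∃ y : R, algebraMap R K y = β.repr v i ∧ (β i ∉ L → y ∈ maximalIdeal R)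

theorem forall_map_mem_iff_toMatrix [FaithfulSMul R K] [Fintype ι] [DecidableEq ι]
    {β : Module.Basis ι K V} {𝓛 : Set (Submodule R V)} (hadapted : ∀ L ∈ 𝓛, IsAdapted β L)
    (hβ : ∀ i, ∃ L ∈ 𝓛, β i ∈ L) (x : Module.End K V) :
    (∀ L ∈ 𝓛, ∀ v ∈ L, x v ∈ L) ↔ ∀ a b, ∃ y : R, algebraMap R K y = LinearMap.toMatrix β β x a b ∧
      ((∃ L ∈ 𝓛, β b ∈ L ∧ β a ∉ L) → y ∈ maximalIdeal R) := by
  constructor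
  · intro hx a b
    obtain ⟨L, hL, hbL⟩ := hβ b
    obtain ⟨y, hy, -⟩ := (hadapted L hL _).1 (hx L hL _ hbL) a
    rw [← LinearMap.toMatrix_apply] at hy
    refine ⟨y, hy, fun ⟨M, hM, hbM, haM⟩ => ?_⟩
    obtain ⟨z, hz, hzm⟩ := (hadapted M hM _).1 (hx M hM _ hbM) a
    rw [← LinearMap.toMatrix_apply, ← hy] at hz
    exact FaithfulSMul.algebraMap_injective R K hz ▸ hzm haM
  · intro hx L hL v hv
    choose y hy hym using hx
    choose z hz hzm using (hadapted L hL v).1 hv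
    refine (hadapted L hL _).2 fun a => ⟨∑ b, y a b * z b, ?_, fun ha => ?_⟩
    · rw [← LinearMap.toMatrix_mulVec_repr β β x v]
      simp only [Matrix.mulVec, dotProduct, map_sum, map_mul, hy, hz]
    · refine Ideal.sum_mem _ fun b _ => ?_
      by_cases hb : β b ∈ L
      · exact Ideal.mul_mem_right _ _ (hym a b ⟨L, hL, hb, ha⟩)
      · exact Ideal.mul_mem_left _ _ (hzm b hb)

theorem extendOfIsLattice_repr {R K V ι : Type*} [CommRing R] [Field K] [Algebra R K]
    [IsFractionRing R K] [AddCommGroup V] [Module K V] [Module R V] [IsScalarTower R K V]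
    {L : Submodule R V} [Submodule.IsLattice K L] (β : Module.Basis ι R L) (v : L) (i : ι) :
    (β.extendOfIsLattice K).repr v i = algebraMap R K (β.repr v i) := by
  suffices h : (Finsupp.lapply i ∘ₗ (β.extendOfIsLattice K).repr.toLinearMap).restrictScalars R ∘ₗ
      L.subtype = Algebra.linearMap R K ∘ₗ Finsupp.lapply i ∘ₗ β.repr.toLinearMap from
    LinearMap.congr_fun h v
  refine β.ext fun j => ?_
  simp only [LinearMap.comp_apply, LinearMap.restrictScalars_apply, Submodule.subtype_apply,
    LinearEquiv.coe_coe, Finsupp.lapply_apply, Algebra.linearMap_apply, Module.Basis.repr_self,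
    ← Module.Basis.extendOfIsLattice_apply K β j]
  classical
  rw [Finsupp.single_apply, Finsupp.single_apply, apply_ite (algebraMap R K), map_one, map_zero]

theorem exists_isAdapted_basis [IsDomain R] [IsPrincipalIdealRing R] [IsFractionRing R K]
    [IsScalarTower R K V] (L₀ : Submodule R V) [Submodule.IsLattice K L₀]
    {𝓛 : Set (Submodule R V)} (h𝓛 : IsChain (· ≤ ·) 𝓛) (hle : ∀ L ∈ 𝓛, L ≤ L₀)
    (hmax : ∀ L ∈ 𝓛, maximalIdeal R • L₀ ≤ L) :
    ∃ (n : ℕ) (β : Module.Basis (Fin n) K V), (∀ i, β i ∈ L₀) ∧ ∀ L ∈ 𝓛, IsAdapted β L := by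
  obtain ⟨n, β, hβ⟩ := exists_adapted_basis (𝓕 := Submodule.comap L₀.subtype '' 𝓛)
    (IsChain.image_of_map_rel _ _ _ (fun _ _ h => Submodule.comap_mono h) h𝓛) (by
      rintro _ ⟨L, hL, rfl⟩
      rw [← Submodule.map_le_iff_le_comap, Submodule.map_smul'', Submodule.map_subtype_top]
      exact hmax L hL)
  refine ⟨n, β.extendOfIsLattice K, fun i => ?_, fun L hL v => ⟨fun hv i => ?_, fun hv => ?_⟩⟩
  · rw [Module.Basis.extendOfIsLattice_apply]
    exact (β i).2
  · refine ⟨β.repr ⟨v, hle L hL hv⟩ i, (extendOfIsLattice_repr β ⟨v, hle L hL hv⟩ i).symm,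
      fun hi => ?_⟩
    rw [Module.Basis.extendOfIsLattice_apply] at hi
    exact (hβ _ ⟨L, hL, rfl⟩ ⟨v, hle L hL hv⟩).1 hv i hi
  · choose y hy hym using hv
    rw [← (β.extendOfIsLattice K).sum_repr v]
    refine L.sum_mem fun i _ => ?_
    rw [← hy, algebraMap_smul]
    by_cases hi : β.extendOfIsLattice K i ∈ L
    · exact L.smul_mem _ hi
    · refine hmax L hL (Submodule.smul_mem_smul (hym i hi) ?_)
      rw [Module.Basis.extendOfIsLattice_apply]
      exact (β i).2

end Structure

section HereditaryStructure

open IsLocalRing Pointwise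

theorem exists_isLattice {R K V : Type*} [CommRing R] [Field K] [Algebra R K] [AddCommGroup V]
    [Module K V] [Module R V] [IsScalarTower R K V] [FiniteDimensional K V]
    {A : Subalgebra R (Module.End K V)} (hA : IsLocalOrder A) :
    ∃ L₀ : Submodule A V, Submodule.IsLattice K (L₀.restrictScalars R) := by
  have := hA.finite
  let L₀ := Submodule.span A (Set.range (Module.finBasis K V))
  have : Module.Finite A L₀ := Module.Finite.span_of_finite A (Set.finite_range _)
  have : Module.Finite R L₀ := Module.Finite.trans A L₀
  refine ⟨L₀, Module.Finite.iff_fg.1 this, top_le_iff.1 ?_⟩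
  rw [← (Module.finBasis K V).span_eq]
  exact Submodule.span_mono Submodule.subset_span

theorem finite_smul {R K V : Type*} [CommRing R] [Field K] [Algebra R K] [AddCommGroup V]
    [Module K V] [Module R V] [IsScalarTower R K V] {A : Subalgebra R (Module.End K V)} (c : K)
    (L : Submodule A V) [Module.Finite R L] : Module.Finite R (c • L : Submodule A V) :=
  Module.Finite.iff_fg.2 (((Module.Finite.iff_fg (N := L.restrictScalars R)).1 ‹_›).map
    (DistribSMul.toLinearMap R V c))

variable {R K V : Type*} [CommRing R] [Field K] [Algebra R K] [IsFractionRing R K]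
  [AddCommGroup V] [Module K V] [Module R V] [IsScalarTower R K V]
  {A : Subalgebra R (Module.End K V)}

/- If `π⁻¹ L ≤ L` then `L = 𝔪 L`, so `L = 0` by Nakayama's lemma. -/
theorem inv_smul_le_self_iff [IsLocalRing R] {π : R} (hπ0 : π ≠ 0) (hπ : π ∈ maximalIdeal R)
    {L : Submodule A V} [Module.Finite R L] : (algebraMap R K π)⁻¹ • L ≤ L ↔ L = ⊥ := by
  have hπK : algebraMap R K π ≠ 0 := by simpa using hπ0
  refine ⟨fun hle => ?_, fun h => by simp [h]⟩
  refine (Submodule.restrictScalars_eq_bot_iff R A V).1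
    (Submodule.eq_bot_of_le_smul_of_le_jacobson_bot (maximalIdeal R) _
      (Module.Finite.iff_fg (N := L.restrictScalars R).1 ‹_›) (fun v hv => ?_)
      (maximalIdeal_le_jacobson _))
  have hv' : (algebraMap R K π)⁻¹ • v ∈ L.restrictScalars R :=
    hle (Submodule.smul_mem_pointwise_smul _ _ _ hv)
  simpa only [← algebraMap_smul K π, smul_inv_smul₀ hπK] using Submodule.smul_mem_smul hπ hv'

variable [IsDomain R]

theorem exists_smul_mem_of_isLattice (L₀ : Submodule R V) [Submodule.IsLattice K L₀] (v : V) :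
    ∃ r : R, r ≠ 0 ∧ r • v ∈ L₀ := by
  have hv : v ∈ Submodule.span K (L₀ : Set V) :=
    Submodule.IsLattice.span_eq_top (M := L₀) ▸ Submodule.mem_top
  obtain ⟨t, ht⟩ := multiple_mem_span_of_mem_localization_span (nonZeroDivisors R) K _ _ hv
  rw [Submodule.span_eq] at ht
  exact ⟨t, nonZeroDivisors.ne_zero t.2, ht⟩

theorem exists_smul_le {L₀ : Submodule A V} [Submodule.IsLattice K (L₀.restrictScalars R)]
    (L : Submodule A V) [Module.Finite R L] : ∃ c : K, c ≠ 0 ∧ c • L ≤ L₀ := by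
  obtain ⟨r, hr, hrL⟩ := exists_smul_mem_of_fg
    (exists_smul_mem_of_isLattice (K := K) (L₀.restrictScalars R))
    (Module.Finite.iff_fg (N := L.restrictScalars R).1 ‹Module.Finite R L›)
  refine ⟨algebraMap R K r, by simpa using hr, ?_⟩
  rintro _ ⟨v, hv, rfl⟩
  change algebraMap R K r • v ∈ L₀
  rw [algebraMap_smul]
  exact hrL v hv

variable [IsDiscreteValuationRing R] [FiniteDimensional K V]

/- Take `c` with `c L ≤ L₀` maximal. Then `π⁻¹ c L` is not contained in `L₀`, hence contains it. -/
theorem exists_smul_le_and_le_smul (hA : IsLocalOrder A)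
    (hproj : ∀ I : Submodule A A, Module.Projective A I) (L₀ : Submodule A V)
    [Submodule.IsLattice K (L₀.restrictScalars R)] (L : Submodule A V) [Module.Finite R L]
    (hL : L ≠ ⊥) :
    ∃ c : K, c ≠ 0 ∧ c • L ≤ L₀ ∧
      maximalIdeal R • L₀.restrictScalars R ≤ (c • L).restrictScalars R := by
  obtain ⟨π, hπ⟩ := IsDiscreteValuationRing.exists_irreducible R
  have hπ0 : algebraMap R K π ≠ 0 := by simpa using hπ.ne_zero
  have : Module.Finite R L₀ := Submodule.IsLattice.finite K (M := L₀.restrictScalars R)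
  have : _root_.IsNoetherian R L₀ := isNoetherian_of_isNoetherianRing_of_finite R L₀
  have : _root_.IsNoetherian A L₀ := isNoetherian_of_tower R inferInstance
  obtain ⟨c, ⟨hc, hcL⟩, hmax⟩ := (InvImage.wf (fun c : K => (c • L).comap L₀.subtype)
    wellFounded_gt).has_min {c | c ≠ 0 ∧ c • L ≤ L₀} (exists_smul_le L)
  have := finite_smul c L
  have := finite_smul (algebraMap R K π)⁻¹ (c • L)
  rcases lattice_total hA hproj ((algebraMap R K π)⁻¹ • c • L) L₀ with hle | hle
  · have hle' : (algebraMap R K π)⁻¹ • c • L ≤ c • L := by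
      by_contra hnot
      refine hmax ((algebraMap R K π)⁻¹ * c) ⟨mul_ne_zero (inv_ne_zero hπ0) hc, by rwa [mul_smul]⟩
        (lt_of_le_not_ge (Submodule.comap_mono fun v hv => ?_) fun h => hnot ?_)
      · rw [mul_smul, ← inv_smul_smul₀ hπ0 v, algebraMap_smul]
        exact Submodule.smul_mem_pointwise_smul _ _ _ (Submodule.smul_of_tower_mem _ π hv)
      · refine fun v hv => h (x := ⟨v, hle hv⟩) ?_
        change v ∈ (_ * c) • L
        rwa [mul_smul]
    have hbot := (inv_smul_le_self_iff hπ.ne_zero hπ.1 (L := c • L)).1 hle'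
    rw [← inv_smul_smul₀ hc L, hbot, Submodule.smul_bot'] at hL
    exact absurd rfl hL
  · refine ⟨c, hc, hcL, Submodule.smul_le.2 fun y hy v hv => ?_⟩
    rw [hπ.maximalIdeal_eq, Ideal.mem_span_singleton] at hy
    obtain ⟨z, rfl⟩ := hy
    obtain ⟨w, hw, hwv⟩ := hle (L₀.smul_of_tower_mem z hv)
    change (algebraMap R K π)⁻¹ • w = z • v at hwv
    rw [mul_smul, ← hwv, ← algebraMap_smul K π, smul_inv_smul₀ hπ0]
    exact hw

theorem mem_iff_forall_mem_lattice (hA : IsLocalOrder A)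
    (hproj : ∀ I : Submodule A A, Module.Projective A I) (L₀ : Submodule A V)
    [Submodule.IsLattice K (L₀.restrictScalars R)] (x : Module.End K V) :
    x ∈ A ↔ ∀ L : Submodule A V, L ≤ L₀ →
      maximalIdeal R • L₀.restrictScalars R ≤ L.restrictScalars R → ∀ v ∈ L, x v ∈ L := by
  refine ⟨fun hx L _ _ v hv => L.smul_mem ⟨x, hx⟩ hv, fun hx => ?_⟩
  refine mem_of_forall_lattice hA hproj fun L _ v hv => ?_
  rcases eq_or_ne L ⊥ with rfl | hL
  · simp [(Submodule.mem_bot _).1 hv]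
  obtain ⟨c, hc, hle, hmax⟩ := exists_smul_le_and_le_smul hA hproj L₀ L hL
  obtain ⟨w, hw, hwx⟩ := hx _ hle hmax _ (Submodule.smul_mem_pointwise_smul _ c _ hv)
  change c • w = x (c • v) at hwx
  rw [map_smul] at hwx
  exact smul_right_injective V hc hwx ▸ hw

theorem exists_basis_mem_iff_toMatrix (hA : IsLocalOrder A)
    (hproj : ∀ I : Submodule A A, Module.Projective A I) :
    ∃ (n : ℕ) (β : Module.Basis (Fin n) K V) (h : Fin n → ℕ), ∀ x, x ∈ A ↔ ∀ a b, ∃ y : R,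
      algebraMap R K y = LinearMap.toMatrix β β x a b ∧ (h b < h a → y ∈ maximalIdeal R) := by
  obtain ⟨L₀, _⟩ := exists_isLattice hA
  have hfin : Module.Finite R L₀ := Submodule.IsLattice.finite K (M := L₀.restrictScalars R)
  have : _root_.IsNoetherian R L₀ := isNoetherian_of_isNoetherianRing_of_finite R L₀
  let 𝓛 : Set (Submodule R V) := Submodule.restrictScalars R '' {L : Submodule A V | L ≤ L₀ ∧
    maximalIdeal R • L₀.restrictScalars R ≤ L.restrictScalars R}
  have h𝓛 : IsChain (· ≤ ·) 𝓛 := by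
    rintro _ ⟨L, hL, rfl⟩ _ ⟨M, hM, rfl⟩ -
    have := Module.Finite.of_injective ((Submodule.inclusion hL.1).restrictScalars R)
      (Submodule.inclusion_injective hL.1)
    have := Module.Finite.of_injective ((Submodule.inclusion hM.1).restrictScalars R)
      (Submodule.inclusion_injective hM.1)
    exact lattice_total hA hproj L M
  obtain ⟨n, β, hβ, hadapted⟩ := exists_isAdapted_basis (L₀.restrictScalars R) h𝓛
    (by rintro _ ⟨L, hL, rfl⟩; exact hL.1) (by rintro _ ⟨L, hL, rfl⟩; exact hL.2)
  obtain ⟨h, hh⟩ := exists_rank (fun b a => ∃ L ∈ 𝓛, β b ∈ L ∧ β a ∉ L)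
    (fun _ ⟨_, _, ha, ha'⟩ => ha' ha)
    (fun a b c ⟨L, hL, haL, hbL⟩ ⟨M, hM, hbM, hcM⟩ =>
      ⟨M, hM, (h𝓛.total hL hM).elim (fun hLM => hLM haL) fun hML => absurd (hML hbM) hbL, hcM⟩)
    (fun a b c ⟨L, hL, haL, hcL⟩ =>
      (em (β b ∈ L)).symm.imp (fun hb => ⟨L, hL, haL, hb⟩) fun hb => ⟨L, hL, hb, hcL⟩)
  have hmem_𝓛 : L₀.restrictScalars R ∈ 𝓛 := ⟨L₀, ⟨le_rfl, Submodule.smul_le_right⟩, rfl⟩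
  refine ⟨n, β, h, fun x => ?_⟩
  simp only [hh, ← forall_map_mem_iff_toMatrix hadapted (fun i => ⟨_, hmem_𝓛, hβ i⟩),
    mem_iff_forall_mem_lattice hA hproj L₀ x, 𝓛, Set.forall_mem_image, Set.mem_ofPred_eq,
    and_imp, Submodule.restrictScalars_mem]

theorem exists_equiv_blockOrder (hA : IsLocalOrder A)
    (hproj : ∀ I : Submodule A A, Module.Projective A I) :
    ∃ (r : ℕ) (n : Fin r → ℕ) (_ : ∀ i, 0 < n i), Nonempty (A ≃ₐ[R] blockOrder R n) := by
  obtain ⟨_, β, h, hmem⟩ := exists_basis_mem_iff_toMatrix hA hproj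
  obtain ⟨r, n, hn, e, he⟩ := exists_block_equiv h
  let T : Module.End K V ≃ₐ[K] Matrix _ _ K := LinearMap.toMatrixAlgEquiv (β.reindex e)
  have hTA (x : Module.End K V) : T x ∈ fracBlockOrder R K n ↔ x ∈ A := by
    simp only [mem_fracBlockOrder, hmem, e.symm.forall_congr_left, Equiv.symm_symm, he]
    simp [T, LinearMap.toMatrixAlgEquiv, LinearMap.toMatrix_apply]
  have hT : A.map (T.restrictScalars R).toAlgHom = fracBlockOrder R K n := by
    ext M
    constructor
    · rintro ⟨x, hx, rfl⟩
      exact (hTA x).2 hx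
    · exact fun hM => ⟨T.symm M, (hTA _).1 (by rwa [T.apply_symm_apply]), T.apply_symm_apply M⟩
  exact ⟨r, n, hn, ⟨(A.equivMapOfInjective _ (T.restrictScalars R).injective).trans
    ((Subalgebra.equivOfEq _ _ hT).trans (fracBlockOrderEquiv R K).symm)⟩⟩

end HereditaryStructure

section Extension

variable {R K E E' : Type*} [CommRing R] [Field K] [Algebra R K]
  [Ring E] [Algebra K E] [Algebra R E] [IsScalarTower R K E]
  [Ring E'] [Algebra K E'] [Algebra R E'] [IsScalarTower R K E']

variable (K) in
/-- The multiplication map `K ⊗ A → E`; it is bijective when `A` spans `E`, so that an isomorphism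
of spanning subalgebras extends to the ambient algebras. -/
def fractionMap (A : Subalgebra R E) : TensorProduct R K A →ₐ[K] E :=
  Algebra.TensorProduct.lift (Algebra.ofId K E) A.val fun c a =>
    Algebra.commute_algebraMap_left c (a : E)

theorem fractionMap_tmul (A : Subalgebra R E) (c : K) (a : A) :
    fractionMap K A (c ⊗ₜ a) = c • (a : E) :=
  (Algebra.TensorProduct.lift_tmul ..).trans (Algebra.smul_def c (a : E)).symm

variable [IsDomain R] [IsFractionRing R K]

theorem isBaseChange_val {A : Subalgebra R E} (hA : ∀ x : E, ∃ r : R, r ≠ 0 ∧ r • x ∈ A) :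
    IsBaseChange K A.val.toLinearMap := by
  have : Module.IsTorsionFree R E := Module.IsTorsionFree.trans_faithfulSMul R K E
  have : IsLocalizedModule (nonZeroDivisors R) A.val.toLinearMap := by
    refine (isLocalizedModule_iff _ _).2 ⟨fun s => ?_, fun x => ?_, fun {a b} hab => ?_⟩
    · rw [← (Algebra.lsmul R (A := K) R E).commutes]
      exact (IsLocalization.map_units K s).map _
    · obtain ⟨r, hr, hrx⟩ := hA x
      exact ⟨(⟨r • x, hrx⟩, ⟨r, mem_nonZeroDivisors_of_ne_zero hr⟩), rfl⟩
    · exact ⟨1, congrArg _ (Subtype.ext hab)⟩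
  exact IsLocalizedModule.isBaseChange (nonZeroDivisors R) K _

theorem bijective_fractionMap {A : Subalgebra R E} (hA : ∀ x : E, ∃ r : R, r ≠ 0 ∧ r • x ∈ A) :
    Function.Bijective (fractionMap K A) := by
  convert (isBaseChange_val (K := K) hA).equiv.bijective using 1
  ext x
  induction x with
  | zero => simp
  | add x y hx hy => rw [map_add, map_add, hx, hy]
  | tmul c a => rw [fractionMap_tmul, IsBaseChange.equiv_tmul]; rfl

theorem exists_algEquiv_extension {A : Subalgebra R E} {A' : Subalgebra R E'}
    (hA : ∀ x : E, ∃ r : R, r ≠ 0 ∧ r • x ∈ A) (hA' : ∀ x : E', ∃ r : R, r ≠ 0 ∧ r • x ∈ A')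
    (f : A ≃ₐ[R] A') : ∃ F : E ≃ₐ[K] E', ∀ a : A, F a = f a := by
  let φ := AlgEquiv.ofBijective _ (bijective_fractionMap (K := K) hA)
  let φ' := AlgEquiv.ofBijective _ (bijective_fractionMap (K := K) hA')
  refine ⟨φ.symm.trans ((Algebra.TensorProduct.congr AlgEquiv.refl f).trans φ'), fun a => ?_⟩
  have hφ : φ.symm a = 1 ⊗ₜ[R] a :=
    φ.symm_apply_eq.2 ((fractionMap_tmul A 1 a).trans (one_smul K _)).symm
  rw [AlgEquiv.trans_apply, hφ]
  exact (fractionMap_tmul A' 1 (f a)).trans (one_smul K _)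

end Extension

section Powers

theorem nonempty_linearEquiv_pi {S M N κ : Type*} [Ring S] [AddCommGroup M] [Module S M]
    [AddCommGroup N] [Module S N] [Fintype κ] [DecidableEq κ] (g : κ → M →ₗ[S] N)
    (h : κ → N →ₗ[S] M) (hgh : ∀ a b, g a ∘ₗ h b = if a = b then LinearMap.id else 0)
    (hsum : ∑ a, h a ∘ₗ g a = LinearMap.id) :
    Nonempty (M ≃ₗ[S] (Fin (Fintype.card κ) → N)) := by
  let f : M ≃ₗ[S] (κ → N) := LinearEquiv.ofLinearMap (LinearMap.pi g)
    (∑ a, h a ∘ₗ LinearMap.proj a)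
    (LinearMap.ext fun y => funext fun a => by
      have (b : κ) : g a (h b (y b)) = if a = b then y b else 0 := by
        rw [← LinearMap.comp_apply, hgh]
        split_ifs <;> rfl
      simp [this])
    (LinearMap.ext fun x => by simpa using LinearMap.congr_fun hsum x)
  exact ⟨f.trans (LinearEquiv.funCongrLeft S N (Fintype.equivFin κ).symm)⟩

theorem mem_span_op_singleton_iff {S : Type*} [Ring S] {e : S} (he : IsIdempotentElem e) (y : S) :
    y ∈ Submodule.span Sᵐᵒᵖ {e} ↔ e * y = y := by
  refine Submodule.mem_span_singleton.trans ⟨?_, fun h => ⟨op y, h⟩⟩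
  rintro ⟨c, rfl⟩
  change e * (e * unop c) = e * unop c
  rw [← mul_assoc, he]

theorem mem_span_singleton_iff_mul_eq {S : Type*} [Ring S] {e : S} (he : IsIdempotentElem e)
    (y : S) : y ∈ Submodule.span S {e} ↔ y * e = y := by
  refine Submodule.mem_span_singleton.trans ⟨?_, fun h => ⟨y, h⟩⟩
  rintro ⟨c, rfl⟩
  change c * e * e = c * e
  rw [mul_assoc, he]

variable {R : Type*} {E : Type v} [CommRing R] [Ring E] [Algebra R E] {A B : Subalgebra R E}
  {κ : Type*} [Fintype κ] [DecidableEq κ] [Nonempty κ]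

/- Left multiplication by `g a` maps `B` to the right ideal `e A`, and left multiplication by `h a`
maps it back. -/
theorem isRightPower_of_matrixUnits (hAB : A ≤ B) {e : A} (he : IsIdempotentElem e) (g h : κ → E)
    (hgh : ∀ a b, g a * h b = if a = b then (e : E) else 0) (hsum : ∑ a, h a * g a = 1)
    (hunit : ∀ a, h a * g a ∈ B) (hmem : ∀ a y, (e : E) * y = y → (h a * y ∈ B ↔ y ∈ A)) :
    IsRightPower ((Subalgebra.inclusion hAB : A →ₐ[R] B) : A →+* B)
      (Submodule.span Aᵐᵒᵖ {e}) := by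
  let _ := rightModule ((Subalgebra.inclusion hAB : A →ₐ[R] B) : A →+* B)
  have heg (a : κ) : e * g a = g a := calc
    e * g a = ∑ b, g a * h b * g b := by simp [hgh]
    _ = g a := by simp only [mul_assoc, ← Finset.mul_sum, hsum, mul_one]
  have hey (y : Submodule.span Aᵐᵒᵖ {e}) : (e : E) * ((y : A) : E) = (y : A) :=
    congrArg Subtype.val ((mem_span_op_singleton_iff he _).1 y.2)
  have hegx (a : κ) (x : E) : e * (g a * x) = g a * x := by rw [← mul_assoc, heg]
  let g' (a : κ) : B →ₗ[Aᵐᵒᵖ] Submodule.span Aᵐᵒᵖ {e} :=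
    { toFun x := ⟨⟨g a * x, (hmem a _ (hegx a x)).1 (by
          rw [← mul_assoc]
          exact mul_mem (hunit a) x.2)⟩,
        (mem_span_op_singleton_iff he _).2 (Subtype.ext (hegx a x))⟩
      map_add' _ _ := Subtype.ext (Subtype.ext (mul_add _ _ _))
      map_smul' _ _ := Subtype.ext (Subtype.ext (mul_assoc _ _ _).symm) }
  let h' (a : κ) : Submodule.span Aᵐᵒᵖ {e} →ₗ[Aᵐᵒᵖ] B :=
    { toFun y := ⟨h a * (y : A), (hmem a _ (hey y)).2 (y : A).2⟩
      map_add' _ _ := Subtype.ext (mul_add _ _ _)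
      map_smul' _ _ := Subtype.ext (mul_assoc _ _ _).symm }
  refine ⟨_, Fintype.card_pos (α := κ), nonempty_linearEquiv_pi g' h' (fun a b => ?_) ?_⟩
  · refine LinearMap.ext fun y => Subtype.ext (Subtype.ext ?_)
    change g a * (h b * ((y : A) : E)) = _
    rw [← mul_assoc, hgh]
    split_ifs
    · exact hey y
    · exact zero_mul _
  · refine LinearMap.ext fun x => Subtype.ext ?_
    rw [LinearMap.sum_apply, AddSubmonoidClass.coe_finsetSum]
    change ∑ a, h a * (g a * (x : E)) = x
    simp only [← mul_assoc, ← Finset.sum_mul, hsum, one_mul]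

theorem isLeftPower_of_matrixUnits (hAB : A ≤ B) {e : A} (he : IsIdempotentElem e) (g h : κ → E)
    (hhg : ∀ a b, h b * g a = if a = b then (e : E) else 0) (hsum : ∑ a, g a * h a = 1)
    (hunit : ∀ a, g a * h a ∈ B) (hmem : ∀ a y, y * (e : E) = y → (y * h a ∈ B ↔ y ∈ A)) :
    IsLeftPower ((Subalgebra.inclusion hAB : A →ₐ[R] B) : A →+* B) (Submodule.span A {e}) := by
  let _ := leftModule ((Subalgebra.inclusion hAB : A →ₐ[R] B) : A →+* B)
  have hge (a : κ) : g a * e = g a := calc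
    g a * e = ∑ b, g b * (h b * g a) := by simp [hhg]
    _ = g a := by simp only [← mul_assoc, ← Finset.sum_mul, hsum, one_mul]
  have hye (y : Submodule.span A {e}) : ((y : A) : E) * (e : E) = (y : A) :=
    congrArg Subtype.val ((mem_span_singleton_iff_mul_eq he _).1 y.2)
  have hxge (a : κ) (x : E) : x * g a * e = x * g a := by rw [mul_assoc, hge]
  let g' (a : κ) : B →ₗ[A] Submodule.span A {e} :=
    { toFun x := ⟨⟨x * g a, (hmem a _ (hxge a x)).1 (by
          rw [mul_assoc]
          exact mul_mem x.2 (hunit a))⟩,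
        (mem_span_singleton_iff_mul_eq he _).2 (Subtype.ext (hxge a x))⟩
      map_add' _ _ := Subtype.ext (Subtype.ext (add_mul _ _ _))
      map_smul' _ _ := Subtype.ext (Subtype.ext (mul_assoc _ _ _)) }
  let h' (a : κ) : Submodule.span A {e} →ₗ[A] B :=
    { toFun y := ⟨(y : A) * h a, (hmem a _ (hye y)).2 (y : A).2⟩
      map_add' _ _ := Subtype.ext (add_mul _ _ _)
      map_smul' _ _ := Subtype.ext (mul_assoc _ _ _) }
  refine ⟨_, Fintype.card_pos (α := κ), nonempty_linearEquiv_pi g' h' (fun a b => ?_) ?_⟩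
  · refine LinearMap.ext fun y => Subtype.ext (Subtype.ext ?_)
    change ((y : A) : E) * h b * g a = _
    rw [mul_assoc, hhg]
    split_ifs
    · exact hye y
    · exact mul_zero _
  · refine LinearMap.ext fun x => Subtype.ext ?_
    rw [LinearMap.sum_apply, AddSubmonoidClass.coe_finsetSum]
    change ∑ a, (x : E) * g a * h a = x
    simp only [mul_assoc, ← Finset.mul_sum, hsum, mul_one]

theorem smul_eq_self_of_linearEquiv_pi {S X κ κ' : Type*} [Ring S] [AddCommGroup X] [Module S X]
    {N N' : Submodule S X} {J : Ideal S} (hJ : J • N' = N') [Nonempty κ] [Finite κ']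
    (f : (κ → N) ≃ₗ[S] (κ' → N')) : J • N = N := by
  classical
  have := Fintype.ofFinite κ'
  have smul_top {Q : Submodule S X} : Submodule.map Q.subtype (J • ⊤) = J • Q := by
    rw [Submodule.map_smul'', Submodule.map_subtype_top]
  have hN' : (J • ⊤ : Submodule S N') = ⊤ :=
    Submodule.map_injective_of_injective N'.injective_subtype
      (by rw [smul_top, hJ, Submodule.map_subtype_top])
  have hpi : (J • ⊤ : Submodule S (κ' → N')) = ⊤ := by
    refine top_unique fun y _ => ?_
    have hsingle (i : κ') : Pi.single i (y i) ∈ (J • ⊤ : Submodule S (κ' → N')) := by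
      have hmap := Submodule.map_smul'' J ⊤ (LinearMap.single S (fun _ : κ' => N') i)
      rw [hN'] at hmap
      exact Submodule.smul_mono le_rfl le_top (hmap.le (Submodule.mem_map_of_mem trivial))
    rw [← LinearMap.sum_single_apply _ y]
    exact sum_mem fun i _ => hsingle i
  obtain ⟨i⟩ := ‹Nonempty κ›
  have hsurj : Function.Surjective
      ((LinearMap.proj i : (κ → N) →ₗ[S] N) ∘ₗ f.symm.toLinearMap) :=
    (Function.surjective_eval i).comp f.symm.surjective
  have hN : (J • ⊤ : Submodule S N) = ⊤ := by
    rw [← LinearMap.range_eq_top.2 hsurj, LinearMap.range_eq_map, ← Submodule.map_smul'', hpi]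
  rw [← smul_top, hN, Submodule.map_subtype_top]

variable {S T : Type v} [Ring S] [Ring T] {φ : S →+* T} {e e' : S}

theorem mem_of_isRightPower {I : TwoSidedIdeal S} (he' : IsIdempotentElem e') (heI : e' ∈ I)
    (h : IsRightPower φ (Submodule.span Sᵐᵒᵖ {e}))
    (h' : IsRightPower φ (Submodule.span Sᵐᵒᵖ {e'})) : e ∈ I := by
  let _ := rightModule φ
  obtain ⟨k, hk, ⟨f⟩⟩ := h
  obtain ⟨k', -, ⟨f'⟩⟩ := h'
  have : Nonempty (Fin k) := ⟨⟨0, hk⟩⟩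
  have hJ : TwoSidedIdeal.asIdealOpposite I • Submodule.span Sᵐᵒᵖ {e'} =
      Submodule.span Sᵐᵒᵖ {e'} := by
    refine le_antisymm Submodule.smul_le_right
      (Submodule.span_le.2 (Set.singleton_subset_iff.2 ?_))
    have := Submodule.smul_mem_smul (TwoSidedIdeal.mem_asIdealOpposite.2 heI : op e' ∈ _)
      (Submodule.mem_span_singleton_self (R := Sᵐᵒᵖ) e')
    rwa [op_smul_eq_mul, he'] at this
  have heJ := (smul_eq_self_of_linearEquiv_pi hJ (f.symm.trans f')).ge
    (Submodule.mem_span_singleton_self e)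
  exact Submodule.smul_induction_on heJ
    (fun c hc x _ => I.mul_mem_left x _ (TwoSidedIdeal.mem_asIdealOpposite.1 hc))
    fun _ _ => I.add_mem

theorem mem_of_isLeftPower {I : TwoSidedIdeal S} (he' : IsIdempotentElem e') (heI : e' ∈ I)
    (h : IsLeftPower φ (Submodule.span S {e}))
    (h' : IsLeftPower φ (Submodule.span S {e'})) : e ∈ I := by
  let _ := leftModule φ
  obtain ⟨k, hk, ⟨f⟩⟩ := h
  obtain ⟨k', -, ⟨f'⟩⟩ := h'
  have : Nonempty (Fin k) := ⟨⟨0, hk⟩⟩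
  have hJ : TwoSidedIdeal.asIdeal I • Submodule.span S {e'} = Submodule.span S {e'} := by
    refine le_antisymm Submodule.smul_le_right
      (Submodule.span_le.2 (Set.singleton_subset_iff.2 ?_))
    have := Submodule.smul_mem_smul (TwoSidedIdeal.mem_asIdeal.2 heI)
      (Submodule.mem_span_singleton_self (R := S) e')
    rwa [show e' • e' = e' from he'] at this
  have heJ := (smul_eq_self_of_linearEquiv_pi hJ (f.symm.trans f')).ge
    (Submodule.mem_span_singleton_self e)
  exact Submodule.smul_induction_on heJ
    (fun c hc x _ => I.mul_mem_right _ x (TwoSidedIdeal.mem_asIdeal.1 hc)) fun _ _ => I.add_mem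

end Powers

section BlockIdeal

variable (R : Type*) [CommRing R] [IsLocalRing R] {r : ℕ} (n : Fin r → ℕ)

/-- The two-sided ideal of the block order that consists of the matrices whose `i`-th diagonal
block has entries in the maximal ideal. It contains exactly the diagonal idempotents outside that
block, which separates the types. -/
def blockIdeal (i : Fin r) : TwoSidedIdeal (blockOrder R n) :=
  TwoSidedIdeal.mk' {M | ∀ s t : Fin (n i), M.1 ⟨i, s⟩ ⟨i, t⟩ ∈ IsLocalRing.maximalIdeal R}
    (fun _ _ => zero_mem _) (fun hM hN s t => add_mem (hM s t) (hN s t))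
    (fun hM s t => neg_mem (hM s t))
    (fun {M N} hN s t => by
      refine Ideal.sum_mem _ fun c _ => ?_
      rcases lt_trichotomy c.1 i with h | rfl | h
      · exact Ideal.mul_mem_right _ _ (M.2 ⟨i, s⟩ c h)
      · exact Ideal.mul_mem_left _ _ (hN c.2 t)
      · exact Ideal.mul_mem_left _ _ (N.2 c ⟨i, t⟩ h))
    (fun {M N} hM s t => by
      refine Ideal.sum_mem _ fun c _ => ?_
      rcases lt_trichotomy c.1 i with h | rfl | h
      · exact Ideal.mul_mem_right _ _ (M.2 ⟨i, s⟩ c h)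
      · exact Ideal.mul_mem_right _ _ (hM s c.2)
      · exact Ideal.mul_mem_left _ _ (N.2 c ⟨i, t⟩ h))

variable {R n}

theorem mem_blockIdeal {i : Fin r} {M : blockOrder R n} : M ∈ blockIdeal R n i ↔
    ∀ s t : Fin (n i), M.1 ⟨i, s⟩ ⟨i, t⟩ ∈ IsLocalRing.maximalIdeal R :=
  TwoSidedIdeal.mem_mk' ..

theorem blockIdempotent_mem_blockIdeal_iff (hn : ∀ i, 0 < n i) {i j : Fin r} :
    blockIdempotent R hn j ∈ blockIdeal R n i ↔ j ≠ i := by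
  rw [mem_blockIdeal]
  constructor
  · rintro h rfl
    simpa [blockIdempotent] using
      h ⟨n j - 1, Nat.sub_lt (hn j) one_pos⟩ ⟨n j - 1, Nat.sub_lt (hn j) one_pos⟩
  · intro h s t
    have : (blockIdempotent R hn j).1 ⟨i, s⟩ ⟨i, t⟩ = 0 :=
      Matrix.single_apply_of_row_ne (fun hj => h (congrArg Sigma.fst hj)) _ _ _
    rw [this]
    exact zero_mem _

theorem isIdempotentElem_blockIdempotent (hn : ∀ i, 0 < n i) (i : Fin r) :
    IsIdempotentElem (blockIdempotent R hn i) :=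
  Subtype.ext ((Matrix.single_mul_single_same ..).trans (by rw [one_mul]; rfl))

section Types

variable {S T : Type v} [Ring S] [Ring T] [Algebra R S] (d : S ≃ₐ[R] blockOrder R n)
  {hn : ∀ i, 0 < n i} {φ : S →+* T} {i j : Fin r}

theorem isIdempotentElem_symm_blockIdempotent (hn : ∀ i, 0 < n i) (i : Fin r) :
    IsIdempotentElem (d.symm (blockIdempotent R hn i)) :=
  (isIdempotentElem_blockIdempotent hn i).map d.symm

theorem eq_of_isRightPower
    (hi : IsRightPower φ (Submodule.span Sᵐᵒᵖ {d.symm (blockIdempotent R hn i)}))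
    (hj : IsRightPower φ (Submodule.span Sᵐᵒᵖ {d.symm (blockIdempotent R hn j)})) : i = j := by
  by_contra hij
  have hj' : blockIdempotent R hn j ∈ blockIdeal R n i :=
    (blockIdempotent_mem_blockIdeal_iff hn).2 (Ne.symm hij)
  have hi' := mem_of_isRightPower (I := (blockIdeal R n i).comap d)
    (isIdempotentElem_symm_blockIdempotent d hn j) (by simpa [TwoSidedIdeal.mem_comap]) hi hj
  simp [TwoSidedIdeal.mem_comap, blockIdempotent_mem_blockIdeal_iff] at hi'

theorem eq_of_isLeftPower
    (hi : IsLeftPower φ (Submodule.span S {d.symm (blockIdempotent R hn i)}))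
    (hj : IsLeftPower φ (Submodule.span S {d.symm (blockIdempotent R hn j)})) : i = j := by
  by_contra hij
  have hj' : blockIdempotent R hn j ∈ blockIdeal R n i :=
    (blockIdempotent_mem_blockIdeal_iff hn).2 (Ne.symm hij)
  have hi' := mem_of_isLeftPower (I := (blockIdeal R n i).comap d)
    (isIdempotentElem_symm_blockIdempotent d hn j) (by simpa [TwoSidedIdeal.mem_comap]) hi hj
  simp [TwoSidedIdeal.mem_comap, blockIdempotent_mem_blockIdeal_iff] at hi'

end Types

section Azumaya

theorem end_apply_mem_of_isAzumaya {R A : Type*} [CommRing R] [Ring A] [Algebra R A]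
    [IsAzumaya R A] {I : TwoSidedIdeal A} (g : Module.End R A) {x : A} (hx : x ∈ I) : g x ∈ I := by
  obtain ⟨t, rfl⟩ := (IsAzumaya.bij (R := R) (A := A)).2 g
  induction t with
  | zero => simp [I.zero_mem]
  | tmul a b =>
    rw [AlgHom.mulLeftRight_apply]
    exact I.mul_mem_right _ _ (I.mul_mem_left _ _ hx)
  | add s t hs ht =>
    rw [map_add]
    exact I.add_mem hs ht

theorem eq_of_isAzumaya_blockOrder (hn : ∀ i, 0 < n i) [IsAzumaya R (blockOrder R n)]
    (i j : Fin r) : i = j := by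
  by_contra hij
  let c : Σ i, Fin (n i) := ⟨j, n j - 1, Nat.sub_lt (hn j) one_pos⟩
  let g : Module.End R (blockOrder R n) :=
    (Matrix.entryLinearMap R R c c ∘ₗ (blockOrder R n).val.toLinearMap).smulRight 1
  have hg : g (blockIdempotent R hn j) = 1 := by
    change (Matrix.single c c (1 : R)) c c • (1 : blockOrder R n) = 1
    rw [Matrix.single_apply_same, one_smul]
  have hone := end_apply_mem_of_isAzumaya g
    ((blockIdempotent_mem_blockIdeal_iff (R := R) hn).2 (Ne.symm hij))
  rw [hg] at hone
  simpa using mem_blockIdeal.1 hone ⟨0, hn i⟩ ⟨0, hn i⟩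

theorem isAzumaya_blockOrder [Nonempty (Σ i, Fin (n i))] [Subsingleton (Fin r)] :
    IsAzumaya R (blockOrder R n) := by
  have htop : blockOrder R n = ⊤ :=
    top_unique fun M _ a b hab => absurd (Subsingleton.elim b.1 a.1) hab.ne
  have := IsAzumaya.matrix R (Σ i, Fin (n i))
  rw [htop]
  exact IsAzumaya.of_AlgEquiv R _ _ Subalgebra.topEquiv.symm

theorem blockCount_pos {A : Type*} [Ring A] [Nontrivial A] [Algebra R A]
    (d : A ≃ₐ[R] blockOrder R n) : 0 < r := by
  refine Nat.pos_of_ne_zero fun hr => ?_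
  subst hr
  exact not_subsingleton A d.toEquiv.subsingleton

end Azumaya

end BlockIdeal

section LocalOrders

variable {R E E' : Type*} [CommRing R] [Ring E] [Algebra R E] [Ring E'] [Algebra R E']
  {A B : Subalgebra R E}

theorem IsLocalOrder.map (hA : IsLocalOrder A) (T : E ≃ₐ[R] E') :
    IsLocalOrder (A.map (T : E →ₐ[R] E')) := by
  refine ⟨?_, fun x => ?_⟩
  · rw [Subalgebra.map_toSubmodule]
    exact hA.1.map _
  · obtain ⟨r, hr, hrx⟩ := hA.2 (T.symm x)
    exact ⟨r, hr, r • T.symm x, hrx, by simp⟩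

theorem IsLocalOrder.of_smul_mem [IsNoetherianRing R] [NoZeroDivisors R] (hB : IsLocalOrder B)
    (hAB : A ≤ B) {c : R} (hc : c ≠ 0) (hcB : ∀ x ∈ B, c • x ∈ A) : IsLocalOrder A := by
  refine ⟨Submodule.FG.of_le hB.1 hAB, fun x => ?_⟩
  obtain ⟨r, hr, hrx⟩ := hB.2 x
  exact ⟨c * r, mul_ne_zero hc hr, by simpa only [mul_smul] using hcB _ hrx⟩

end LocalOrders

section DiagOrder

variable (R : Type*) {K ι : Type*} [CommRing R] [Field K] [Algebra R K] [Fintype ι]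
  [DecidableEq ι]

theorem isLocalOrder_range_mapMatrix [IsDomain R] [IsFractionRing R K] :
    IsLocalOrder ((Algebra.ofId R K).mapMatrix (m := ι)).range := by
  refine ⟨?_, fun M => ?_⟩
  · change (LinearMap.range ((Algebra.ofId R K).mapMatrix (m := ι)).toLinearMap).FG
    rw [LinearMap.range_eq_map]
    exact Module.Finite.fg_top.map _
  · obtain ⟨b, hb⟩ := IsLocalization.exist_integer_multiples_of_finite (nonZeroDivisors R)
      fun t : ι × ι => M t.1 t.2
    choose y hy using hb
    exact ⟨b, nonZeroDivisors.ne_zero b.2, Matrix.of fun s t => y (s, t),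
      Matrix.ext fun s t => hy (s, t)⟩

/-- The order of the matrices that preserve the lattice `⨁ u_a R` in `K ^ ι`, encoded as the
conjugate of `Mat_ι(R)` by the diagonal matrix with entries `u_a`. -/
def diagOrder (u : ι → Kˣ) : Subalgebra R (Matrix ι ι K) :=
  ((Algebra.ofId R K).mapMatrix (m := ι)).range.map
    ((MulSemiringAction.toAlgEquiv R (Matrix ι ι K) (ConjAct.toConjAct (Units.map
      (Matrix.diagonalRingHom ι K : (ι → K) →* Matrix ι ι K) (MulEquiv.piUnits.symm u))) :
        Matrix ι ι K ≃ₐ[R] Matrix ι ι K) : Matrix ι ι K →ₐ[R] Matrix ι ι K)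

variable {R}

theorem isLocalOrder_diagOrder [IsDomain R] [IsFractionRing R K] (u : ι → Kˣ) :
    IsLocalOrder (diagOrder R u) :=
  (isLocalOrder_range_mapMatrix R).map _

theorem mem_diagOrder {u : ι → Kˣ} {M : Matrix ι ι K} : M ∈ diagOrder R u ↔
    ∀ a b, (u a : K)⁻¹ * M a b * u b ∈ (algebraMap R K).range := by
  have hconj (N : Matrix ι ι K) (a b : ι) : MulSemiringAction.toAlgEquiv R (Matrix ι ι K)
      (ConjAct.toConjAct (Units.map (Matrix.diagonalRingHom ι K : (ι → K) →* Matrix ι ι K)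
        (MulEquiv.piUnits.symm u))) N a b = u a * N a b * (u b : K)⁻¹ := by
    change (Matrix.diagonal (fun a => (u a : K)) * N *
      Matrix.diagonal fun a => ((u a)⁻¹ : Kˣ).val) a b = _
    simp
  constructor
  · rintro ⟨_, ⟨N, rfl⟩, rfl⟩ a b
    refine ⟨N a b, ((congrArg (fun z => (u a : K)⁻¹ * z * u b) (hconj _ a b)).trans ?_).symm⟩
    change _ * (_ * algebraMap R K (N a b) * _) * _ = algebraMap R K (N a b)
    field_simp
  · intro h
    choose N hN using h
    refine ⟨_, ⟨Matrix.of N, rfl⟩, Matrix.ext fun a b => (hconj _ a b).trans ?_⟩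
    change _ * algebraMap R K (N a b) * _ = _
    rw [hN]
    field_simp

theorem single_mem_diagOrder {u : ι → Kˣ} {a b : ι} {x : K} :
    Matrix.single a b x ∈ diagOrder R u ↔ (u a : K)⁻¹ * x * u b ∈ (algebraMap R K).range := by
  refine ⟨fun h => by simpa using mem_diagOrder.1 h a b, fun h => mem_diagOrder.2 fun c d => ?_⟩
  rw [Matrix.single_apply]
  split_ifs with hcd
  · obtain ⟨rfl, rfl⟩ := hcd
    exact h
  · simp

theorem mem_range_of_single_mem [IsFractionRing R K] [IsIntegrallyClosed R] [IsNoetherianRing R]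
    {B : Subalgebra R (Matrix ι ι K)} (hB : IsLocalOrder B) {a : ι}
    (hone : Matrix.single a a (1 : K) ∈ B) {x : K} (hx : Matrix.single a a x ∈ B) :
    x ∈ (algebraMap R K).range := by
  let S : Subalgebra R K :=
    { carrier := {y | Matrix.single a a y ∈ B}
      mul_mem' := fun {y z} hy hz => by
        have := B.mul_mem hy hz
        rwa [Matrix.single_mul_single_same] at this
      add_mem' := fun {y z} hy hz => by
        have := B.add_mem hy hz
        rwa [← Matrix.single_add] at this
      algebraMap_mem' := fun c => by
        have := B.smul_mem hone c
        rwa [Matrix.smul_single, ← Algebra.algebraMap_eq_smul_one] at this }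
  have hinj : Function.Injective (Matrix.singleLinearMap R a a : K →ₗ[R] Matrix ι ι K) :=
    fun y z hyz => by simpa using congrFun₂ hyz a a
  have hS : (Subalgebra.toSubmodule S).FG :=
    Submodule.fg_of_fg_map_injective _ hinj
      (Submodule.FG.of_le hB.1 (Submodule.map_le_iff_le_comap.2 fun _ hy => hy))
  exact IsIntegrallyClosed.isIntegral_iff.1 (IsIntegral.of_mem_of_fg S hS x hx)

theorem le_diagOrder_of_forall_single {B : Subalgebra R (Matrix ι ι K)} {u : ι → Kˣ} (o : ι)
    (hone : ∀ a, Matrix.single a a (1 : K) ∈ B)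
    (ho : ∀ a x, Matrix.single a o x ∈ B ↔ (u a : K)⁻¹ * x ∈ (algebraMap R K).range) :
    B ≤ diagOrder R u := by
  refine fun M hM => mem_diagOrder.2 fun a b => ?_
  have hu : Matrix.single b o (u b : K) ∈ B := (ho b _).2 ⟨1, by simp⟩
  rw [mul_assoc, ← ho]
  simpa only [Matrix.single_mul_mul_single, one_mul] using mul_mem (mul_mem (hone a) hM) hu

end DiagOrder

section Weights

variable {K : Type*} [Field K] {r : ℕ} {n : Fin r → ℕ}

/-- The weights of the `j`-th lattice in the chain of lattices attached to a block order: `ϖ` on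
the blocks after the `j`-th one and `1` on the others. -/
def blockWeight (ϖ : Kˣ) (j : Fin r) (a : Σ i, Fin (n i)) : Kˣ := if j < a.1 then ϖ else 1

variable {R : Type*} [CommRing R] [IsDomain R] [IsDiscreteValuationRing R] [Algebra R K] {π : R}
  {ϖ : Kˣ}

theorem exists_mem_maximalIdeal_iff (hπ : Irreducible π) (hϖ : (ϖ : K) = algebraMap R K π)
    (p : Prop) [Decidable p] (x : K) :
    (∃ y : R, algebraMap R K y = x ∧ (p → y ∈ IsLocalRing.maximalIdeal R)) ↔
      ((if p then ϖ else 1 : Kˣ) : K)⁻¹ * x ∈ (algebraMap R K).range := by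
  rw [hπ.maximalIdeal_eq]
  split_ifs with hp
  · simp only [hp, true_imp_iff, Ideal.mem_span_singleton']
    constructor
    · rintro ⟨_, rfl, z, rfl⟩
      exact ⟨z, by rw [map_mul, ← hϖ]; field_simp⟩
    · rintro ⟨z, hz⟩
      exact ⟨z * π, by rw [map_mul, ← hϖ, hz]; field_simp, z, rfl⟩
  · simp [hp]

theorem fracBlockOrder_eq_iInf (hπ : Irreducible π) (hϖ : (ϖ : K) = algebraMap R K π) :
    fracBlockOrder R K n = ⨅ j, diagOrder R (blockWeight ϖ j) := by
  ext M
  simp only [mem_fracBlockOrder, exists_mem_maximalIdeal_iff hπ hϖ, Algebra.mem_iInf,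
    mem_diagOrder]
  refine ⟨fun h j a b => ?_, fun h a b => ?_⟩
  · have hϖmem : (ϖ : K) ∈ (algebraMap R K).range := ⟨π, hϖ.symm⟩
    have hab := h a b
    have hM : M a b ∈ (algebraMap R K).range := by
      split_ifs at hab with hba
      · simpa using mul_mem hϖmem hab
      · simpa using hab
    by_cases ha : j < a.1 <;> by_cases hb : j < b.1
    · simpa [blockWeight, ha, hb, mul_right_comm] using hM
    · simpa [blockWeight, ha, hb, (not_lt.1 hb).trans_lt ha] using hab
    · simpa [blockWeight, ha, hb] using mul_mem hM hϖmem
    · simpa [blockWeight, ha, hb] using hM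
  · simpa [blockWeight] using h b.1 a b

theorem eq_of_diagOrder_le [IsFractionRing R K] (hπ : Irreducible π)
    (hϖ : (ϖ : K) = algebraMap R K π) (hn : ∀ i, 0 < n i) {j j' : Fin r}
    (h : diagOrder R (blockWeight (n := n) ϖ j) ≤ diagOrder R (blockWeight ϖ j')) : j = j' := by
  have hinv : (ϖ : K)⁻¹ ∉ (algebraMap R K).range := by
    intro hmem
    obtain ⟨y, hy, hym⟩ := (exists_mem_maximalIdeal_iff hπ hϖ True 1).2 (by simpa using hmem)
    rw [(IsFractionRing.injective R K) (hy.trans (map_one _).symm)] at hym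
    exact (Ideal.ne_top_iff_one _).1 Ideal.IsPrime.ne_top' (hym trivial)
  by_contra hne
  let a : Σ i, Fin (n i) := ⟨j, 0, hn j⟩
  let b : Σ i, Fin (n i) := ⟨j', 0, hn j'⟩
  have hab := single_mem_diagOrder.1 (h (single_mem_diagOrder (R := R) (a := a) (b := b)
    (x := blockWeight ϖ j a * (blockWeight ϖ j b : K)⁻¹) |>.2 ⟨1, by simp⟩))
  refine hinv ?_
  rcases lt_or_gt_of_ne hne with hlt | hlt <;>
    simpa [blockWeight, a, b, hlt, hlt.le, hlt.not_gt] using hab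

end Weights

section Classification

variable {R K : Type*} [CommRing R] [IsDomain R] [IsDiscreteValuationRing R] [Field K]
  [Algebra R K] {r : ℕ} {n : Fin r → ℕ}

theorem single_mem_fracBlockOrder {a b : Σ i, Fin (n i)} {y : R}
    (hy : b.1 < a.1 → y ∈ IsLocalRing.maximalIdeal R) :
    Matrix.single a b (algebraMap R K y) ∈ fracBlockOrder R K n := by
  rw [mem_fracBlockOrder]
  intro a' b'
  rw [Matrix.single_apply]
  split_ifs with h
  · obtain ⟨rfl, rfl⟩ := h
    exact ⟨y, rfl, hy⟩
  · exact ⟨0, map_zero _, fun _ => zero_mem _⟩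

theorem single_one_mem_fracBlockOrder {a b : Σ i, Fin (n i)} (hab : a.1 ≤ b.1) :
    Matrix.single a b (1 : K) ∈ fracBlockOrder R K n := by
  simpa using single_mem_fracBlockOrder (K := K) (y := (1 : R)) (a := a) fun h =>
    absurd hab h.not_ge

variable {B : Subalgebra R (Matrix (Σ i, Fin (n i)) (Σ i, Fin (n i)) K)} {π : R} {ϖ : Kˣ}

theorem single_mem_of_fst_le (hB : fracBlockOrder R K n ≤ B) {a b o : Σ i, Fin (n i)}
    (hab : a.1 ≤ b.1) {x : K} (hx : Matrix.single b o x ∈ B) : Matrix.single a o x ∈ B := by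
  simpa using mul_mem (hB (single_one_mem_fracBlockOrder hab)) hx

/- Let `j` be the last block in which the column `o` of `B` contains `1`. Up to `j` the column is
`R`, and after `j` it is `𝔪 = ϖ R`, since it is closed under multiplication by units. -/
theorem exists_single_mem_iff [IsFractionRing R K] (hπ : Irreducible π)
    (hϖ : (ϖ : K) = algebraMap R K π) (hB : IsLocalOrder B) (hle : fracBlockOrder R K n ≤ B)
    {o : Σ i, Fin (n i)} (ho : ∀ a : Σ i, Fin (n i), o.1 ≤ a.1) :
    ∃ j, ∀ a x, Matrix.single a o x ∈ B ↔
      (blockWeight ϖ j a : K)⁻¹ * x ∈ (algebraMap R K).range := by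
  classical
  have hint {a x} (hx : Matrix.single a o x ∈ B) : x ∈ (algebraMap R K).range :=
    mem_range_of_single_mem hB (hle (single_one_mem_fracBlockOrder le_rfl))
      (single_mem_of_fst_le hle (ho a) hx)
  let s : Finset (Fin r) := {i | ∃ a : Σ i, Fin (n i), i ≤ a.1 ∧ Matrix.single a o (1 : K) ∈ B}
  have mem_s (i) : i ∈ s ↔ ∃ a : Σ i, Fin (n i), i ≤ a.1 ∧ Matrix.single a o (1 : K) ∈ B := by
    simp [s]
  have hs : s.Nonempty := ⟨o.1, (mem_s _).2
    ⟨o, le_rfl, hle (single_one_mem_fracBlockOrder le_rfl)⟩⟩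
  refine ⟨s.max' hs, fun a x => ?_⟩
  rw [blockWeight, ← exists_mem_maximalIdeal_iff hπ hϖ]
  constructor
  · intro hx
    obtain ⟨y, rfl⟩ := hint hx
    refine ⟨y, rfl, fun ha => (IsLocalRing.mem_maximalIdeal y).2 ?_⟩
    rintro ⟨y, rfl⟩
    refine (s.le_max' a.1 ((mem_s _).2 ⟨a, le_rfl, ?_⟩)).not_gt ha
    have hone := B.smul_mem hx (↑y⁻¹ : R)
    rwa [Matrix.smul_single, Algebra.smul_def, ← map_mul, Units.inv_mul, map_one] at hone
  · rintro ⟨y, rfl, hy⟩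
    by_cases ha : s.max' hs < a.1
    · exact hle (single_mem_fracBlockOrder fun _ => hy ha)
    · obtain ⟨b, hb, hbB⟩ := (mem_s _).1 (s.max'_mem hs)
      simpa only [Matrix.smul_single, ← Algebra.algebraMap_eq_smul_one] using
        B.smul_mem (single_mem_of_fst_le hle ((not_lt.1 ha).trans hb) hbB) y

theorem exists_le_diagOrder [IsFractionRing R K] (hπ : Irreducible π)
    (hϖ : (ϖ : K) = algebraMap R K π) (hr : 0 < r) (hn : ∀ i, 0 < n i) (hB : IsLocalOrder B)
    (hle : fracBlockOrder R K n ≤ B) : ∃ j, B ≤ diagOrder R (blockWeight ϖ j) := by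
  obtain ⟨j, hj⟩ := exists_single_mem_iff hπ hϖ hB hle (o := ⟨⟨0, hr⟩, ⟨0, hn _⟩⟩)
    fun a => Fin.le_def.2 (Nat.zero_le _)
  exact ⟨j, le_diagOrder_of_forall_single _
    (fun a => hle (single_one_mem_fracBlockOrder le_rfl)) hj⟩

theorem isLocalOrder_fracBlockOrder [IsFractionRing R K] :
    IsLocalOrder (fracBlockOrder R K n) := by
  obtain ⟨π, hπ⟩ := IsDiscreteValuationRing.exists_irreducible R
  refine (isLocalOrder_range_mapMatrix R).of_smul_mem ?_ hπ.ne_zero ?_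
  · rintro _ ⟨M, -, rfl⟩
    exact ⟨M, rfl⟩
  · rintro _ ⟨M, rfl⟩
    refine ⟨π • M, fun a b _ => ?_, map_smul (Algebra.ofId R K).mapMatrix π M⟩
    rw [hπ.maximalIdeal_eq]
    exact Ideal.mul_mem_right _ _ (Ideal.mem_span_singleton_self π)

end Classification

section Powers

variable {R K : Type*} [CommRing R] [IsDomain R] [IsDiscreteValuationRing R] [Field K]
  [Algebra R K] {r : ℕ} {n : Fin r → ℕ} {π : R} {ϖ : Kˣ} {u : (Σ i, Fin (n i)) → Kˣ}
  {M : Matrix (Σ i, Fin (n i)) (Σ i, Fin (n i)) K} {α : Σ i, Fin (n i)}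

theorem single_mul_mem_diagOrder_iff (hπ : Irreducible π) (hϖ : (ϖ : K) = algebraMap R K π)
    {c : Kˣ} (hu : ∀ a, c = u a * if a.1 < α.1 then ϖ else 1)
    (hM : Matrix.single α α 1 * M = M) (a : Σ i, Fin (n i)) :
    Matrix.single a α (u a * (c : K)⁻¹) * M ∈ diagOrder R u ↔ M ∈ fracBlockOrder R K n := by
  simp only [mem_fracBlockOrder, mem_diagOrder, exists_mem_maximalIdeal_iff hπ hϖ]
  have hrow (a' b) (ha' : a' ≠ α) : M a' b = 0 := by
    rw [← hM, Matrix.single_mul_apply_of_ne _ _ _ _ _ ha']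
  have hentry (b) : (u a : K)⁻¹ * (u a * (c : K)⁻¹ * M α b) * u b =
      ((if b.1 < α.1 then ϖ else 1 : Kˣ) : K)⁻¹ * M α b := by
    rw [hu b, Units.val_mul]
    field_simp
  refine ⟨fun h a' b => ?_, fun h a' b => ?_⟩
  · by_cases ha' : a' = α
    · subst ha'
      simpa only [Matrix.single_mul_apply_same, hentry] using h a b
    · simp [hrow a' b ha']
  · by_cases ha' : a' = a
    · subst ha'
      simpa only [Matrix.single_mul_apply_same, hentry] using h α b
    · simp [Matrix.single_mul_apply_of_ne _ _ _ _ _ ha']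

theorem mul_single_mem_diagOrder_iff (hπ : Irreducible π) (hϖ : (ϖ : K) = algebraMap R K π)
    (hu : ∀ a, u a = if α.1 < a.1 then ϖ else 1) (hM : M * Matrix.single α α 1 = M)
    (a : Σ i, Fin (n i)) :
    M * Matrix.single α a (u a : K)⁻¹ ∈ diagOrder R u ↔ M ∈ fracBlockOrder R K n := by
  simp only [mem_fracBlockOrder, mem_diagOrder, exists_mem_maximalIdeal_iff hπ hϖ]
  have hcol (b a') (ha' : a' ≠ α) : M b a' = 0 := by
    rw [← hM, Matrix.mul_single_apply_of_ne _ _ _ _ _ ha']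
  have hentry (b) : (u b : K)⁻¹ * (M b α * (u a : K)⁻¹) * u a =
      ((if α.1 < b.1 then ϖ else 1 : Kˣ) : K)⁻¹ * M b α := by
    rw [← hu b]
    field_simp
  refine ⟨fun h b a' => ?_, fun h b a' => ?_⟩
  · by_cases ha' : a' = α
    · subst ha'
      simpa only [Matrix.mul_single_apply_same, hentry] using h b a
    · simp [hcol b a' ha']
  · by_cases ha' : a' = a
    · subst ha'
      simpa only [Matrix.mul_single_apply_same, hentry] using h b α
    · simp [Matrix.mul_single_apply_of_ne _ _ _ _ _ ha']

variable {E : Type v} [Ring E] [Algebra K E] [Algebra R E] {A B : Subalgebra R E}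
  (T : E ≃ₐ[K] Matrix (Σ i, Fin (n i)) (Σ i, Fin (n i)) K)

theorem isRightPower_of_weight (hπ : Irreducible π) (hϖ : (ϖ : K) = algebraMap R K π)
    (hA : ∀ x, x ∈ A ↔ T x ∈ fracBlockOrder R K n) (hB : ∀ x, x ∈ B ↔ T x ∈ diagOrder R u)
    (hAB : A ≤ B) {c : Kˣ} (hu : ∀ a, c = u a * if a.1 < α.1 then ϖ else 1) {e : A}
    (he : T e = Matrix.single α α 1) :
    IsRightPower ((Subalgebra.inclusion hAB : A →ₐ[R] B) : A →+* B)
      (Submodule.span Aᵐᵒᵖ {e}) := by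
  have : Nonempty (Σ i, Fin (n i)) := ⟨α⟩
  have hunit (a) : u a * (c : K)⁻¹ * (c * (u a : K)⁻¹) = 1 := by field_simp
  refine isRightPower_of_matrixUnits hAB (κ := Σ i, Fin (n i))
    (Subtype.ext (T.injective (by simp [he])))
    (fun a => T.symm (Matrix.single α a (c * (u a : K)⁻¹)))
    (fun a => T.symm (Matrix.single a α (u a * (c : K)⁻¹))) (fun a b => ?_) ?_ (fun a => ?_)
    fun a y hy => ?_
  · apply T.injective
    rw [map_mul, AlgEquiv.apply_symm_apply, AlgEquiv.apply_symm_apply, apply_ite T, he, map_zero]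
    split_ifs with h
    · subst h
      rw [Matrix.single_mul_single_same]
      congr 1
      field_simp
    · rw [Matrix.single_mul_single_of_ne _ _ _ _ h]
  · apply T.injective
    simp [hunit, Matrix.sum_single_one]
  · rw [hB, map_mul, AlgEquiv.apply_symm_apply, AlgEquiv.apply_symm_apply,
      Matrix.single_mul_single_same, hunit]
    exact single_mem_diagOrder.2 ⟨1, by simp⟩
  · rw [hA, hB, map_mul, AlgEquiv.apply_symm_apply]
    exact single_mul_mem_diagOrder_iff hπ hϖ hu (by rw [← he, ← map_mul, hy]) a

theorem isLeftPower_of_weight (hπ : Irreducible π) (hϖ : (ϖ : K) = algebraMap R K π)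
    (hA : ∀ x, x ∈ A ↔ T x ∈ fracBlockOrder R K n) (hB : ∀ x, x ∈ B ↔ T x ∈ diagOrder R u)
    (hAB : A ≤ B) (hu : ∀ a, u a = if α.1 < a.1 then ϖ else 1) {e : A}
    (he : T e = Matrix.single α α 1) :
    IsLeftPower ((Subalgebra.inclusion hAB : A →ₐ[R] B) : A →+* B) (Submodule.span A {e}) := by
  have : Nonempty (Σ i, Fin (n i)) := ⟨α⟩
  refine isLeftPower_of_matrixUnits hAB (κ := Σ i, Fin (n i))
    (Subtype.ext (T.injective (by simp [he])))
    (fun a => T.symm (Matrix.single a α (u a : K)))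
    (fun a => T.symm (Matrix.single α a (u a : K)⁻¹)) (fun a b => ?_) ?_ (fun a => ?_)
    fun a y hy => ?_
  · apply T.injective
    rw [map_mul, AlgEquiv.apply_symm_apply, AlgEquiv.apply_symm_apply, apply_ite T, he, map_zero]
    split_ifs with h
    · subst h
      rw [Matrix.single_mul_single_same]
      congr 1
      field_simp
    · rw [Matrix.single_mul_single_of_ne _ _ _ _ (Ne.symm h)]
  · apply T.injective
    simp [Matrix.sum_single_one]
  · rw [hB, map_mul, AlgEquiv.apply_symm_apply, AlgEquiv.apply_symm_apply,
      Matrix.single_mul_single_same]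
    exact single_mem_diagOrder.2 ⟨1, by simp⟩
  · rw [hA, hB, map_mul, AlgEquiv.apply_symm_apply]
    exact mul_single_mem_diagOrder_iff hπ hϖ hu (by rw [← he, ← map_mul, hy]) a

end Powers

section LocalOverorders

/- The weight is `1` for the last lattice of the chain, whose successor is `ϖ` times the first one,
and `ϖ` otherwise. -/
theorem exists_eq_blockWeight_mul {K : Type*} [Field K] {r : ℕ} {n : Fin r → ℕ} (ϖ : Kˣ)
    (j : Fin r) : ∃ c : Kˣ, ∀ a : Σ i, Fin (n i),
      c = blockWeight ϖ j a * if a.1 < finRotate r j then ϖ else 1 := by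
  obtain ⟨s, rfl⟩ := Nat.exists_eq_succ_of_ne_zero (Fin.pos j).ne'
  by_cases hj : j = Fin.last s
  · refine ⟨1, fun a => ?_⟩
    simp [blockWeight, hj, (Fin.le_last a.1).not_gt]
  · refine ⟨ϖ, fun a => ?_⟩
    have hlt : a.1 < finRotate (s + 1) j ↔ ¬ j < a.1 := by
      rw [finRotate_apply, not_lt, Fin.lt_def,
        Fin.val_add_one_of_lt (Fin.lt_last_iff_ne_last.2 hj), Fin.le_def, Nat.lt_succ_iff]
    by_cases ha : j < a.1 <;> simp only [blockWeight, hlt, ha, not_true, not_false_iff, if_true,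
      if_false, one_mul, mul_one]

variable {R K : Type*} [CommRing R] [Field K] [Algebra R K] {r : ℕ} {n : Fin r → ℕ}
  {E : Type v} [Ring E] [Algebra R E] [Algebra K E] [IsScalarTower R K E]
  (T : E ≃ₐ[K] Matrix (Σ i, Fin (n i)) (Σ i, Fin (n i)) K) {π : R} {ϖ : Kˣ}

variable (R) in
/-- The `j`-th maximal overorder of an order that the isomorphism `T` turns into a block order: the
endomorphisms of the `j`-th lattice in the corresponding chain. -/
def maximalOverorder (ϖ : Kˣ) (j : Fin r) : Subalgebra R E :=
  (diagOrder R (blockWeight ϖ j)).map (T.restrictScalars R).symm.toAlgHom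

variable {T}

theorem mem_maximalOverorder {j : Fin r} {x : E} :
    x ∈ maximalOverorder R T ϖ j ↔ T x ∈ diagOrder R (blockWeight ϖ j) := by
  constructor
  · rintro ⟨M, hM, rfl⟩
    exact (T.apply_symm_apply M).symm ▸ hM
  · exact fun hx => ⟨T x, hx, T.symm_apply_apply x⟩

theorem exists_algEquiv_fracBlockOrder [IsDomain R] [IsDiscreteValuationRing R]
    [IsFractionRing R K] {A : Subalgebra R E} (hA : IsLocalOrder A)
    (d : A ≃ₐ[R] blockOrder R n) :
    ∃ T : E ≃ₐ[K] Matrix (Σ i, Fin (n i)) (Σ i, Fin (n i)) K,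
      (∀ a : A, T a = (d a : Matrix _ _ R).map (algebraMap R K)) ∧
        ∀ x, x ∈ A ↔ T x ∈ fracBlockOrder R K n := by
  obtain ⟨T, hT⟩ := exists_algEquiv_extension (K := K) hA.2
    (isLocalOrder_fracBlockOrder (R := R) (K := K) (n := n)).2 (d.trans (fracBlockOrderEquiv R K))
  refine ⟨T, hT, fun x => ⟨fun hx => ?_, fun hx => ?_⟩⟩
  · rw [hT ⟨x, hx⟩]
    exact Subtype.property _
  · have hx' := hT ((d.trans (fracBlockOrderEquiv R K)).symm ⟨T x, hx⟩)
    rw [AlgEquiv.apply_symm_apply] at hx'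
    rw [← T.injective hx']
    exact Subtype.property _

theorem isLocalOrder_maximalOverorder [IsDomain R] [IsFractionRing R K] (j : Fin r) :
    IsLocalOrder (maximalOverorder R T ϖ j) :=
  (isLocalOrder_diagOrder (blockWeight ϖ j)).map (T.restrictScalars R).symm

variable [IsDomain R] [IsDiscreteValuationRing R] {A : Subalgebra R E}

theorem iInf_maximalOverorder (hπ : Irreducible π) (hϖ : (ϖ : K) = algebraMap R K π)
    (hA : ∀ x, x ∈ A ↔ T x ∈ fracBlockOrder R K n) : ⨅ j, maximalOverorder R T ϖ j = A := by
  ext x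
  simp only [hA, fracBlockOrder_eq_iInf hπ hϖ, Algebra.mem_iInf, mem_maximalOverorder]

variable [IsFractionRing R K]

theorem exists_le_maximalOverorder (hπ : Irreducible π) (hϖ : (ϖ : K) = algebraMap R K π)
    (hA : ∀ x, x ∈ A ↔ T x ∈ fracBlockOrder R K n) (hr : 0 < r) (hn : ∀ i, 0 < n i)
    {B : Subalgebra R E} (hB : IsLocalOrder B) (hAB : A ≤ B) :
    ∃ j, B ≤ maximalOverorder R T ϖ j := by
  obtain ⟨j, hj⟩ := exists_le_diagOrder hπ hϖ hr hn (hB.map (T.restrictScalars R)) fun M hM =>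
    ⟨T.symm M, hAB ((hA _).2 (by rwa [T.apply_symm_apply])), T.apply_symm_apply M⟩
  exact ⟨j, fun x hx => mem_maximalOverorder.2 (hj ⟨x, hx, rfl⟩)⟩

theorem eq_of_maximalOverorder_le (hπ : Irreducible π) (hϖ : (ϖ : K) = algebraMap R K π)
    (hn : ∀ i, 0 < n i) {j j' : Fin r}
    (h : maximalOverorder R T ϖ j ≤ maximalOverorder R T ϖ j') : j = j' := by
  refine eq_of_diagOrder_le hπ hϖ hn fun M hM => ?_
  rw [← T.apply_symm_apply M] at hM ⊢
  exact mem_maximalOverorder.1 (h (mem_maximalOverorder.2 hM))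

theorem exists_maximal_overorders (K : Type*) [Field K] [Algebra R K] [IsFractionRing R K]
    [Algebra K E] [IsScalarTower R K E] (hA : IsLocalOrder A)
    (d : A ≃ₐ[R] blockOrder R n) (hr : 0 < r) (hn : ∀ i, 0 < n i) :
    ∃ (M : Fin r → Subalgebra R E) (σ : Equiv.Perm (Fin r)), ⨅ j, M j = A ∧
      (∀ j, IsLocalOrder (M j)) ∧ (∀ B, IsLocalOrder B → A ≤ B → ∃ j, B ≤ M j) ∧
      (∀ j j', M j ≤ M j' → j = j') ∧
      ∀ j B (h : A ≤ B), B = M j → ∀ i,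
        (IsRightPower ((Subalgebra.inclusion h : A →ₐ[R] B) : A →+* B)
          (Submodule.span Aᵐᵒᵖ {d.symm (blockIdempotent R hn i)}) ↔ i = σ j) ∧
        (IsLeftPower ((Subalgebra.inclusion h : A →ₐ[R] B) : A →+* B)
          (Submodule.span A {d.symm (blockIdempotent R hn i)}) ↔ i = j) := by
  obtain ⟨π, hπ⟩ := IsDiscreteValuationRing.exists_irreducible R
  obtain ⟨ϖ, hϖ⟩ : ∃ ϖ : Kˣ, (ϖ : K) = algebraMap R K π :=
    ⟨Units.mk0 (algebraMap R K π) (by simpa using hπ.ne_zero), rfl⟩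
  obtain ⟨T, hT, hTA⟩ := exists_algEquiv_fracBlockOrder (K := K) hA d
  have he (i : Fin r) : T (d.symm (blockIdempotent R hn i)) =
      Matrix.single ⟨i, n i - 1, Nat.sub_lt (hn i) one_pos⟩
        ⟨i, n i - 1, Nat.sub_lt (hn i) one_pos⟩ 1 := by
    rw [hT, AlgEquiv.apply_symm_apply]
    exact (Matrix.map_single _ _ _ _).trans (by rw [map_one])
  refine ⟨maximalOverorder R T ϖ, finRotate r, iInf_maximalOverorder hπ hϖ hTA,
    isLocalOrder_maximalOverorder, fun B => exists_le_maximalOverorder hπ hϖ hTA hr hn,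
    fun j j' => eq_of_maximalOverorder_le hπ hϖ hn, ?_⟩
  rintro j _ h rfl i
  obtain ⟨c, hc⟩ := exists_eq_blockWeight_mul (n := n) ϖ j
  have hright := isRightPower_of_weight T hπ hϖ hTA (fun x => mem_maximalOverorder) h
    (α := ⟨finRotate r j, _⟩) hc (he _)
  have hleft := isLeftPower_of_weight T hπ hϖ hTA (fun x => mem_maximalOverorder) h
    (fun a => rfl) (he j)
  exact ⟨⟨fun hi => eq_of_isRightPower d hi hright, fun hi => hi ▸ hright⟩,
    ⟨fun hi => eq_of_isLeftPower d hi hleft, fun hi => hi ▸ hleft⟩⟩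

end LocalOverorders

section Sections

variable {X : Scheme.{u}} [IsIntegral X] {D : Type v} [Ring D] [Algebra X.functionField D]

instance isScalarTower_stalk (p : X) : IsScalarTower (X.presheaf.stalk p) X.functionField D :=
  IsScalarTower.of_algebraMap_eq fun _ => rfl

instance isScalarTower_sections (U : X.Opens) [Nonempty U] :
    IsScalarTower Γ(X, U) X.functionField D :=
  IsScalarTower.of_algebraMap_eq fun _ => rfl

instance isTorsionFree_stalk (p : X) : Module.IsTorsionFree (X.presheaf.stalk p) D :=
  Module.IsTorsionFree.trans_faithfulSMul _ X.functionField D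

instance isTorsionFree_sections (U : X.Opens) [Nonempty U] : Module.IsTorsionFree Γ(X, U) D :=
  have : FaithfulSMul Γ(X, U) X.functionField :=
    (faithfulSMul_iff_algebraMap_injective _ _).2 (X.germToFunctionField_injective U)
  Module.IsTorsionFree.trans_faithfulSMul _ X.functionField D

theorem germ_smul {U : X.Opens} [Nonempty U] {p : X} (hp : p ∈ U) (t : Γ(X, U)) (x : D) :
    X.presheaf.germ U p hp t • x = t • x := by
  rw [Algebra.smul_def, Algebra.smul_def]
  congr 1
  change algebraMap X.functionField D (algebraMap (X.presheaf.stalk p) X.functionField _) =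
    algebraMap X.functionField D (algebraMap Γ(X, U) X.functionField t)
  rw [Scheme.algebraMap_germ_eq_germToFunctionField]
  rfl

theorem germ_injective {U : X.Opens} {p : X} (hp : p ∈ U) :
    Function.Injective (X.presheaf.germ U p hp) := by
  have : Nonempty U := ⟨⟨p, hp⟩⟩
  intro s t hst
  apply X.germToFunctionField_injective U
  rw [← X.algebraMap_germ_eq_germToFunctionField hp, hst,
    X.algebraMap_germ_eq_germToFunctionField hp]

theorem span_sections_le_span_stalk {U : X.Opens} [Nonempty U] {p : X} (hp : p ∈ U) (T : Set D) :
    (Submodule.span Γ(X, U) T : Set D) ⊆ Submodule.span (X.presheaf.stalk p) T := by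
  intro y hy
  induction hy using Submodule.span_induction with
  | mem y hy => exact Submodule.subset_span hy
  | zero => exact zero_mem _
  | add y z _ _ hy hz => exact add_mem hy hz
  | smul a y _ hy =>
    rw [← germ_smul hp]
    exact Submodule.smul_mem _ _ hy

namespace OrderIn

variable (A : OrderIn X D)

theorem mem_stalk_of_mem_sections {U : X.Opens} [h : Nonempty U] {p : X} (hp : p ∈ U) {x : D}
    (hx : x ∈ A.sections U) : x ∈ A.stalk p := ⟨U, h, hp, hx⟩

theorem mem_sections_iff {U : X.Opens} [Nonempty U] {x : D} :
    x ∈ A.sections U ↔ ∀ p ∈ U, x ∈ A.stalk p := by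
  refine ⟨fun hx p hp => A.mem_stalk_of_mem_sections hp hx, fun h => A.local_mem U x ?_⟩
  intro p hp
  obtain ⟨V, hV, hpV, hxV⟩ := h p hp
  have : Nonempty (U ⊓ V : X.Opens) := ⟨⟨p, hp, hpV⟩⟩
  exact ⟨U ⊓ V, this, ⟨hp, hpV⟩, inf_le_left, A.restrict _ V inf_le_right x hxV⟩

variable {A} in
theorem le_iff_stalk_le {B : OrderIn X D} : A ≤ B ↔ ∀ p, A.stalk p ≤ B.stalk p := by
  refine ⟨fun h p => stalk_mono h p, fun h U _ x hx => ?_⟩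
  exact B.mem_sections_iff.2 fun p hp => h p (A.mem_sections_iff.1 hx p hp)

theorem mem_stalk_genericPoint (x : D) : x ∈ A.stalk (genericPoint X) := by
  obtain ⟨U, hU, hx⟩ := A.generic x
  exact A.mem_stalk_of_mem_sections (genericPoint_mem U) hx

theorem isOpen_setOf_mem_stalk (x : D) : IsOpen {p | x ∈ A.stalk p} := by
  rw [isOpen_iff_forall_mem_open]
  rintro p ⟨U, hU, hp, hx⟩
  exact ⟨U, fun q hq => ⟨U, hU, hq, hx⟩, U.isOpen, hp⟩

theorem exists_smul_mem_of_mem_stalk {U : X.Opens} [Nonempty U] (hU : IsAffineOpen U) {p : X}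
    (hp : p ∈ U) {x : D} (hx : x ∈ A.stalk p) :
    ∃ s : Γ(X, U), p ∈ X.basicOpen s ∧ s • x ∈ A.sections U := by
  obtain ⟨V, hV, hpV, hxV⟩ := hx
  obtain ⟨g, hgV, hpg⟩ := hU.exists_basicOpen_le (V := V) ⟨p, hpV⟩ hp
  have : Nonempty (X.basicOpen g) := ⟨⟨p, hpg⟩⟩
  obtain ⟨m, hm⟩ := A.quasiCoherent U hU g x (A.restrict _ V hgV x hxV)
  refine ⟨g ^ m, ?_, hm⟩
  rw [Scheme.mem_basicOpen _ _ _ hp] at hpg ⊢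
  rw [map_pow]
  exact hpg.pow m

theorem exists_smul_mem_sections {U : X.Opens} [Nonempty U] (hU : IsAffineOpen U) (x : D) :
    ∃ s : Γ(X, U), s ≠ 0 ∧ s • x ∈ A.sections U := by
  obtain ⟨s, hs, hsx⟩ := A.exists_smul_mem_of_mem_stalk hU (genericPoint_mem U)
    (A.mem_stalk_genericPoint x)
  refine ⟨s, ?_, hsx⟩
  rintro rfl
  rw [Scheme.mem_basicOpen _ _ _ (genericPoint_mem U), map_zero] at hs
  exact not_isUnit_zero hs

theorem span_stalk_eq {U : X.Opens} [Nonempty U] (hU : IsAffineOpen U) {p : X} (hp : p ∈ U)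
    {T : Set D} (hT : Submodule.span Γ(X, U) T = (A.sections U).toSubmodule) :
    Submodule.span (X.presheaf.stalk p) T = (A.stalk p).toSubmodule := by
  refine le_antisymm (Submodule.span_le.2 fun y hy => ?_) fun x hx => ?_
  · exact A.mem_stalk_of_mem_sections hp (hT.le (Submodule.subset_span hy))
  · obtain ⟨s, hs, hsx⟩ := A.exists_smul_mem_of_mem_stalk hU hp hx
    rw [Scheme.mem_basicOpen _ _ _ hp] at hs
    have hmem := span_sections_le_span_stalk hp T (hT.ge hsx)
    rw [← germ_smul hp] at hmem
    exact (Submodule.smul_mem_iff_of_isUnit _ hs).1 hmem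

theorem isLocalOrder_stalk (p : X) : IsLocalOrder (A.stalk p) := by
  obtain ⟨U, hU, hp, -⟩ := exists_isAffineOpen_mem_and_subset (x := p) (U := ⊤) trivial
  have : Nonempty U := ⟨⟨p, hp⟩⟩
  refine ⟨?_, fun x => ?_⟩
  · obtain ⟨T, hT⟩ := A.finite U hU
    exact ⟨T, A.span_stalk_eq hU hp hT⟩
  · obtain ⟨s, hs, hsx⟩ := A.exists_smul_mem_sections hU x
    refine ⟨X.presheaf.germ U p hp s, ?_, ?_⟩
    · rw [Ne, ← map_zero (X.presheaf.germ U p hp).hom]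
      exact fun h => hs (germ_injective hp h)
    · rw [germ_smul]
      exact A.mem_stalk_of_mem_sections hp hsx

variable [IsDedekindScheme X]

theorem finite_notMem_stalk (x : D) : {p | x ∉ A.stalk p}.Finite := by
  obtain ⟨U, hU, hx⟩ := A.generic x
  refine (IsDedekindScheme.finite_compl U).subset fun p hp hpU => hp ?_
  exact A.mem_stalk_of_mem_sections hpU hx

end OrderIn

end Sections

section Gluing

variable {X : Scheme.{u}} [IsIntegral X] {D : Type v} [Ring D] [Algebra X.functionField D]

theorem IsLocalOrder.mem_of_eq_genericPoint {p : X} {M : Subalgebra (X.presheaf.stalk p) D}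
    (hM : IsLocalOrder M) (hp : p = genericPoint X) (x : D) : x ∈ M := by
  obtain ⟨r, hr, hrx⟩ := hM.2 x
  have hunit : IsUnit r := by
    subst hp
    exact IsUnit.mk0 (r : X.functionField) hr
  exact (M.toSubmodule.smul_mem_iff_of_isUnit hunit).1 hrx

theorem IsLocalOrder.exists_pow_smul_mem {R E : Type*} [CommRing R] [IsDomain R]
    [IsDiscreteValuationRing R] [Ring E] [Algebra R E] {M : Subalgebra R E} (hM : IsLocalOrder M)
    {g : R} (hg : ¬ IsUnit g) (x : E) : ∃ m : ℕ, g ^ m • x ∈ M := by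
  obtain ⟨π, hπ⟩ := IsDiscreteValuationRing.exists_irreducible R
  obtain ⟨r, hr, hrx⟩ := hM.2 x
  obtain ⟨m, hm⟩ := IsDiscreteValuationRing.associated_pow_irreducible hr hπ
  have hgm : g ∈ IsLocalRing.maximalIdeal R := hg
  rw [hπ.maximalIdeal_eq, Ideal.mem_span_singleton] at hgm
  obtain ⟨w, hw⟩ := hm.dvd.trans (pow_dvd_pow_of_dvd hgm m)
  refine ⟨m, ?_⟩
  rw [hw, mul_comm, mul_smul]
  exact M.smul_mem hrx w

variable (M : ∀ p : X, Subalgebra (X.presheaf.stalk p) D)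

/-- The sections over `U` of the subsheaf of the constant sheaf `D` with prescribed stalks. -/
def sectionsOfStalks (U : X.Opens) [Nonempty U] : Subalgebra Γ(X, U) D where
  carrier := {x | ∀ p ∈ U, x ∈ M p}
  mul_mem' hx hy p hp := (M p).mul_mem (hx p hp) (hy p hp)
  add_mem' hx hy p hp := (M p).add_mem (hx p hp) (hy p hp)
  algebraMap_mem' s p hp := by
    rw [Algebra.algebraMap_eq_smul_one, ← germ_smul hp]
    exact (M p).smul_mem (M p).one_mem _

variable {M}

theorem exists_pow_smul_mem_sectionsOfStalks [IsDedekindScheme X] (hM : ∀ p, IsLocalOrder (M p))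
    (hfin : ∀ x, {p | x ∉ M p}.Finite) {U : X.Opens} [Nonempty U] (g : Γ(X, U))
    [Nonempty (X.basicOpen g)] {x : D} (hx : x ∈ sectionsOfStalks M (X.basicOpen g)) :
    ∃ m : ℕ, g ^ m • x ∈ sectionsOfStalks M U := by
  have hlocal (p : X) : ∃ m : ℕ, p ∈ U → g ^ m • x ∈ M p := by
    by_cases hpU : p ∈ U
    · by_cases hp : p ∈ X.basicOpen g
      · exact ⟨0, fun _ => by simpa only [pow_zero, one_smul] using hx p hp⟩
      · have := IsDedekindScheme.isDiscreteValuationRing_stalk p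
          fun h => hp (h ▸ genericPoint_mem _)
        rw [Scheme.mem_basicOpen _ _ _ hpU] at hp
        obtain ⟨m, hm⟩ := (hM p).exists_pow_smul_mem hp x
        rw [← map_pow, germ_smul] at hm
        exact ⟨m, fun _ => hm⟩
    · exact ⟨0, fun h => absurd h hpU⟩
  choose m hm using hlocal
  refine ⟨(hfin x).toFinset.sup m, fun p hpU => ?_⟩
  by_cases hp : x ∈ M p
  · rw [← germ_smul hpU]
    exact (M p).smul_mem hp _
  · have hle : m p ≤ (hfin x).toFinset.sup m :=
      Finset.le_sup ((hfin x).mem_toFinset.2 hp)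
    rw [← Nat.sub_add_cancel hle, pow_add, mul_smul, ← germ_smul hpU (g ^ (_ - m p))]
    exact (M p).smul_mem (hm p hpU) _

theorem finite_notMem_of_finite_ne_stalk [IsDedekindScheme X] {A : OrderIn X D}
    (hfin : {p | M p ≠ A.stalk p}.Finite) (x : D) : {p | x ∉ M p}.Finite :=
  (hfin.union (A.finite_notMem_stalk x)).subset fun p hp =>
    or_iff_not_imp_left.2 fun h => by rwa [Set.mem_ofPred_eq, ← not_not.1 h]

theorem exists_smul_mem_sections_of_mem_sectionsOfStalks {A : OrderIn X D}
    (hM : ∀ p, IsLocalOrder (M p)) (hfin : {p | M p ≠ A.stalk p}.Finite) {U : X.Opens} [Nonempty U]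
    (hU : IsAffineOpen U) :
    ∃ g : Γ(X, U), g ≠ 0 ∧ ∀ x ∈ sectionsOfStalks M U, g • x ∈ A.sections U := by
  classical
  choose T hT using fun p => (hM p).1
  obtain ⟨g, hg, hgT⟩ := exists_smul_mem_of_fg (R := Γ(X, U))
    (Q := (A.sections U).toSubmodule) (A.exists_smul_mem_sections hU)
    (Submodule.fg_span (hfin.toFinset.biUnion T).finite_toSet)
  refine ⟨g, hg, fun x hx => A.mem_sections_iff.2 fun p hpU => ?_⟩
  by_cases hp : M p = A.stalk p
  · rw [← germ_smul hpU]
    exact (A.stalk p).smul_mem (hp ▸ hx p hpU) _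
  · have hTp : (T p : Set D) ⊆
        (A.stalk p).toSubmodule.comap (X.presheaf.germ U p hpU g • LinearMap.id) := fun y hy => by
      change X.presheaf.germ U p hpU g • y ∈ A.stalk p
      rw [germ_smul]
      refine A.mem_stalk_of_mem_sections hpU (hgT y (Submodule.subset_span ?_))
      exact Finset.mem_coe.2 (Finset.mem_biUnion.2 ⟨p, hfin.mem_toFinset.2 hp, hy⟩)
    rw [← germ_smul hpU]
    exact Submodule.span_le.2 hTp ((hT p).ge (hx p hpU))

theorem fg_sectionsOfStalks [IsLocallyNoetherian X] {A : OrderIn X D}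
    (hM : ∀ p, IsLocalOrder (M p)) (hfin : {p | M p ≠ A.stalk p}.Finite) {U : X.Opens} [Nonempty U]
    (hU : IsAffineOpen U) :
    (sectionsOfStalks M U).toSubmodule.FG := by
  obtain ⟨g, hg, hgx⟩ := exists_smul_mem_sections_of_mem_sectionsOfStalks hM hfin hU
  have : IsNoetherianRing Γ(X, U) := IsLocallyNoetherian.component_noetherian ⟨U, hU⟩
  have : Module.Finite Γ(X, U) (A.sections U).toSubmodule := Module.Finite.iff_fg.2 (A.finite U hU)
  let φ : (sectionsOfStalks M U).toSubmodule →ₗ[Γ(X, U)] (A.sections U).toSubmodule :=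
    (LinearMap.lsmul Γ(X, U) D g).restrict hgx
  have hφ : Function.Injective φ := fun x y hxy =>
    Subtype.ext (smul_right_injective D hg (congrArg Subtype.val hxy))
  exact Module.Finite.iff_fg.1 (Module.Finite.of_injective φ hφ)

theorem exists_stalk_eq [IsDedekindScheme X] {A : OrderIn X D} (hM : ∀ p, IsLocalOrder (M p))
    (hfin : {p | M p ≠ A.stalk p}.Finite) : ∃ B : OrderIn X D, ∀ p, B.stalk p = M p := by
  have hfin' := finite_notMem_of_finite_ne_stalk hfin
  let W (x : D) : X.Opens := ⟨_, IsDedekindScheme.isOpen_compl_of_finite (hfin' x)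
    fun h => h ((hM _).mem_of_eq_genericPoint rfl x)⟩
  have hmem_W {x : D} {p : X} (hx : x ∈ M p) : p ∈ W x := fun h => h hx
  have hW (x : D) (_ : Nonempty (W x)) : x ∈ sectionsOfStalks M (W x) := fun p hp => not_not.1 hp
  let B : OrderIn X D :=
    { sections := sectionsOfStalks M
      restrict := fun U V _ _ h x hx p hp => hx p (h hp)
      local_mem := fun V _ x h p hp => by
        obtain ⟨U, _, hpU, -, hx⟩ := h p hp
        exact hx p hpU
      quasiCoherent := fun U _ _ g _ x hx => exists_pow_smul_mem_sectionsOfStalks hM hfin' g hx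
      finite := fun U _ hU => fg_sectionsOfStalks hM hfin hU
      generic := fun x =>
        have hne : Nonempty (W x) := ⟨⟨_, hmem_W ((hM _).mem_of_eq_genericPoint rfl x)⟩⟩
        ⟨W x, hne, hW x hne⟩ }
  refine ⟨B, fun p => le_antisymm ?_ fun x hx => ?_⟩
  · rintro x ⟨U, hU, hp, hx⟩
    exact hx p hp
  · exact ⟨W x, ⟨⟨p, hmem_W hx⟩⟩, hmem_W hx, hW x _⟩

end Gluing

section Azumaya

theorem projective_submodule_of_semilinearEquiv {S S' P P' : Type*} [Semiring S] [Semiring S']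
    [AddCommMonoid P] [AddCommMonoid P'] [Module S P] [Module S' P'] {σ : S →+* S'}
    {σ' : S' →+* S} [RingHomInvPair σ σ'] [RingHomInvPair σ' σ] (f : P ≃ₛₗ[σ] P')
    (h : ∀ N : Submodule S P, Module.Projective S N) (N : Submodule S' P') :
    Module.Projective S' N := by
  have := h (N.comap f.toLinearMap)
  rw [← Submodule.map_comap_eq_of_surjective f.surjective N]
  exact Module.Projective.of_equiv (f.submoduleMap _)

theorem projective_submodule_of_ringEquiv {S S' : Type*} [Semiring S] [Semiring S'] (e : S ≃+* S')
    (h : ∀ I : Submodule S S, Module.Projective S I) (I : Submodule S' S') :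
    Module.Projective S' I := by
  let _ := RingHomInvPair.of_ringEquiv e
  let _ := RingHomInvPair.symm (e : S →+* S') (e.symm : S' →+* S)
  exact projective_submodule_of_semilinearEquiv e.toSemilinearEquiv h I

section MatrixUnits

variable {R K ι : Type*} [CommRing R] [IsIntegrallyClosed R] [IsNoetherianRing R] [Field K]
  [Algebra R K] [IsFractionRing R K] [Fintype ι] [DecidableEq ι]

theorem eq_range_mapMatrix_of_forall_single_mem {B : Subalgebra R (Matrix ι ι K)}
    (hB : IsLocalOrder B) (h : ∀ a b, Matrix.single a b 1 ∈ B) :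
    B = ((Algebra.ofId R K).mapMatrix (m := ι)).range := by
  refine le_antisymm (fun M hM => ?_) ?_
  · have hentry (a b : ι) : M a b ∈ (algebraMap R K).range := by
      refine mem_range_of_single_mem hB (h a a) ?_
      have := mul_mem (mul_mem (h a a) hM) (h b a)
      rwa [Matrix.single_mul_mul_single, one_mul, mul_one] at this
    choose y hy using hentry
    exact ⟨Matrix.of y, Matrix.ext hy⟩
  · rintro _ ⟨M, rfl⟩
    change (Algebra.ofId R K).mapMatrix M ∈ _
    rw [Matrix.matrix_eq_sum_single ((Algebra.ofId R K).mapMatrix M)]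
    refine sum_mem fun a _ => sum_mem fun b _ => ?_
    have := B.smul_mem (h a b) (M a b)
    rwa [Matrix.smul_single, ← Algebra.algebraMap_eq_smul_one] at this

theorem isAzumaya_of_forall_single_mem [Nonempty ι] {E : Type*} [Ring E] [Algebra K E] [Algebra R E]
    [IsScalarTower R K E] (T : E ≃ₐ[K] Matrix ι ι K) {A : Subalgebra R E} (hA : IsLocalOrder A)
    (h : ∀ a b, T.symm (Matrix.single a b 1) ∈ A) : IsAzumaya R A := by
  let T' : E →ₐ[R] Matrix ι ι K := T.restrictScalars R
  have hT : A.map T' = ((Algebra.ofId R K).mapMatrix (m := ι)).range :=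
    eq_range_mapMatrix_of_forall_single_mem (hA.map (T.restrictScalars R)) fun a b =>
      ⟨_, h a b, T.apply_symm_apply _⟩
  have hinj : Function.Injective ((Algebra.ofId R K).mapMatrix (m := ι)) :=
    Matrix.map_injective (FaithfulSMul.algebraMap_injective R K)
  have := IsAzumaya.matrix R ι
  exact IsAzumaya.of_AlgEquiv R _ _ (((AlgEquiv.ofInjective _ hinj).trans
    (Subalgebra.equivOfEq _ _ hT.symm)).trans (A.equivMapOfInjective T' T.injective).symm)

end MatrixUnits

end Azumaya

section Ramification

variable {X : Scheme.{u}} [IsIntegral X] [IsDedekindScheme X]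
  {D : Type v} [Ring D] [Algebra X.functionField D]

namespace OrderIn

theorem isAzumaya_of_notMem_ramificationLocus {Y : Scheme.{u}} [IsIntegral Y]
    [Algebra Y.functionField D] {A : OrderIn Y D} {p : Y} (hp : p ∉ A.ramificationLocus) :
    IsAzumaya (Y.presheaf.stalk p) (A.stalk p) := by
  obtain ⟨U, hpU, hU⟩ := not_not.1 hp
  exact hU p hpU

theorem ramificationLocus_subset {A : OrderIn X D} {S : Set X} (hS : S.Finite)
    (hgen : genericPoint X ∉ S) (h : ∀ p ∉ S, IsAzumaya (X.presheaf.stalk p) (A.stalk p)) :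
    A.ramificationLocus ⊆ S :=
  fun _ hp => by_contra fun hpS =>
    hp ⟨⟨_, IsDedekindScheme.isOpen_compl_of_finite hS hgen⟩, hpS, fun q hq => h q hq⟩

variable {ι : Type*} [Fintype ι] [DecidableEq ι]

theorem nonempty_ramificationData (T : D ≃ₐ[X.functionField] Matrix ι ι X.functionField)
    {A : OrderIn X D} (hA : A.IsHereditary) {p : X} (hp : p ≠ genericPoint X) :
    Nonempty (A.RamificationData p) := by
  have := IsDedekindScheme.isDiscreteValuationRing_stalk p hp
  let T' : D ≃ₐ[X.presheaf.stalk p] Module.End X.functionField (ι → X.functionField) :=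
    (T.trans Matrix.toLinAlgEquiv').restrictScalars (X.presheaf.stalk p)
  let e := (A.stalk p).equivMapOfInjective T'.toAlgHom T'.injective
  obtain ⟨r, n, hn, ⟨d⟩⟩ := exists_equiv_blockOrder ((A.isLocalOrder_stalk p).map T')
    (projective_submodule_of_ringEquiv e.toRingEquiv (hA p).1)
  exact ⟨⟨r, n, hn, e.trans d⟩⟩

variable [Nonempty ι] (A : OrderIn X D)

theorem exists_finite_isAzumaya_stalk (T : D ≃ₐ[X.functionField] Matrix ι ι X.functionField) :
    ∃ S : Set X, S.Finite ∧ genericPoint X ∉ S ∧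
    ∀ p ∉ S, IsAzumaya (X.presheaf.stalk p) (A.stalk p) := by
  refine ⟨⋃ a, ⋃ b, {p | T.symm (Matrix.single a b 1) ∉ A.stalk p},
    Set.finite_iUnion fun a => Set.finite_iUnion fun b => A.finite_notMem_stalk _, ?_,
    fun p hp => ?_⟩
  · simp only [Set.mem_iUnion, not_exists]
    exact fun a b h => h (A.mem_stalk_genericPoint _)
  · simp only [Set.mem_iUnion, not_exists, Set.mem_ofPred_eq, not_not] at hp
    exact isAzumaya_of_forall_single_mem T (A.isLocalOrder_stalk p) hp

theorem finite_ramificationLocus (T : D ≃ₐ[X.functionField] Matrix ι ι X.functionField) :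
    A.ramificationLocus.Finite := by
  obtain ⟨S, hS, hgen, h⟩ := A.exists_finite_isAzumaya_stalk T
  exact hS.subset (ramificationLocus_subset hS hgen h)

theorem genericPoint_notMem_ramificationLocus
    (T : D ≃ₐ[X.functionField] Matrix ι ι X.functionField) :
    genericPoint X ∉ A.ramificationLocus := by
  obtain ⟨S, hS, hgen, h⟩ := A.exists_finite_isAzumaya_stalk T
  exact fun hp => hgen (ramificationLocus_subset hS hgen h hp)

variable {A} {p : X}

theorem one_lt_blockCount (T : D ≃ₐ[X.functionField] Matrix ι ι X.functionField)
    (hp : p ∈ A.ramificationLocus) (d : A.RamificationData p) : 1 < d.r := by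
  have hgen := A.genericPoint_notMem_ramificationLocus T
  have := IsDedekindScheme.isDiscreteValuationRing_stalk p fun h => hgen (h ▸ hp)
  have : Nontrivial D := T.toEquiv.nontrivial
  have hpos : 0 < d.r := blockCount_pos d.equiv
  by_contra hr
  have : Subsingleton (Fin d.r) := Fin.subsingleton_iff_le_one.2 (not_lt.1 hr)
  have : Nonempty (Σ i, Fin (d.n i)) := ⟨⟨0, hpos⟩, ⟨0, d.n_pos _⟩⟩
  have := isAzumaya_blockOrder (R := X.presheaf.stalk p) (n := d.n)
  have hsubset : A.ramificationLocus ⊆ A.ramificationLocus \ {p} := by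
    refine ramificationLocus_subset ((A.finite_ramificationLocus T).subset Set.sdiff_subset)
      (fun h => hgen h.1) fun q hq => ?_
    by_cases hqp : q = p
    · subst hqp
      exact IsAzumaya.of_AlgEquiv _ _ _ d.equiv.symm
    · exact isAzumaya_of_notMem_ramificationLocus fun h => hq ⟨h, hqp⟩
  exact (hsubset hp).2 rfl

theorem eq_stalk_of_notMem_ramificationLocus
    (T : D ≃ₐ[X.functionField] Matrix ι ι X.functionField) (hA : A.IsHereditary)
    (hp : p ∉ A.ramificationLocus) {B : Subalgebra (X.presheaf.stalk p) D} (hB : IsLocalOrder B)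
    (hAB : A.stalk p ≤ B) : B = A.stalk p := by
  refine le_antisymm ?_ hAB
  by_cases hgen : p = genericPoint X
  · subst hgen
    exact fun x _ => A.mem_stalk_genericPoint x
  · have := IsDedekindScheme.isDiscreteValuationRing_stalk p hgen
    obtain ⟨d⟩ := nonempty_ramificationData T hA hgen
    have : Nontrivial D := T.toEquiv.nontrivial
    have := isAzumaya_of_notMem_ramificationLocus hp
    have := IsAzumaya.of_AlgEquiv _ _ _ d.equiv
    obtain ⟨M, -, hM, -, hle, -⟩ := exists_maximal_overorders X.functionField
      (A.isLocalOrder_stalk p) d.equiv (blockCount_pos d.equiv) d.n_pos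
    obtain ⟨j, hj⟩ := hle B hB hAB
    have hsub := eq_of_isAzumaya_blockOrder (R := X.presheaf.stalk p) d.n_pos
    have : M j = ⨅ i, M i :=
      le_antisymm (le_iInf fun i => (congrArg M (hsub j i)).le) (iInf_le M j)
    rwa [this, hM] at hj

end OrderIn

end Ramification

section DualBasis

theorem finite_and_projective_of_dualBasis {S P ι : Type*} [Semiring S] [AddCommMonoid P]
    [Module S P] [Fintype ι] (x : ι → P) (φ : ι → P →ₗ[S] S)
    (h : ∀ p, ∑ i, φ i p • x i = p) : Module.Finite S P ∧ Module.Projective S P := by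
  let s : (ι → S) →ₗ[S] P := Fintype.linearCombination S x
  have hs : s ∘ₗ LinearMap.pi φ = LinearMap.id := LinearMap.ext h
  exact ⟨Module.Finite.of_surjective s fun p => ⟨_, LinearMap.congr_fun hs p⟩,
    Module.Projective.of_split (LinearMap.pi φ) s hs⟩

variable {R E : Type*} [CommRing R] [Ring E] [Algebra R E] {A B : Subalgebra R E}

theorem projective_of_smul_mem [IsDomain R] [Module.IsTorsionFree R E]
    (hproj : ∀ I : Submodule A A, Module.Projective A I) {N : Submodule A E} {r : R} (hr : r ≠ 0)
    (hrN : ∀ x ∈ N, r • x ∈ A) : Module.Projective A N := by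
  let j : N →ₗ[A] A :=
    { toFun x := ⟨r • (x : E), hrN x x.2⟩
      map_add' x y := Subtype.ext (smul_add r _ _)
      map_smul' a x := Subtype.ext (mul_smul_comm r (a : E) (x : E)).symm }
  have hj : Function.Injective j := fun x y h =>
    Subtype.ext (smul_right_injective E hr (congrArg Subtype.val h))
  have := hproj (LinearMap.range j)
  exact Module.Projective.of_equiv (LinearEquiv.ofInjective j hj).symm

theorem IsLocalOrder.exists_dualBasis [IsDomain R] [Module.IsTorsionFree R E] (hA : IsLocalOrder A)
    {N : Submodule A E} [Module.Projective A N] (hone : 1 ∈ N) :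
    ∃ (s : Finset N) (y : N → E), (∀ x, ∀ b ∈ N, b * y x ∈ A) ∧ ∑ x ∈ s, y x * x = 1 := by
  obtain ⟨s, hs⟩ := Module.Projective.out (R := A) (P := N)
  let e : N := ⟨1, hone⟩
  refine ⟨(s e).support, fun x => s e x, fun x b hb => ?_, ?_⟩
  · let incl : A →ₗ[A] E :=
      { toFun := Subtype.val, map_add' := fun _ _ => rfl, map_smul' := fun _ _ => rfl }
    let ψ : N →ₗ[A] E := incl ∘ₗ Finsupp.lapply x ∘ₗ s
    have hψ := hA.map_eq_smul ψ (z := b) (x := e) (x' := ⟨b, hb⟩) (mul_one b).symm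
    change (s ⟨b, hb⟩ x : E) = b * s e x at hψ
    exact hψ ▸ Subtype.property _
  · have := congrArg Subtype.val (hs e)
    rwa [Finsupp.linearCombination_apply, Finsupp.sum, AddSubmonoidClass.coe_finsetSum] at this

theorem exists_left_dualBasis [IsDomain R] [Module.IsTorsionFree R E] (hA : IsLocalOrder A)
    (hB : IsLocalOrder B) (hAB : A ≤ B) (hproj : ∀ I : Submodule A A, Module.Projective A I) :
    ∃ (s : Finset B) (y : B → E), (∀ x, ∀ b ∈ B, b * y x ∈ A) ∧ ∑ x ∈ s, y x * x = 1 := by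
  let N : Submodule A E :=
    { carrier := B
      add_mem' := B.add_mem
      zero_mem' := B.zero_mem
      smul_mem' := fun a _ hx => B.mul_mem (hAB a.2) hx }
  obtain ⟨r, hr, hrB⟩ := exists_smul_mem_of_fg (Q := A.toSubmodule) hA.2 hB.1
  have : Module.Projective A N := projective_of_smul_mem hproj hr hrB
  exact hA.exists_dualBasis (N := N) B.one_mem

theorem IsLocalOrder.op (hA : IsLocalOrder A) : IsLocalOrder A.op := by
  refine ⟨?_, fun x => hA.2 x.unop⟩
  have hop : A.op.toSubmodule = A.toSubmodule.map (opLinearEquiv R : E ≃ₗ[R] Eᵐᵒᵖ).toLinearMap :=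
    Submodule.ext fun x => ⟨fun hx => ⟨x.unop, hx, rfl⟩, fun ⟨_, hy, hyx⟩ => hyx ▸ hy⟩
  exact hop ▸ hA.1.map _

theorem projective_submodule_op (h : ∀ I : Submodule Aᵐᵒᵖ A, Module.Projective Aᵐᵒᵖ I)
    (I : Submodule A.op A.op) : Module.Projective A.op I := by
  let σ : Aᵐᵒᵖ ≃+* A.op := A.mopAlgEquivOp.toRingEquiv
  let _ := RingHomInvPair.of_ringEquiv σ
  let _ := RingHomInvPair.symm (σ : Aᵐᵒᵖ →+* A.op) (σ.symm : A.op →+* Aᵐᵒᵖ)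
  let f : A ≃ₛₗ[(σ : Aᵐᵒᵖ →+* A.op)] A.op :=
    { A.linearEquivOp.toAddEquiv with map_smul' := fun _ _ => rfl }
  exact projective_submodule_of_semilinearEquiv f h I

theorem exists_right_dualBasis [IsDomain R] [Module.IsTorsionFree R E] (hA : IsLocalOrder A)
    (hB : IsLocalOrder B) (hAB : A ≤ B)
    (hproj : ∀ I : Submodule Aᵐᵒᵖ A, Module.Projective Aᵐᵒᵖ I) :
    ∃ (s : Finset B) (y : B → E), (∀ x, ∀ b ∈ B, y x * b ∈ A) ∧ ∑ x ∈ s, x * y x = 1 := by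
  have : Module.IsTorsionFree R Eᵐᵒᵖ :=
    (opLinearEquiv R : E ≃ₗ[R] Eᵐᵒᵖ).symm.injective.moduleIsTorsionFree _ (map_smul _)
  obtain ⟨s, y, hy, hsum⟩ := exists_left_dualBasis hA.op hB.op (Subalgebra.op_le_op_iff.2 hAB)
    (projective_submodule_op hproj)
  refine ⟨s.map B.linearEquivOp.symm.toEquiv.toEmbedding, fun x => (y (B.linearEquivOp x)).unop,
    fun x b hb => hy _ (op b) hb, ?_⟩
  rw [Finset.sum_map]
  have := congrArg unop hsum
  rwa [Finset.unop_sum] at this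

end DualBasis

section LocallyProjective

open Topology

variable {X : Scheme.{u}}

theorem exists_isAffineOpen_of_eventually {p : X} {P : X → Prop} (h : ∀ᶠ q in 𝓝 p, P q) :
    ∃ (U : X.Opens) (_ : Nonempty U), p ∈ U ∧ IsAffineOpen U ∧ ∀ q ∈ U, P q := by
  obtain ⟨W, hWP, hW, hpW⟩ := eventually_nhds_iff.1 h
  obtain ⟨U, hU, hpU, hUW⟩ := exists_isAffineOpen_mem_and_subset (U := ⟨W, hW⟩) hpW
  exact ⟨U, ⟨⟨p, hpU⟩⟩, hpU, hU, fun q hq => hWP q (hUW hq)⟩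

variable [IsIntegral X] {D : Type v} [Ring D] [Algebra X.functionField D] {A B : OrderIn X D}

namespace OrderIn

theorem eventually_mem_stalk {p : X} {x : D} (hx : x ∈ A.stalk p) : ∀ᶠ q in 𝓝 p, x ∈ A.stalk q :=
  (A.isOpen_setOf_mem_stalk x).mem_nhds hx

theorem eventually_forall_mem_stalk {p : X} {φ : D →ₗ[X.functionField] D}
    (hφ : ∀ b ∈ B.stalk p, φ b ∈ A.stalk p) : ∀ᶠ q in 𝓝 p, ∀ b ∈ B.stalk q, φ b ∈ A.stalk q := by
  obtain ⟨U, hU, hp, -⟩ := exists_isAffineOpen_mem_and_subset (x := p) (U := ⊤) trivial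
  have : Nonempty U := ⟨⟨p, hp⟩⟩
  obtain ⟨G, hG⟩ := B.finite U hU
  have hGstalk (b : D) (hb : b ∈ G) : b ∈ B.stalk p :=
    (B.span_stalk_eq hU hp hG).le (Submodule.subset_span hb)
  have hev : ∀ᶠ q in 𝓝 p, ∀ b ∈ G, φ b ∈ A.stalk q :=
    (Filter.eventually_all_finset G).2 fun b hb => eventually_mem_stalk (hφ b (hGstalk b hb))
  filter_upwards [hev, U.isOpen.mem_nhds hp] with q hq hqU b hb
  have hle : Submodule.span (X.presheaf.stalk q) (G : Set D) ≤
      (A.stalk q).toSubmodule.comap (φ.restrictScalars (X.presheaf.stalk q)) :=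
    Submodule.span_le.2 hq
  exact hle ((B.span_stalk_eq hU hqU hG).ge hb)

theorem IsHereditary.isLeftLocallyProjective (hA : A.IsHereditary) (h : A ≤ B) :
    IsLeftLocallyProjective h := by
  intro p
  obtain ⟨s, y, hy, hsum⟩ := exists_left_dualBasis (A.isLocalOrder_stalk p)
    (B.isLocalOrder_stalk p) (stalk_mono h p) (hA p).1
  obtain ⟨U, hne, hpU, hU, hUxy⟩ := exists_isAffineOpen_of_eventually <|
    (Filter.eventually_all (ι := s)).2 fun x => (eventually_mem_stalk x.1.2).and <|
      eventually_forall_mem_stalk (φ := LinearMap.mulRight _ (y x)) (hy x)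
  refine ⟨U, hne, hpU, hU, ?_⟩
  have hx (x : s) : (x : D) ∈ B.sections U := B.mem_sections_iff.2 fun q hq => (hUxy q hq x).1
  have hyU (x : s) (b : B.sections U) : (b : D) * y x ∈ A.sections U :=
    A.mem_sections_iff.2 fun q hq => (hUxy q hq x).2 b (B.mem_sections_iff.1 b.2 q hq)
  let _ := leftModule (sectionsHom h U)
  refine finite_and_projective_of_dualBasis (ι := s) (fun x => ⟨x, hx x⟩)
    (fun x => { toFun := fun b => ⟨b * y x, hyU x b⟩
                map_add' := fun b c => Subtype.ext (add_mul _ _ _)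
                map_smul' := fun a b => Subtype.ext (mul_assoc _ _ _) }) fun b => Subtype.ext ?_
  rw [AddSubmonoidClass.coe_finsetSum]
  change ∑ x : s, (b : D) * y x * x = b
  simp only [mul_assoc]
  rw [← Finset.mul_sum, Finset.sum_coe_sort s fun x => y x * (x : D), hsum, mul_one]

theorem IsHereditary.isRightLocallyProjective (hA : A.IsHereditary) (h : A ≤ B) :
    IsRightLocallyProjective h := by
  intro p
  obtain ⟨s, y, hy, hsum⟩ := exists_right_dualBasis (A.isLocalOrder_stalk p)
    (B.isLocalOrder_stalk p) (stalk_mono h p) (hA p).2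
  obtain ⟨U, hne, hpU, hU, hUxy⟩ := exists_isAffineOpen_of_eventually <|
    (Filter.eventually_all (ι := s)).2 fun x => (eventually_mem_stalk x.1.2).and <|
      eventually_forall_mem_stalk (φ := LinearMap.mulLeft _ (y x)) (hy x)
  refine ⟨U, hne, hpU, hU, ?_⟩
  have hx (x : s) : (x : D) ∈ B.sections U := B.mem_sections_iff.2 fun q hq => (hUxy q hq x).1
  have hyU (x : s) (b : B.sections U) : y x * (b : D) ∈ A.sections U :=
    A.mem_sections_iff.2 fun q hq => (hUxy q hq x).2 b (B.mem_sections_iff.1 b.2 q hq)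
  let _ := rightModule (sectionsHom h U)
  refine finite_and_projective_of_dualBasis (ι := s) (fun x => ⟨x, hx x⟩)
    (fun x => { toFun := fun b => op ⟨y x * b, hyU x b⟩
                map_add' := fun b c => unop_injective (Subtype.ext (mul_add _ _ _))
                map_smul' := fun a b => unop_injective (Subtype.ext (mul_assoc _ _ _).symm) })
    fun b => Subtype.ext ?_
  rw [AddSubmonoidClass.coe_finsetSum]
  change ∑ x : s, (x : D) * (y x * b) = b
  simp only [← mul_assoc]
  rw [← Finset.sum_mul, Finset.sum_coe_sort s fun x => (x : D) * y x, hsum, one_mul]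

end OrderIn

end LocallyProjective

section Parametrization

variable {X : Scheme.{u}} [IsIntegral X] {D : Type v} [Ring D] [Algebra X.functionField D]
  {A : OrderIn X D}

theorem encard_range_pi_fin {α β : Type*} [Finite α] {r : α → ℕ} {B : (∀ a, Fin (r a)) → β}
    (hB : Function.Injective B) : (Set.range B).encard = ((∏ᶠ a, r a : ℕ) : ℕ∞) := by
  classical
  have := Fintype.ofFinite α
  rw [← Set.image_univ, hB.encard_image, Set.encard_univ, ENat.card_eq_coe_fintype_card,
    Fintype.card_pi, finprod_eq_prod_of_fintype]
  simp only [Fintype.card_fin]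

namespace OrderIn

theorem exists_stalk_eq_on [IsDedekindScheme X] (A : OrderIn X D) {S : Set X} (hS : S.Finite)
    {M : ∀ p : S, Subalgebra (X.presheaf.stalk (p : X)) D} (hM : ∀ p, IsLocalOrder (M p)) :
    ∃ B : OrderIn X D, (∀ p : S, B.stalk p = M p) ∧ ∀ p ∉ S, B.stalk p = A.stalk p := by
  classical
  let M' (p : X) : Subalgebra (X.presheaf.stalk p) D :=
    if hp : p ∈ S then M ⟨p, hp⟩ else A.stalk p
  have hmem (p : S) : M' p = M p := dif_pos p.2
  have hnotMem (p : X) (hp : p ∉ S) : M' p = A.stalk p := dif_neg hp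
  have hM' (p : X) : IsLocalOrder (M' p) := by
    by_cases hp : p ∈ S
    · exact hmem ⟨p, hp⟩ ▸ hM ⟨p, hp⟩
    · exact hnotMem p hp ▸ A.isLocalOrder_stalk p
  obtain ⟨B, hB⟩ := exists_stalk_eq (A := A) hM' <|
    hS.subset fun p hp => by_contra fun hpS => hp (hnotMem p hpS)
  exact ⟨B, fun p => (hB p).trans (hmem p), fun p hp => (hB p).trans (hnotMem p hp)⟩

theorem range_eq_maximalOverorders {ι : Type*} {B : ι → OrderIn X D} (hAB : ∀ c, A ≤ B c)
    (hle : ∀ B', A ≤ B' → ∃ c, B' ≤ B c) (hanti : ∀ c c', B c ≤ B c' → c = c') :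
    Set.range B = A.maximalOverorders := by
  refine Set.Subset.antisymm ?_ fun B' hB' => ?_
  · rintro _ ⟨c, rfl⟩
    refine ⟨hAB c, fun B' hB' => le_antisymm ?_ hB'⟩
    obtain ⟨c', hc'⟩ := hle B' ((hAB c).trans hB')
    rwa [← hanti c c' (hB'.trans hc')] at hc'
  · obtain ⟨c, hc⟩ := hle B' hB'.1
    exact ⟨c, hB'.2 _ hc⟩

theorem le_of_forall_mem_ramificationLocus [IsDedekindScheme X] {ι : Type*} [Fintype ι]
    [DecidableEq ι] [Nonempty ι] (T : D ≃ₐ[X.functionField] Matrix ι ι X.functionField)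
    (hA : A.IsHereditary) {B B' : OrderIn X D} (hAB : A ≤ B) (hAB' : A ≤ B')
    (h : ∀ p ∈ A.ramificationLocus, B.stalk p ≤ B'.stalk p) : B ≤ B' := by
  refine le_iff_stalk_le.2 fun p => ?_
  by_cases hp : p ∈ A.ramificationLocus
  · exact h p hp
  · rw [eq_stalk_of_notMem_ramificationLocus T hA hp (B.isLocalOrder_stalk p) (stalk_mono hAB p)]
    exact stalk_mono hAB' p

theorem exists_parametrization_maximalOverorders [IsDedekindScheme X] {ι : Type*} [Fintype ι]
    [DecidableEq ι] [Nonempty ι] (T : D ≃ₐ[X.functionField] Matrix ι ι X.functionField)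
    (hA : A.IsHereditary) (d : ∀ p : A.ramificationLocus, A.RamificationData p) :
    ∃ (B : (∀ p, Fin (d p).r) → OrderIn X D) (σ : ∀ p, Equiv.Perm (Fin (d p).r)),
      Function.Injective B ∧ Set.range B = A.maximalOverorders ∧
      ∀ c (h : A ≤ B c) p i, ((d p).IsPurelyOfType h i ↔ i = σ p (c p)) ∧
        ((d p).IsLeftPurelyOfType h i ↔ i = c p) := by
  have hdvr (p : A.ramificationLocus) : IsDiscreteValuationRing (X.presheaf.stalk (p : X)) :=
    IsDedekindScheme.isDiscreteValuationRing_stalk _ fun h =>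
      A.genericPoint_notMem_ramificationLocus T (h ▸ p.2)
  choose M σ hM hMlocal hle hanti htype using fun p : A.ramificationLocus =>
    exists_maximal_overorders X.functionField (A.isLocalOrder_stalk p) (d p).equiv
      (zero_lt_one.trans (one_lt_blockCount T p.2 (d p))) (d p).n_pos
  choose B hB hBA using fun c : ∀ p, Fin (d p).r =>
    A.exists_stalk_eq_on (A.finite_ramificationLocus T) fun p => hMlocal p (c p)
  have hAB (c) : A ≤ B c := by
    refine le_iff_stalk_le.2 fun p => ?_
    by_cases hp : p ∈ A.ramificationLocus
    · exact (hM ⟨p, hp⟩).ge.trans ((iInf_le _ _).trans (hB c ⟨p, hp⟩).ge)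
    · exact (hBA c p hp).ge
  have hexists (B') (h : A ≤ B') : ∃ c, B' ≤ B c := by
    choose c hc using fun p : A.ramificationLocus =>
      hle p (B'.stalk p) (B'.isLocalOrder_stalk p) (stalk_mono h p)
    exact ⟨c, le_of_forall_mem_ramificationLocus T hA h (hAB c) fun p hp =>
      (hc ⟨p, hp⟩).trans (hB c ⟨p, hp⟩).ge⟩
  have hBanti (c c') (h : B c ≤ B c') : c = c' :=
    funext fun p => hanti p _ _ (hB c p ▸ hB c' p ▸ stalk_mono h p)
  exact ⟨B, σ, fun c c' h => hBanti c c' h.le, range_eq_maximalOverorders hAB hexists hBanti,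
    fun c h p i => htype p (c p) ((B c).stalk p) (stalk_mono h p) (hB c p) i⟩

end OrderIn

end Parametrization

end HereditaryOrder

end

open AlgebraicGeometry HereditaryOrder OrderIn in
theorem mainTheorem6_general (X : Scheme.{u}) [IsIntegral X] [IsDedekindScheme X]
    (D : Type v) [Ring D] [Algebra X.functionField D]
    {ι : Type*} [Fintype ι] [DecidableEq ι] [Nonempty ι]
    (T : D ≃ₐ[X.functionField] Matrix ι ι X.functionField)
    (A : OrderIn X D) (hA : A.IsHereditary) :
    A.ramificationLocus.Finite ∧
    (∀ p ∈ A.ramificationLocus, Nonempty (A.RamificationData p)) ∧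
    ∀ d : ∀ p : A.ramificationLocus, A.RamificationData p,
      (∀ p, 1 < (d p).r) ∧
      A.maximalOverorders.encard = ((∏ᶠ p, (d p).r : ℕ) : ℕ∞) ∧
      (∀ B ∈ A.maximalOverorders, ∀ h : A ≤ B,
        IsLeftLocallyProjective h ∧ IsRightLocallyProjective h) ∧
      (∀ B ∈ A.maximalOverorders, ∀ h : A ≤ B, ∀ p,
        (∃! j, (d p).IsPurelyOfType h j) ∧ ∃! j, (d p).IsLeftPurelyOfType h j) ∧
      ∀ B ∈ A.maximalOverorders, ∀ B' ∈ A.maximalOverorders, ∀ (h : A ≤ B) (h' : A ≤ B'),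
        (∀ p, ∃ j, (d p).IsPurelyOfType h j ∧ (d p).IsPurelyOfType h' j) → B = B' := by
  have hfin := A.finite_ramificationLocus T
  have hgen := A.genericPoint_notMem_ramificationLocus T
  refine ⟨hfin, fun p hp => nonempty_ramificationData T hA fun h => hgen (h ▸ hp), fun d => ?_⟩
  have := hfin.to_subtype
  obtain ⟨B, σ, hinj, hrange, htype⟩ := exists_parametrization_maximalOverorders T hA d
  refine ⟨fun p => one_lt_blockCount T p.2 (d p), hrange ▸ encard_range_pi_fin hinj,
    fun B _ h => ⟨hA.isLeftLocallyProjective h, hA.isRightLocallyProjective h⟩, ?_, ?_⟩ <;>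
    rw [← hrange]
  · rintro _ ⟨c, rfl⟩ h p
    exact ⟨⟨_, (htype c h p _).1.2 rfl, fun i hi => (htype c h p i).1.1 hi⟩,
      ⟨_, (htype c h p _).2.2 rfl, fun i hi => (htype c h p i).2.1 hi⟩⟩
  · rintro _ ⟨c, rfl⟩ _ ⟨c', rfl⟩ h h' hsame
    refine congrArg B (funext fun p => (σ p).injective ?_)
    obtain ⟨j, hj, hj'⟩ := hsame p
    exact ((htype c h p j).1.1 hj).symm.trans ((htype c' h' p j).1.1 hj')

open AlgebraicGeometry HereditaryOrder OrderIn in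
theorem mainTheorem6 {k : Type u} [Field k] [IsAlgClosed k] [CharZero k]
    (C : Scheme.{u}) [IsIntegral C] (f : C ⟶ Spec (CommRingCat.of k))
    [SmoothOfRelativeDimension 1 f] [IsSeparated f] [QuasiCompact f]
    (D : Type v) [Ring D] [Algebra C.functionField D] [FiniteDimensional C.functionField D]
    [Algebra.IsCentral C.functionField D] [IsSimpleRing D]
    (A : OrderIn C D) (hA : A.IsHereditary) :
    A.ramificationLocus.Finite ∧
    (∀ p ∈ A.ramificationLocus, Nonempty (A.RamificationData p)) ∧
    ∀ d : ∀ p : A.ramificationLocus, A.RamificationData p,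
      (∀ p, 1 < (d p).r) ∧
      A.maximalOverorders.encard = ((∏ᶠ p, (d p).r : ℕ) : ℕ∞) ∧
      (∀ B ∈ A.maximalOverorders, ∀ h : A ≤ B,
        IsLeftLocallyProjective h ∧ IsRightLocallyProjective h) ∧
      (∀ B ∈ A.maximalOverorders, ∀ h : A ≤ B, ∀ p,
        (∃! j, (d p).IsPurelyOfType h j) ∧ ∃! j, (d p).IsLeftPurelyOfType h j) ∧
      ∀ B ∈ A.maximalOverorders, ∀ B' ∈ A.maximalOverorders, ∀ (h : A ≤ B) (h' : A ≤ B'),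
        (∀ p, ∃ j, (d p).IsPurelyOfType h j ∧ (d p).IsPurelyOfType h' j) → B = B' := by
  have := isDedekindScheme_of_smooth f
  obtain ⟨N, hN, ⟨T⟩⟩ := exists_algEquiv_matrix_functionField f D
  have : NeZero N := ⟨hN⟩
  exact mainTheorem6_general C D T A hA
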